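/- Let $m_1,m_2\ge 1$ be integers, $l=m_1+m_2$, and let $e_{i,j}$ be the $l\times l$ matrix units. Put $$W(z,s)=(z-\tfrac12)e_{1,m_1}-s\,e_{1,l}+s\sum_{i=2}^{l}e_{i,i-1}.$$ For $a=1,\dots,l-1$ let $q_a=\frac a{m_1}$ and $K_a=\sum_{j=1}^{a}e_{j,m_1-a+j}$ if $a\le m_1$, and $q_a=\frac{l-a}{m_2}$ and $K_a=-\sum_{j=1}^{l-a}e_{a+j,m_1+j}$ if $a>m_1$. Define the formal functions $$\psi_A(z,s)=\Bigl(\frac s{m_1}\Bigr)^{\frac{z-1/2}{m_1}}\sum_{j\ge0}\frac{(-1)^j s^{\frac l{m_1}j}}{m_1^{\frac{m_2}{m_1}j}m_2^j\,j!}\,\frac1{\Gamma\bigl(\frac{z-\frac12+m_2j}{m_1}+1\bigr)},$$ $$\psi_B(z,s)=\Bigl(\frac s{m_2}\Bigr)^{-\frac{z-1/2}{m_2}}\sum_{j\ge0}\frac{s^{\frac l{m_2}j}}{m_1^j m_2^{\frac{m_1}{m_2}j}\,j!}\,\Gamma\Bigl(\frac{z-\frac12-m_1j}{m_2}\Bigr),$$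 where each Gamma factor stands for its asymptotic expansion as $z\to+\infty$ (Stirling's formula to all orders), so that $\psi_A$ and $\psi_B$ are products of a symbol $e^{\alpha z}z^{\beta z}s^{\gamma z}$ and a series in $z^{-1}$ with rational exponents whose coefficients involve rational powers of $s$; the argument $e^{2\pi\sqrt{-1}k}s$ means that every power $s^{r}$ or $s^{\gamma z+r}$ is multiplied by $e^{2\pi\sqrt{-1}kr}$ or $e^{2\pi\sqrt{-1}k(\gamma z+r)}$. Put $\psi_j(z,s)=\psi_A(z,e^{2\pi\sqrt{-1}(j-1)}s)$ for $1\le j\le m_1$, $\psi_j(z,s)=\psi_B(z,e^{2\pi\sqrt{-1}(l-j)}s)$ for $m_1<j\le l$, and $$\Psi(z,s)=\bigl(\psi_j(z-m_1+i,s)\bigr)_{i,j=1,\dots,l}.$$ With $\xi_{m}=e^{2\pi\sqrt{-1}/m}$, let $$P_a(s)=s^{1-\frac a{m_1}}\,\mathrm{diag}\bigl(1,\xi_{m_1}^{-a},\dots,\xi_{m_1}^{-(m_1-1)a},0,\dots,0\bigr)\quad(1\le a\le m_1),$$ $$P_a(s)=-s^{\frac{a-m_1}{m_2}}\,\mathrm{diag}\bigl(0,\dots,0,\xi_{m_2}^{(m_2-1)(a-l)},\dots,\xi_{m_2}^{a-l},1\bigr)\quad(m_1<a\le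 l-1).$$ Proposition. The matrix $\Psi(z,s)$ is invertible. For every $a=1,\dots,l-1$ the topological difference equation $$M(z-1,s)\,W(z,s)=W(z,s)\,M(z,s)$$ has exactly one formal solution $M_a(z,s)$ in $z^{1-q_a}\,\mathrm{Mat}\bigl(l\times l,\mathbb C(s)((z^{-1}))\bigr)$ of the form $M_a(z,s)=z^{1-q_a}\bigl(K_a+O(z^{-1})\bigr)$, and $$M_a(z,s)=\Psi(z,s)\,P_a(s)\,\Psi(z,s)^{-1}.$$ -/

import Mathlib

set_option maxSynthPendingDepth 3

namespace OrbifoldTDE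

noncomputable section

/-! ### The asymptotic expansion of the Gamma function -/

/-- `f(x) ~ ∑ cₙ x⁻ⁿ` as `x → +∞`, in the sense of Poincaré. -/
def HasAsymptoticExpansion (f : ℝ → ℝ) (c : ℕ → ℝ) : Prop :=
  ∀ N : ℕ, (fun x : ℝ => f x - ∑ n ∈ Finset.range N, c n * (x⁻¹) ^ n)
    =O[Filter.atTop] fun x : ℝ => (x⁻¹) ^ N

/-- `Γ(x + a) / (√(2π) x^(x+a-1/2) e^(-x))`. -/
def stirlingQuotient (a x : ℝ) : ℝ :=
  Real.Gamma (x + a) / (√(2 * Real.pi) * x ^ (x + a - 1 / 2) * Real.exp (-x))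

/-- `log (stirlingQuotient a x)` for large `x`. -/
def logStirling (a x : ℝ) : ℝ :=
  Real.log (Real.Gamma (x + a)) - Real.log √(2 * Real.pi) - (x + a - 1 / 2) * Real.log x + x

open Filter Topology Asymptotics in
theorem logStirling_tendsto (a x : ℝ) (hx : 0 < x) (hxa : 0 < x + a) :
    Tendsto (fun n : ℕ => logStirling a (x + n)) atTop (𝓝 0) := by
  rw [← tendsto_add_atTop_iff_nat 1]
  have hG : ∀ n : ℕ, Real.log (Real.Gamma (x + a + n + 1)) = Real.log (Real.Gamma (x + a)) +
      ∑ m ∈ Finset.range (n + 1), Real.log (x + a + m) := by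
    intro n
    induction n with
    | zero =>
      simp only [Nat.cast_zero, add_zero, zero_add, Finset.sum_range_one]
      rw [Real.Gamma_add_one hxa.ne', Real.log_mul hxa.ne' (Real.Gamma_pos_of_pos hxa).ne']
      ring
    | succ n ih =>
      have hp : 0 < x + a + n + 1 := by positivity
      rw [Finset.sum_range_succ, ← add_assoc, ← ih]
      push_cast
      rw [show x + a + (n + 1) + 1 = (x + a + n + 1) + 1 by ring, Real.Gamma_add_one hp.ne',
        Real.log_mul hp.ne' (Real.Gamma_pos_of_pos hp).ne', ← add_assoc]
      ring
  have t1 := Real.BohrMollerup.tendsto_log_gamma hxa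
  have t2 : Tendsto (fun n => Real.log (Stirling.stirlingSeq n)) atTop (𝓝 (Real.log √Real.pi)) :=
    Stirling.tendsto_stirlingSeq_sqrt_pi.log (Real.sqrt_pos.2 Real.pi_pos).ne'
  have t3 : Tendsto (fun n : ℕ => (n : ℝ) * Real.log (1 + (x + 1) / n)) atTop (𝓝 (x + 1)) :=
    (Real.tendsto_mul_log_one_add_div_atTop (x + 1)).comp tendsto_natCast_atTop_atTop
  have t4 : Tendsto (fun n : ℕ => Real.log (1 + (x + 1) / n)) atTop (𝓝 0) := by
    have : Tendsto (fun n : ℕ => 1 + (x + 1) / (n : ℝ)) atTop (𝓝 (1 + 0)) :=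
      tendsto_const_nhds.add (tendsto_const_div_atTop_nhds_zero_nat _)
    rw [add_zero] at this
    simpa using this.log one_ne_zero
  have key := ((((t2.sub t1).add_const (Real.log (Real.Gamma (x + a)))).sub t3).sub
    (t4.const_mul (x + a + 1 / 2))).add_const (x + 1 - Real.log √Real.pi)
  have h0 : Real.log √Real.pi - Real.log (Real.Gamma (x + a)) + Real.log (Real.Gamma (x + a))
      - (x + 1) - (x + a + 1 / 2) * 0 + (x + 1 - Real.log √Real.pi) = 0 := by ring
  rw [h0] at key
  refine key.congr' ?_
  filter_upwards [eventually_gt_atTop 0] with n hn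
  have hn' : (0 : ℝ) < n := by exact_mod_cast hn
  have e1 : Real.log (1 + (x + 1) / n) = Real.log (x + n + 1) - Real.log n := by
    rw [← Real.log_div (by positivity) hn'.ne']
    congr 1
    field_simp
    ring
  have e2 : Real.log ((n : ℝ) / Real.exp 1) = Real.log n - 1 := by
    rw [Real.log_div hn'.ne' (Real.exp_pos 1).ne', Real.log_exp]
  have e3 : Real.log √(2 * Real.pi) = Real.log 2 / 2 + Real.log √Real.pi := by
    rw [Real.sqrt_mul (by norm_num), Real.log_mul (by positivity) (by positivity),
      Real.log_sqrt (by norm_num)]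
  rw [Stirling.log_stirlingSeq_formula, Real.BohrMollerup.logGammaSeq, e1, e2,
    Real.log_mul (by norm_num) hn'.ne', logStirling, e3]
  push_cast
  rw [show x + ((n : ℝ) + 1) + a = x + a + n + 1 by ring, hG n,
    show x + ((n : ℝ) + 1) = x + n + 1 by ring]
  ring

theorem analyticAt_dslope {f : ℝ → ℝ} (hf : AnalyticAt ℝ f 0) : AnalyticAt ℝ (dslope f 0) 0 := by
  obtain ⟨p, hp⟩ := hf
  exact ⟨_, hp.has_fpower_series_dslope_fslope⟩

theorem mul_dslope (f : ℝ → ℝ) (t : ℝ) : f t = f 0 + t * dslope f 0 t := by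
  have := sub_smul_dslope f 0 t
  simp only [sub_zero, smul_eq_mul] at this
  linarith

theorem analyticAt_log_one_add_mul (a : ℝ) : AnalyticAt ℝ (fun t => Real.log (1 + a * t)) 0 := by
  apply AnalyticAt.log
  · fun_prop
  · simp

/-- `logStirling a (x + 1) - logStirling a x = stirlingStep a x⁻¹`. -/
def stirlingStep (a t : ℝ) : ℝ :=
  Real.log (1 + a * t) - dslope (fun t => Real.log (1 + 1 * t)) 0 t
    - (a + 1 / 2) * Real.log (1 + 1 * t) + 1

theorem logStirling_step (a x : ℝ) (hx : 0 < x) (hxa : 0 < x + a) :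
    logStirling a (x + 1) - logStirling a x = stirlingStep a x⁻¹ := by
  have h1 : Real.log (1 + a * x⁻¹) = Real.log (x + a) - Real.log x := by
    rw [← Real.log_div hxa.ne' hx.ne']
    congr 1
    field_simp
  have h2 : Real.log (1 + 1 * x⁻¹) = Real.log (x + 1) - Real.log x := by
    rw [← Real.log_div (by positivity) hx.ne']
    congr 1
    field_simp
  have h3 : dslope (fun t => Real.log (1 + 1 * t)) 0 x⁻¹
      = x * (Real.log (x + 1) - Real.log x) := by
    have := mul_dslope (fun t => Real.log (1 + 1 * t)) x⁻¹
    simp only [mul_zero, add_zero, Real.log_one, zero_add] at this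
    rw [h2] at this
    rw [this]
    field_simp
  rw [stirlingStep, h1, h2, h3, logStirling, logStirling,
    show x + 1 + a = (x + a) + 1 by ring, Real.Gamma_add_one hxa.ne',
    Real.log_mul hxa.ne' (Real.Gamma_pos_of_pos hxa).ne']
  ring

open Filter Topology in
theorem stirlingStep_eq (a : ℝ) :
    ∃ k : ℝ → ℝ, AnalyticAt ℝ k 0 ∧ ∀ t, stirlingStep a t = t ^ 2 * k t := by
  set f : ℝ → ℝ := fun t => Real.log (1 + 1 * t) with hf
  set L := dslope f 0 with hL
  have fan : AnalyticAt ℝ f 0 := analyticAt_log_one_add_mul 1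
  have Lan : AnalyticAt ℝ L 0 := analyticAt_dslope fan
  have hder : ∀ b : ℝ, HasDerivAt (fun t => Real.log (1 + b * t)) b 0 := by
    intro b
    have h := ((hasDerivAt_id (0 : ℝ)).const_mul b).const_add 1
    have := h.log (by simp)
    simpa using this
  have L0 : L 0 = 1 := by
    rw [hL, dslope_same]
    exact (hder 1).deriv
  have L1 : deriv L 0 = -1 / 2 := by
    have hfd : ∀ᶠ t in 𝓝 (0 : ℝ), (1 + t)⁻¹ = L t + t * deriv L t := by
      have h1 : ∀ᶠ t in 𝓝 (0 : ℝ), 0 < 1 + t := by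
        have : ContinuousAt (fun t : ℝ => 1 + t) 0 := by fun_prop
        exact this.eventually (lt_mem_nhds (by norm_num))
      filter_upwards [h1, Lan.eventually_analyticAt] with t ht hLt
      have d1 : HasDerivAt f (1 + t)⁻¹ t := by
        have h := ((hasDerivAt_id t).const_mul 1).const_add 1
        have := h.log (by simpa using ht.ne')
        simpa [hf] using this
      have d2 : HasDerivAt (fun t => t * L t) (1 * L t + t * deriv L t) t :=
        (hasDerivAt_id t).mul hLt.differentiableAt.hasDerivAt
      have e : f = fun t => t * L t := by
        ext u
        have := mul_dslope f u
        simpa [hf, hL] using this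
      rw [e] at d1
      simpa using d1.unique d2
    have d1 : HasDerivAt (fun t : ℝ => (1 + t)⁻¹) (-1) 0 := by
      have h := ((hasDerivAt_id (0 : ℝ)).const_add 1).inv (by simp)
      have h2 : HasDerivAt (fun t : ℝ => (1 + t)⁻¹) _ 0 := h
      convert h2 using 1
      simp
    have d2 : HasDerivAt (fun t => L t + t * deriv L t)
        (deriv L 0 + (1 * deriv L 0 + 0 * deriv (deriv L) 0)) 0 :=
      Lan.differentiableAt.hasDerivAt.add
        ((hasDerivAt_id (0 : ℝ)).mul Lan.deriv.differentiableAt.hasDerivAt)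
    have := (d1.congr_of_eventuallyEq (hfd.mono fun t ht => ht.symm)).unique d2
    linarith
  have han : AnalyticAt ℝ (stirlingStep a) 0 :=
    (((analyticAt_log_one_add_mul a).sub Lan).sub (analyticAt_const.mul fan)).add analyticAt_const
  have h0 : stirlingStep a 0 = 0 := by
    have : stirlingStep a 0 = Real.log (1 + a * 0) - L 0 - (a + 1 / 2) * f 0 + 1 := rfl
    rw [this, L0, hf]
    simp
  have h1 : dslope (stirlingStep a) 0 0 = 0 := by
    rw [dslope_same]
    have := (((hder a).sub Lan.differentiableAt.hasDerivAt).sub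
      ((hder 1).const_mul (a + 1 / 2))).add_const 1
    have h2 := this.deriv
    rw [L1] at h2
    have h3 : deriv (stirlingStep a) 0 = a - -1 / 2 - (a + 1 / 2) * 1 := h2
    rw [h3]
    ring
  refine ⟨dslope (dslope (stirlingStep a) 0) 0, analyticAt_dslope (analyticAt_dslope han), ?_⟩
  intro t
  have e1 := mul_dslope (stirlingStep a) t
  have e2 := mul_dslope (dslope (stirlingStep a) 0) t
  rw [h0] at e1
  rw [h1] at e2
  rw [e1, e2]
  ring

theorem stirlingStep_expand (a : ℝ) (N : ℕ) :
    ∃ (b : ℕ → ℝ) (k : ℝ → ℝ), AnalyticAt ℝ k 0 ∧ ∀ t, stirlingStep a t =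
      ∑ n ∈ Finset.range N, b n * (t ^ (n + 1) * (((1 + t) ^ (n + 1))⁻¹ - 1))
        + t ^ (N + 2) * k t := by
  induction N with
  | zero =>
    obtain ⟨k, hk, h⟩ := stirlingStep_eq a
    exact ⟨0, k, hk, fun t => by simp [h t]⟩
  | succ N ih =>
    obtain ⟨b, k, hk, h⟩ := ih
    set w : ℝ → ℝ := fun t => ((1 + t) ^ (N + 1))⁻¹ with hw
    have wan : AnalyticAt ℝ w 0 := by
      apply AnalyticAt.inv
      · fun_prop
      · simp
    have w0 : w 0 = 1 := by simp [hw]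
    have w1 : dslope w 0 0 = -(N + 1) := by
      rw [dslope_same]
      have h := (((hasDerivAt_id (0 : ℝ)).const_add 1).pow (N + 1)).inv (by simp)
      have h' := h.deriv
      simp only [id, Pi.pow_apply] at h'
      have h2 : deriv w 0 = _ := h'
      rw [h2]
      simp
    have hN : (N : ℝ) + 1 ≠ 0 := by positivity
    set β : ℝ := -k 0 / (N + 1) with hβ
    set r : ℝ → ℝ := fun t => k t - β * dslope w 0 t with hr
    have ran : AnalyticAt ℝ r 0 := hk.sub (analyticAt_const.mul (analyticAt_dslope wan))
    have r0 : r 0 = 0 := by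
      simp only [hr, w1, hβ]
      field_simp
      ring
    refine ⟨fun n => if n = N then β else b n, dslope r 0, analyticAt_dslope ran, fun t => ?_⟩
    have e1 := mul_dslope w t
    have e2 := mul_dslope r t
    rw [r0] at e2
    rw [w0] at e1
    rw [Finset.sum_range_succ, h t]
    have e3 : ∑ n ∈ Finset.range N, (if n = N then β else b n) *
        (t ^ (n + 1) * (((1 + t) ^ (n + 1))⁻¹ - 1)) =
        ∑ n ∈ Finset.range N, b n * (t ^ (n + 1) * (((1 + t) ^ (n + 1))⁻¹ - 1)) := by
      refine Finset.sum_congr rfl fun n hn => ?_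
      rw [if_neg (Finset.mem_range.1 hn).ne]
    have e4 : ((1 + t) ^ (N + 1))⁻¹ - 1 = t * dslope w 0 t := by
      have : ((1 + t) ^ (N + 1))⁻¹ = w t := rfl
      rw [this, e1]
      ring
    have e5 : k t = β * dslope w 0 t + t * dslope r 0 t := by
      have : r t = k t - β * dslope w 0 t := rfl
      linarith
    simp only [if_true]
    rw [e3, e4, e5]
    ring

open Filter Topology in
theorem abs_le_of_steps (u v : ℝ → ℝ) (x : ℝ)
    (h : ∀ n : ℕ, |u (x + n + 1) - u (x + n)| ≤ v (x + n) - v (x + n + 1))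
    (hu : Tendsto (fun n : ℕ => u (x + n)) atTop (𝓝 0))
    (hv : Tendsto (fun n : ℕ => v (x + n)) atTop (𝓝 0)) : |u x| ≤ v x := by
  have key : ∀ n : ℕ, |u x| ≤ |u (x + n)| + v x - v (x + n) := by
    intro n
    induction n with
    | zero => simp
    | succ n ih =>
      have h1 := h n
      have h2 : |u (x + n)| ≤ |u (x + n + 1)| + |u (x + n + 1) - u (x + n)| := by
        have := abs_sub_abs_le_abs_sub (u (x + n)) (u (x + n + 1))
        rw [abs_sub_comm] at this
        linarith
      push_cast
      rw [← add_assoc]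
      linarith
  have t : Tendsto (fun n : ℕ => |u (x + n)| + v x - v (x + n)) atTop (𝓝 (|0| + v x - 0)) :=
    ((hu.abs).add_const _).sub hv
  have := ge_of_tendsto' t key
  simpa using this

open Filter Topology Asymptotics in
theorem logStirling_expand (a : ℝ) (N : ℕ) :
    ∃ b : ℕ → ℝ, (fun x => logStirling a x - ∑ n ∈ Finset.range N, b n * (x⁻¹) ^ (n + 1))
      =O[atTop] fun x : ℝ => (x⁻¹) ^ (N + 1) := by
  obtain ⟨b, k, hk, h⟩ := stirlingStep_expand a N
  refine ⟨b, ?_⟩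
  obtain ⟨C, hC⟩ : ∃ C, ∀ᶠ t in 𝓝 (0 : ℝ), |k t| ≤ C := by
    refine ⟨|k 0| + 1, ?_⟩
    have := hk.continuousAt.abs.eventually (gt_mem_nhds (lt_add_one |k 0|))
    exact this.mono fun t ht => ht.le
  have hC' := tendsto_inv_atTop_zero.eventually hC
  obtain ⟨X, hX⟩ := eventually_atTop.1 hC'
  set u : ℝ → ℝ := fun x => logStirling a x - ∑ n ∈ Finset.range N, b n * (x⁻¹) ^ (n + 1) with hu
  set v : ℝ → ℝ := fun x => 2 * C * (x⁻¹) ^ (N + 1) with hv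
  refine IsBigO.of_bound (2 * C) ?_
  filter_upwards [eventually_ge_atTop X, eventually_ge_atTop 1, eventually_gt_atTop (-a)]
    with x hxX hx1 hxa
  have hC0 : 0 ≤ C := (abs_nonneg _).trans (hX x hxX)
  have hx0 : 0 < x := by linarith
  have hstep : ∀ y : ℝ, x ≤ y → |u (y + 1) - u y| ≤ v y - v (y + 1) := by
    intro y hy
    have hy0 : 0 < y := by linarith
    have e1 : u (y + 1) - u y = (y⁻¹) ^ (N + 2) * k y⁻¹ := by
      have e := logStirling_step a y hy0 (by linarith)
      rw [h] at e
      have e2 : ∀ n : ℕ, b n * ((y⁻¹) ^ (n + 1) * (((1 + y⁻¹) ^ (n + 1))⁻¹ - 1))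
          = b n * ((y + 1)⁻¹) ^ (n + 1) - b n * (y⁻¹) ^ (n + 1) := by
        intro n
        have : ((1 + y⁻¹) ^ (n + 1))⁻¹ * (y⁻¹) ^ (n + 1) = ((y + 1)⁻¹) ^ (n + 1) := by
          rw [← inv_pow, ← mul_pow]
          congr 1
          field_simp
        rw [← this]
        ring
      simp only [e2, Finset.sum_sub_distrib] at e
      simp only [hu]
      linarith
    rw [e1, abs_mul, abs_of_pos (by positivity)]
    have hk' : |k y⁻¹| ≤ C := hX y (by linarith)
    have hle : (y⁻¹) ^ (N + 2) ≤ 2 * ((y⁻¹) ^ (N + 1) - ((y + 1)⁻¹) ^ (N + 1)) := by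
      have hq : ((y + 1)⁻¹) ^ N ≤ (y⁻¹) ^ N := by
        gcongr
        linarith
      have hq2 : y⁻¹ ^ 2 ≤ 2 * (y⁻¹ - (y + 1)⁻¹) := by
        have : y⁻¹ - (y + 1)⁻¹ = y⁻¹ * (y + 1)⁻¹ := by
          field_simp
          ring
        rw [this]
        have h3 : y⁻¹ ≤ 2 * (y + 1)⁻¹ := by
          rw [← div_eq_mul_inv, inv_eq_one_div, div_le_div_iff₀ hy0 (by linarith)]
          linarith
        nlinarith [inv_pos.2 hy0]
      have hq3 : 0 ≤ (y + 1)⁻¹ := by positivity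
      calc (y⁻¹) ^ (N + 2) = (y⁻¹) ^ N * y⁻¹ ^ 2 := by ring
        _ ≤ (y⁻¹) ^ N * (2 * (y⁻¹ - (y + 1)⁻¹)) := by gcongr
        _ = 2 * ((y⁻¹) ^ (N + 1) - (y⁻¹) ^ N * (y + 1)⁻¹) := by ring
        _ ≤ 2 * ((y⁻¹) ^ (N + 1) - ((y + 1)⁻¹) ^ N * (y + 1)⁻¹) := by gcongr
        _ = _ := by ring
    calc (y⁻¹) ^ (N + 2) * |k y⁻¹|
        ≤ (2 * ((y⁻¹) ^ (N + 1) - ((y + 1)⁻¹) ^ (N + 1))) * C :=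
          mul_le_mul hle hk' (abs_nonneg _) ((by positivity : 0 ≤ (y⁻¹) ^ (N + 2)).trans hle)
      _ = v y - v (y + 1) := by simp only [hv]; ring
  have hinv : Tendsto (fun n : ℕ => (x + n)⁻¹) atTop (𝓝 0) :=
    tendsto_inv_atTop_zero.comp
      (tendsto_atTop_add_const_left _ x tendsto_natCast_atTop_atTop)
  have hpow : ∀ n : ℕ, Tendsto (fun j : ℕ => ((x + j)⁻¹) ^ (n + 1)) atTop (𝓝 0) := by
    intro n
    simpa using hinv.pow (n + 1)
  have hut : Tendsto (fun n : ℕ => u (x + n)) atTop (𝓝 0) := by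
    have t1 := logStirling_tendsto a x hx0 (by linarith)
    have t2 : Tendsto (fun j : ℕ => ∑ n ∈ Finset.range N, b n * ((x + j)⁻¹) ^ (n + 1)) atTop
        (𝓝 (∑ n ∈ Finset.range N, b n * 0)) :=
      tendsto_finsetSum _ fun n _ => (hpow n).const_mul (b n)
    simpa [hu] using t1.sub t2
  have hvt : Tendsto (fun n : ℕ => v (x + n)) atTop (𝓝 0) := by
    simpa [hv] using (hpow N).const_mul (2 * C)
  have := abs_le_of_steps u v x (fun n => hstep _ (by
    have : (0 : ℝ) ≤ n := n.cast_nonneg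
    linarith)) hut hvt
  rw [Real.norm_eq_abs, Real.norm_eq_abs, abs_of_pos (by positivity : 0 < (x⁻¹) ^ (N + 1))]
  exact this

theorem analytic_expand {E : ℝ → ℝ} (hE : AnalyticAt ℝ E 0) (N : ℕ) :
    ∃ (c : ℕ → ℝ) (k : ℝ → ℝ), AnalyticAt ℝ k 0 ∧
      ∀ t, E t = ∑ n ∈ Finset.range N, c n * t ^ n + t ^ N * k t := by
  induction N with
  | zero => exact ⟨0, E, hE, fun t => by simp⟩
  | succ N ih =>
    obtain ⟨c, k, hk, h⟩ := ih
    refine ⟨fun n => if n = N then k 0 else c n, dslope k 0, analyticAt_dslope hk, fun t => ?_⟩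
    have e1 := mul_dslope k t
    have e2 : ∑ n ∈ Finset.range N, (if n = N then k 0 else c n) * t ^ n =
        ∑ n ∈ Finset.range N, c n * t ^ n := by
      refine Finset.sum_congr rfl fun n hn => ?_
      rw [if_neg (Finset.mem_range.1 hn).ne]
    rw [Finset.sum_range_succ, h t]
    simp only [if_true]
    rw [e2, e1]
    ring

open Filter Topology Asymptotics in
theorem stirlingQuotient_expand (a : ℝ) (N : ℕ) :
    ∃ c : ℕ → ℝ, (fun x => stirlingQuotient a x - ∑ n ∈ Finset.range N, c n * (x⁻¹) ^ n)
      =O[atTop] fun x : ℝ => (x⁻¹) ^ N := by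
  obtain ⟨b, hb⟩ := logStirling_expand a N
  set p : ℝ → ℝ := fun t => ∑ n ∈ Finset.range N, b n * t ^ (n + 1) with hp
  have hpan : AnalyticAt ℝ p 0 := by
    apply Finset.analyticAt_fun_sum
    intro n _
    fun_prop
  set E : ℝ → ℝ := fun t => Real.exp (p t) with hEdef
  have hE : AnalyticAt ℝ E 0 := hpan.rexp
  obtain ⟨c, k, hk, h⟩ := analytic_expand hE N
  refine ⟨c, ?_⟩
  set r : ℝ → ℝ := fun x => logStirling a x - p x⁻¹ with hr
  have hb' : r =O[atTop] fun x : ℝ => (x⁻¹) ^ (N + 1) := hb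
  have hpow : (fun x : ℝ => (x⁻¹) ^ (N + 1)) =O[atTop] fun x : ℝ => (x⁻¹) ^ N := by
    refine IsBigO.of_bound 1 ?_
    filter_upwards [eventually_ge_atTop 1] with x hx
    have hx0 : 0 < x := by linarith
    rw [Real.norm_of_nonneg (by positivity), Real.norm_of_nonneg (by positivity), one_mul, pow_succ]
    have h1 : x⁻¹ ≤ 1 := inv_le_one_of_one_le₀ hx
    exact mul_le_of_le_one_right (by positivity) h1
  have hr0 : Tendsto r atTop (𝓝 0) := by
    refine hb'.trans_tendsto ?_
    simpa using (tendsto_inv_atTop_zero (𝕜 := ℝ)).pow (N + 1)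
  have hexp : (fun x => Real.exp (r x) - 1) =O[atTop] r := by
    have h1 : (fun y : ℝ => Real.exp y - 1) =O[𝓝 0] fun y => y := by
      have := (Real.hasDerivAt_exp 0).isBigO_sub
      simpa using this
    exact h1.comp_tendsto hr0
  have hEO : (fun x : ℝ => E x⁻¹) =O[atTop] fun _ => (1 : ℝ) :=
    (hE.continuousAt.tendsto.comp tendsto_inv_atTop_zero).isBigO_one ℝ
  have hkO : (fun x : ℝ => k x⁻¹) =O[atTop] fun _ => (1 : ℝ) :=
    (hk.continuousAt.tendsto.comp tendsto_inv_atTop_zero).isBigO_one ℝ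
  have t1 : (fun x : ℝ => E x⁻¹ * (Real.exp (r x) - 1)) =O[atTop] fun x : ℝ => (x⁻¹) ^ N := by
    simpa using hEO.mul ((hexp.trans hb').trans hpow)
  have t2 : (fun x : ℝ => (x⁻¹) ^ N * k x⁻¹) =O[atTop] fun x : ℝ => (x⁻¹) ^ N := by
    simpa using (isBigO_refl (fun x : ℝ => (x⁻¹) ^ N) atTop).mul hkO
  refine (t1.add t2).congr' ?_ EventuallyEq.rfl
  filter_upwards [eventually_gt_atTop 0, eventually_gt_atTop (-a)] with x hx hxa
  have hxa' : 0 < x + a := by linarith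
  have e1 : stirlingQuotient a x = Real.exp (logStirling a x) := by
    rw [logStirling, Real.exp_add, Real.exp_sub, Real.exp_sub,
      Real.exp_log (Real.Gamma_pos_of_pos hxa'), Real.exp_log (by positivity), stirlingQuotient,
      Real.rpow_def_of_pos hx, mul_comm (Real.log x), Real.exp_neg]
    field_simp
  have e2 : logStirling a x = p x⁻¹ + r x := by
    simp only [hr]
    ring
  have e3 := h x⁻¹
  have e4 : Real.exp (p x⁻¹) = E x⁻¹ := rfl
  rw [e1, e2, Real.exp_add, e4]
  linarith

open Filter Topology Asymptotics in
theorem coeff_eq_zero (N : ℕ) : ∀ c : ℕ → ℝ,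
    ((fun x : ℝ => ∑ n ∈ Finset.range N, c n * (x⁻¹) ^ n) =O[atTop] fun x : ℝ => (x⁻¹) ^ N) →
      ∀ n < N, c n = 0 := by
  induction N with
  | zero => intro c _ n hn; omega
  | succ N ih =>
    intro c hc
    have hpow : ∀ m : ℕ, Tendsto (fun x : ℝ => (x⁻¹) ^ (m + 1)) atTop (𝓝 0) := by
      intro m
      simpa using (tendsto_inv_atTop_zero (𝕜 := ℝ)).pow (m + 1)
    have c0 : c 0 = 0 := by
      have t1 := hc.trans_tendsto (hpow N)
      have t2 : Tendsto (fun x : ℝ => ∑ n ∈ Finset.range (N + 1), c n * (x⁻¹) ^ n) atTop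
          (𝓝 (∑ n ∈ Finset.range N, c (n + 1) * 0 + c 0)) := by
        simp only [Finset.sum_range_succ', pow_zero, mul_one]
        exact (tendsto_finsetSum _ fun n _ => (hpow n).const_mul _).add_const _
      have := tendsto_nhds_unique t2 t1
      simpa using this
    have hc' : (fun x : ℝ => ∑ n ∈ Finset.range N, c (n + 1) * (x⁻¹) ^ n)
        =O[atTop] fun x : ℝ => (x⁻¹) ^ N := by
      have h1 := (isBigO_refl (fun x : ℝ => x) atTop).mul hc
      refine h1.congr' ?_ ?_
      · filter_upwards [eventually_gt_atTop 0] with x hx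
        rw [Finset.sum_range_succ', c0, zero_mul, add_zero, Finset.mul_sum]
        refine Finset.sum_congr rfl fun n _ => ?_
        rw [pow_succ]
        field_simp
      · filter_upwards [eventually_gt_atTop 0] with x hx
        rw [pow_succ]
        field_simp
    intro n hn
    cases n with
    | zero => exact c0
    | succ n => exact ih _ hc' n (by omega)

open Filter Topology Asymptotics in
/-- **Stirling's formula**, to all orders. -/
theorem exists_stirling (a : ℝ) : ∃ c, HasAsymptoticExpansion (stirlingQuotient a) c := by
  choose c hc using stirlingQuotient_expand a
  have hpow : ∀ N : ℕ, (fun x : ℝ => (x⁻¹) ^ (N + 1)) =O[atTop] fun x : ℝ => (x⁻¹) ^ N := by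
    intro N
    refine IsBigO.of_bound 1 ?_
    filter_upwards [eventually_ge_atTop 1] with x hx
    have hx0 : 0 < x := by linarith
    rw [Real.norm_of_nonneg (by positivity), Real.norm_of_nonneg (by positivity), one_mul, pow_succ]
    exact mul_le_of_le_one_right (by positivity) (inv_le_one_of_one_le₀ hx)
  have step : ∀ N n, n < N → c (N + 1) n = c N n := by
    intro N n hn
    have h1 := (hc N).sub ((hc (N + 1)).trans (hpow N))
    have h2 : (fun x : ℝ => c (N + 1) N * (x⁻¹) ^ N) =O[atTop] fun x : ℝ => (x⁻¹) ^ N :=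
      (isBigO_refl _ _).const_mul_left _
    have h3 := coeff_eq_zero N (fun n => c (N + 1) n - c N n) (by
      refine (h1.sub h2).congr_left fun x => ?_
      simp only [Finset.sum_range_succ, sub_mul, Finset.sum_sub_distrib]
      ring) n hn
    simpa [sub_eq_zero] using h3
  have coh : ∀ n j, c (n + 1 + j) n = c (n + 1) n := by
    intro n j
    induction j with
    | zero => rfl
    | succ j ih => rw [← ih, ← add_assoc, step _ _ (by omega)]
  refine ⟨fun n => c (n + 1) n, fun N => ?_⟩
  refine (hc N).congr_left fun x => ?_
  congr 1
  refine Finset.sum_congr rfl fun n hn => ?_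
  obtain ⟨j, rfl⟩ := Nat.exists_eq_add_of_lt (Finset.mem_range.1 hn)
  have h := coh n j
  rw [show n + 1 + j = n + j + 1 by omega] at h
  simp only [h]

/-- The coefficients `γₙ(a)` of the asymptotic expansion
`Γ(x + a) ~ √(2π) x^(x+a-1/2) e^(-x) ∑ γₙ(a) x⁻ⁿ` as `x → +∞`. -/
def stirlingCoeff (a : ℝ) : ℕ → ℝ := (exists_stirling a).choose

theorem stirlingCoeff_spec (a : ℝ) :
    HasAsymptoticExpansion (stirlingQuotient a) (stirlingCoeff a) :=
  (exists_stirling a).choose_spec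

/-! ### Formal functions of `s` and `z` -/

/-- Generalised power series `∑ c_r s^r` in `s`, with rational exponents. -/
abbrev SSeries := HahnSeries ℚ ℂ

/-- Generalised power series `∑ f_r z^(-r)` in `z⁻¹`, with rational exponents and with
coefficients depending on `s`. -/
abbrev ZSeries := HahnSeries ℚ SSeries

/-- Finite formal sums `∑ e^(αz) z^(βz) s^(γz) f(z,s)` with `f` a generalised power series; the
index `(α, β, γ)` stands for the symbol `e^(αz) z^(βz) s^(γz)`, and the product of two symbols is
obtained by adding their indices. -/
abbrev FormalFun := AddMonoidAlgebra ZSeries (ℂ × ℚ × ℚ)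

/-- The formal function `e^(αz) z^(βz) s^(γz) f(z,s)`. -/
def expMul (α : ℂ) (β γ : ℚ) (f : ZSeries) : FormalFun :=
  AddMonoidAlgebra.single (α, β, γ) f

/-- The power `z^r`. -/
def zPow (r : ℚ) : ZSeries := HahnSeries.single (-r) 1

/-- The power `(e^(2πik) s)^r = e^(2πikr) s^r`. -/
def sPow (k : ℤ) (r : ℚ) : SSeries :=
  HahnSeries.single r (Complex.exp (2 * Real.pi * Complex.I * k * r))

/-- The positive real number `m^r`, as a complex number. -/
def natPow (m : ℕ) (r : ℚ) : ℂ := (((m : ℝ) ^ (r : ℝ) : ℝ) : ℂ)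

/-- The formal function `(e^(2πik) s)^(γz + r)`. -/
def sPowLin (k : ℤ) (γ r : ℚ) : FormalFun :=
  expMul (2 * Real.pi * Complex.I * k * γ) 0 γ (HahnSeries.C (sPow k r))

/-- The formal function `m^(γz + r)`. -/
def natPowLin (m : ℕ) (γ r : ℚ) : FormalFun :=
  expMul (γ * Real.log m) 0 0 (HahnSeries.C (HahnSeries.C (natPow m r)))

/-- A power series in `z⁻¹` with constant coefficients, as a generalised power series. -/
def ofPS (p : PowerSeries ℂ) : ZSeries :=
  HahnSeries.ofPowerSeries ℚ SSeries (p.map HahnSeries.C)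

/-! ### The formal functions `Γ(z/m + a)` and `1/Γ(z/m + a)`

Putting `x = z/m` in the expansion of the Gamma function,
`Γ(z/m + a) = e^(-(1 + log m) z/m) z^(z/m) · z^(a-1/2) · √(2π) m^(1/2-a) ∑ γₙ(a) mⁿ z⁻ⁿ`. -/

/-- The power series `√(2π) m^(1/2-a) ∑ γₙ(a) mⁿ z⁻ⁿ` in `z⁻¹`. -/
def gammaSeries (m : ℕ) (a : ℚ) : PowerSeries ℂ :=
  PowerSeries.mk fun n =>
    (√(2 * Real.pi) : ℝ) * natPow m (1 / 2 - a) * (stirlingCoeff a n : ℝ) * (m : ℂ) ^ n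

/-- `Γ(z/m + a)` without its factor `e^(-(1 + log m) z/m) z^(z/m)`. -/
def gammaPart (m : ℕ) (a : ℚ) : ZSeries := zPow (a - 1 / 2) * ofPS (gammaSeries m a)

/-- `1/Γ(z/m + a)` without its factor `e^((1 + log m) z/m) z^(-z/m)`. -/
def recipGammaPart (m : ℕ) (a : ℚ) : ZSeries := zPow (1 / 2 - a) * ofPS (gammaSeries m a)⁻¹

/-! ### Infinite sums of generalised power series -/

theorem support_zPow_mul_ofPS (κ : SSeries) (r : ℚ) (p : PowerSeries ℂ) :
    (HahnSeries.C κ * (zPow r * ofPS p)).support ⊆ {ρ | ∃ n : ℕ, ρ = -r + n} := by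
  intro ρ hρ
  by_contra hne
  apply hρ
  have h1 : (ofPS p).coeff (ρ + r) = 0 := by
    unfold ofPS
    rw [HahnSeries.ofPowerSeries_apply]
    apply HahnSeries.embDomain_of_notMem_range
    rintro ⟨n, hn⟩
    apply hne
    refine ⟨n, ?_⟩
    have : (n : ℚ) = ρ + r := hn
    linarith
  have h2 : (zPow r * ofPS p).coeff ρ = 0 := by
    have := HahnSeries.coeff_single_mul_add (r := (1 : SSeries)) (x := ofPS p) (a := ρ + r) (b := -r)
    rw [show ρ + r + -r = ρ by ring] at this
    rw [zPow, this, h1, mul_zero]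
  rw [HahnSeries.C_apply, HahnSeries.coeff_single_zero_mul, h2, mul_zero]

theorem isPWO_steps (e δ : ℚ) (hδ : 0 < δ) :
    {ρ : ℚ | ∃ j n : ℕ, ρ = e + δ * j + n}.IsPWO := by
  have h1 : (Set.range fun j : ℕ => e + δ * (j : ℚ)).IsPWO := by
    rw [← Set.image_univ]
    refine Set.IsPWO.image_of_monotone (Set.isPWO_of_wellQuasiOrderedLE _) ?_
    intro a b h
    have : (a : ℚ) ≤ b := by exact_mod_cast h
    dsimp only
    nlinarith
  have h2 : (Set.range fun n : ℕ => (n : ℚ)).IsPWO := by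
    rw [← Set.image_univ]
    exact Set.IsPWO.image_of_monotone (Set.isPWO_of_wellQuasiOrderedLE _) Nat.mono_cast
  refine (h1.add h2).mono ?_
  rintro ρ ⟨j, n, rfl⟩
  exact Set.add_mem_add ⟨j, rfl⟩ ⟨n, rfl⟩

/-- A family of series whose `j`-th member has exponents in `e + δj + ℕ`, with `δ > 0`, has a
well-defined formal sum. -/
def stepFamily (e δ : ℚ) (hδ : 0 < δ) (f : ℕ → ZSeries)
    (hf : ∀ j, (f j).support ⊆ {ρ | ∃ n : ℕ, ρ = e + δ * j + n}) :
    HahnSeries.SummableFamily ℚ SSeries ℕ where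
  toFun := f
  isPWO_iUnion_support' := by
    refine (isPWO_steps e δ hδ).mono ?_
    intro ρ hρ
    obtain ⟨j, hj⟩ := Set.mem_iUnion.1 hρ
    obtain ⟨n, hn⟩ := hf j hj
    exact ⟨j, n, hn⟩
  finite_co_support' := by
    intro g
    obtain ⟨B, hB⟩ := exists_nat_gt ((g - e) / δ)
    refine (Set.finite_lt_nat B).subset ?_
    intro j hj
    obtain ⟨n, hn⟩ := hf j hj
    have h0 : (0 : ℚ) ≤ n := n.cast_nonneg
    have : (j : ℚ) ≤ (g - e) / δ := by
      rw [le_div_iff₀ hδ]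
      linarith
    exact_mod_cast this.trans_lt hB

/-! ### The formal quasi-wave functions -/

/-- The terms of the sum over `j` in `ψ_A(z + c, e^(2πik) s)`, where
`1/Γ((z + c - 1/2 + m₂j)/m₁ + 1)` stands without its factor
`e^((1 + log m₁) z/m₁) z^(-z/m₁)`, which does not depend on `j`. -/
def termA (m₁ m₂ : ℕ) (c : ℚ) (k : ℤ) (j : ℕ) : ZSeries :=
  HahnSeries.C
      (HahnSeries.C ((-1) ^ j / (natPow m₁ (m₂ * j / m₁) * (m₂ : ℂ) ^ j * (j.factorial : ℂ)))
        * sPow k ((m₁ + m₂) * j / m₁))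
    * recipGammaPart m₁ ((c - 1 / 2 + m₂ * j) / m₁ + 1)

/-- The terms of the sum over `j` in `ψ_B(z + c, e^(2πik) s)`, where
`Γ((z + c - 1/2 - m₁j)/m₂)` stands without its factor
`e^(-(1 + log m₂) z/m₂) z^(z/m₂)`, which does not depend on `j`. -/
def termB (m₁ m₂ : ℕ) (c : ℚ) (k : ℤ) (j : ℕ) : ZSeries :=
  HahnSeries.C
      (HahnSeries.C (1 / ((m₁ : ℂ) ^ j * natPow m₂ (m₁ * j / m₂) * (j.factorial : ℂ)))
        * sPow k ((m₁ + m₂) * j / m₂))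
    * gammaPart m₂ ((c - 1 / 2 - m₁ * j) / m₂)

/-- The summable family `termA`. -/
def familyA (m₁ m₂ : ℕ) [NeZero m₁] [NeZero m₂] (c : ℚ) (k : ℤ) : HahnSeries.SummableFamily ℚ SSeries ℕ :=
  stepFamily ((c - 1 / 2) / m₁ + 1 / 2) ((m₂ : ℚ) / m₁)
    (div_pos (Nat.cast_pos.2 (NeZero.pos m₂)) (Nat.cast_pos.2 (NeZero.pos m₁)))
    (termA m₁ m₂ c k) (by
      intro j ρ hρ
      obtain ⟨n, hn⟩ := support_zPow_mul_ofPS _ _ _ hρ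
      exact ⟨n, by rw [hn]; ring⟩)

/-- The summable family `termB`. -/
def familyB (m₁ m₂ : ℕ) [NeZero m₁] [NeZero m₂] (c : ℚ) (k : ℤ) : HahnSeries.SummableFamily ℚ SSeries ℕ :=
  stepFamily (1 / 2 - (c - 1 / 2) / m₂) ((m₁ : ℚ) / m₂)
    (div_pos (Nat.cast_pos.2 (NeZero.pos m₁)) (Nat.cast_pos.2 (NeZero.pos m₂)))
    (termB m₁ m₂ c k) (by
      intro j ρ hρ
      obtain ⟨n, hn⟩ := support_zPow_mul_ofPS _ _ _ hρ
      exact ⟨n, by rw [hn]; ring⟩)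

/-- `ψ_A(z + c, e^(2πik) s)`, that is,
`(s/m₁)^((z-1/2)/m₁) ∑_j (-1)^j s^(lj/m₁) / (m₁^(m₂j/m₁) m₂^j j!) · 1/Γ((z-1/2+m₂j)/m₁ + 1)`
with `z + c` and `e^(2πik) s` for `z` and `s`. -/
def psiA (m₁ m₂ : ℕ) [NeZero m₁] [NeZero m₂] (c : ℚ) (k : ℤ) : FormalFun :=
  sPowLin k (1 / m₁) ((c - 1 / 2) / m₁) * natPowLin m₁ (-1 / m₁) (-(c - 1 / 2) / m₁)
    * expMul ((1 + Real.log m₁) / m₁) (-1 / m₁) 0 (familyA m₁ m₂ c k).hsum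

/-- `ψ_B(z + c, e^(2πik) s)`, that is,
`(s/m₂)^(-(z-1/2)/m₂) ∑_j s^(lj/m₂) / (m₁^j m₂^(m₁j/m₂) j!) · Γ((z-1/2-m₁j)/m₂)`
with `z + c` and `e^(2πik) s` for `z` and `s`. -/
def psiB (m₁ m₂ : ℕ) [NeZero m₁] [NeZero m₂] (c : ℚ) (k : ℤ) : FormalFun :=
  sPowLin k (-1 / m₂) (-(c - 1 / 2) / m₂) * natPowLin m₂ (1 / m₂) ((c - 1 / 2) / m₂)
    * expMul (-(1 + Real.log m₂) / m₂) (1 / m₂) 0 (familyB m₁ m₂ c k).hsum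

/-- `ψ_j(z + c, s)`, for `j = 1, …, l`. -/
def psi (m₁ m₂ : ℕ) [NeZero m₁] [NeZero m₂] (j : ℕ) (c : ℚ) : FormalFun :=
  if j ≤ m₁ then psiA m₁ m₂ c ((j : ℤ) - 1) else psiB m₁ m₂ c ((m₁ : ℤ) + m₂ - j)

/-- The matrix `Ψ(z,s)` with entries `Ψ_ij(z,s) = ψ_j(z - m₁ + i, s)`. Rows and columns are
numbered from `1`, so that `i : Fin (m₁ + m₂)` stands for the number `i + 1`. -/
def Psi (m₁ m₂ : ℕ) [NeZero m₁] [NeZero m₂] :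
    Matrix (Fin (m₁ + m₂)) (Fin (m₁ + m₂)) FormalFun :=
  Matrix.of fun i j => psi m₁ m₂ ((j : ℕ) + 1) (-(m₁ : ℚ) + ((i : ℕ) + 1))

/-- The diagonal matrix `P_a(s)`: for `a ≤ m₁` it is
`s^(1-a/m₁) diag(1, ξ^(-a), …, ξ^(-(m₁-1)a), 0, …, 0)` with `ξ = e^(2πi/m₁)`, and for `a > m₁` it is
`-s^((a-m₁)/m₂) diag(0, …, 0, ξ^((m₂-1)(a-l)), …, ξ^(a-l), 1)` with `ξ = e^(2πi/m₂)`. -/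
def P (m₁ m₂ a : ℕ) : Matrix (Fin (m₁ + m₂)) (Fin (m₁ + m₂)) FormalFun :=
  Matrix.diagonal fun i =>
    algebraMap ZSeries FormalFun <| HahnSeries.C <|
      if a ≤ m₁ then
        if (i : ℕ) + 1 ≤ m₁ then
          HahnSeries.C (Complex.exp (2 * Real.pi * Complex.I / m₁) ^ (-((i : ℤ) * a)))
            * sPow 0 (1 - (a : ℚ) / m₁)
        else 0
      else
        if (i : ℕ) + 1 ≤ m₁ then 0
        else
          -(HahnSeries.C (Complex.exp (2 * Real.pi * Complex.I / m₂) ^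
              (((m₁ : ℤ) + m₂ - ((i : ℤ) + 1)) * ((a : ℤ) - (m₁ + m₂))))
            * sPow 0 (((a : ℚ) - m₁) / m₂))

/-! ### The topological difference equation -/

theorem finite_shift_terms (f : ZSeries) (ρ : ℚ) : {n : ℕ | f.coeff (ρ - n) ≠ 0}.Finite := by
  obtain ⟨B, hB⟩ := exists_nat_gt (ρ - f.order)
  refine (Set.finite_lt_nat B).subset ?_
  intro n hn
  have h1 : f.order ≤ ρ - n := HahnSeries.order_le_of_coeff_ne_zero hn
  have h2 : (n : ℚ) < B := by linarith
  exact_mod_cast h2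

/-- The substitution `z ↦ z + c`, given by
`(z + c)^(-σ) = ∑ₙ binom(-σ, n) cⁿ z^(-σ-n)`; by `finite_shift_terms` the sum that defines a
coefficient is finite. -/
def shift (c : ℚ) (f : ZSeries) : ZSeries where
  coeff ρ := ∑ᶠ n : ℕ,
    HahnSeries.C ((Ring.choose ((n : ℚ) - ρ) n * c ^ n : ℚ) : ℂ) * f.coeff (ρ - n)
  isPWO_support' := by
    have h2 : (Set.range fun n : ℕ => (n : ℚ)).IsPWO := by
      rw [← Set.image_univ]
      exact Set.IsPWO.image_of_monotone (Set.isPWO_of_wellQuasiOrderedLE _) Nat.mono_cast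
    refine (f.isPWO_support.add h2).mono ?_
    intro ρ hρ
    have h : ∃ n : ℕ, f.coeff (ρ - n) ≠ 0 := by
      by_contra hne
      push Not at hne
      apply hρ
      simp [hne]
    obtain ⟨n, h⟩ := h
    exact ⟨ρ - n, h, n, ⟨n, rfl⟩, by ring⟩

/-- The matrix unit `e_ij` of size `l`, with rows and columns numbered from `1`. -/
def matrixUnit (R : Type) [Zero R] [One R] (l i j : ℕ) : Matrix (Fin l) (Fin l) R :=
  Matrix.of fun p q => if (p : ℕ) + 1 = i ∧ (q : ℕ) + 1 = j then 1 else 0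

/-- `W(z,s) = (z - 1/2) e_{1,m₁} - s e_{1,l} + s ∑_{i=2}^l e_{i,i-1}`. -/
def W (m₁ m₂ : ℕ) : Matrix (Fin (m₁ + m₂)) (Fin (m₁ + m₂)) ZSeries :=
  (zPow 1 - HahnSeries.C (HahnSeries.C (1 / 2))) • matrixUnit ZSeries (m₁ + m₂) 1 m₁
    - (HahnSeries.C (sPow 0 1) : ZSeries) • matrixUnit ZSeries (m₁ + m₂) 1 (m₁ + m₂)
    + (HahnSeries.C (sPow 0 1) : ZSeries) •
        ∑ i ∈ Finset.Icc 2 (m₁ + m₂), matrixUnit ZSeries (m₁ + m₂) i (i - 1)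

/-- The topological difference equation `M(z-1,s) W(z,s) = W(z,s) M(z,s)`. -/
def IsTDESolution (m₁ m₂ : ℕ) (M : Matrix (Fin (m₁ + m₂)) (Fin (m₁ + m₂)) ZSeries) : Prop :=
  M.map (shift (-1)) * W m₁ m₂ = W m₁ m₂ * M

/-- The numbers `q_a`: `a/m₁` for `a ≤ m₁` and `(l-a)/m₂` for `a > m₁`. -/
def q (m₁ m₂ a : ℕ) : ℚ :=
  if a ≤ m₁ then (a : ℚ) / m₁ else ((m₁ : ℚ) + m₂ - a) / m₂

/-- The matrices `K_a`: `∑_{j=1}^a e_{j,m₁-a+j}` for `a ≤ m₁` and `-∑_{j=1}^{l-a} e_{a+j,m₁+j}` for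
`a > m₁`. -/
def K (R : Type) [Ring R] (m₁ m₂ a : ℕ) : Matrix (Fin (m₁ + m₂)) (Fin (m₁ + m₂)) R :=
  if a ≤ m₁ then ∑ j ∈ Finset.Icc 1 a, matrixUnit R (m₁ + m₂) j (m₁ - a + j)
  else -∑ j ∈ Finset.Icc 1 (m₁ + m₂ - a), matrixUnit R (m₁ + m₂) (a + j) (m₁ + j)

/-- The inclusion of `R((t))` in the series in `t` with rational exponents. -/
def ofLaurent (R : Type) [CommRing R] : HahnSeries ℤ R →+* HahnSeries ℚ R :=
  HahnSeries.embDomainRingHom (Int.castAddHom ℚ) Int.cast_injective fun _ _ => Int.cast_le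

open scoped RatFunc in
/-- The inclusion of the field of rational functions `ℂ(s)` in the field of generalised power
series in `s`. -/
def ofRat : RatFunc ℂ →+* SSeries :=
  (ofLaurent ℂ).comp (algebraMap (RatFunc ℂ) (LaurentSeries ℂ))

/-- The inclusion of `ℂ(s)((z⁻¹))` in the generalised power series in `z⁻¹`. -/
def ofLaurentZ (f : LaurentSeries (RatFunc ℂ)) : ZSeries :=
  ofLaurent SSeries (HahnSeries.map f ofRat)

/-- `M` is a solution in `z^(1-q_a) Mat(l × l, ℂ(s)((z⁻¹)))` of the topological difference equation
such that `M(z,s) = z^(1-q_a) (K_a + O(z⁻¹))`. -/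
def IsNormalizedSolution (m₁ m₂ a : ℕ)
    (M : Matrix (Fin (m₁ + m₂)) (Fin (m₁ + m₂)) ZSeries) : Prop :=
  IsTDESolution m₁ m₂ M ∧
    ∃ N : Matrix (Fin (m₁ + m₂)) (Fin (m₁ + m₂)) (LaurentSeries (RatFunc ℂ)),
      M = zPow (1 - q m₁ m₂ a) • N.map ofLaurentZ ∧
        ∀ i j, ∀ n : ℤ, n < 1 → (N i j - K (LaurentSeries (RatFunc ℂ)) m₁ m₂ a i j).coeff n = 0

end

end OrbifoldTDE

/-!
The columns of `Ψ` are formal solutions of one scalar equation. Write `y(z)` for `ψ_A` or `ψ_B` at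
`e^(2πik) s`. The functional equation `Γ(x + 1) = x Γ(x)`, applied to the terms of the two series,
gives `(z - 1/2) y(z) = s (y(z - m₁) + y(z + m₂))` (`waveA_recurrence`, `waveB_recurrence`), and in
matrix form this says `W(z) Ψ(z) = s Ψ(z - 1)`. Hence every matrix `M = Ψ P Ψ⁻¹` with `P`
independent of `z` satisfies `M(z - 1) W(z) = W(z) M(z)`.

All computations take place in the field `ZSeries`. Each `ψ_j` is a symbol `e^(αz) z^(βz) s^(γz)`
times a series `wave j`, and the symbol becomes a multiplier `u_j` of the shift:
`shift (-1) (wave j c) = u_j * wave j (c - 1)`. That one multiplier serves all terms follows from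
the uniqueness of asymptotic expansions, applied to a product of two Stirling quotients
(`stirlingCoeff_shift`, `shift_gammaPart`). Its leading term is `((e^(2πik) s)/z)^(1/m₁)` for `ψ_A`
and `((e^(2πik) s)/z)^(-1/m₂)` for `ψ_B`, so the leading terms of the `l` multipliers are
different. The structure `IsWaveSystem` collects these facts. They give

* the invertibility of `Ψ` (`IsWaveSystem.det_ne_zero`), by Dedekind's argument for the
  independence of characters: a shortest linear relation between the columns can be subtracted from
  its shift;
* the uniqueness (`IsWaveSystem.eq_zero_of_isTDESolution`): if `D` is the difference of two
  normalized solutions, then `Ψ⁻¹ D Ψ` is diagonal and independent of `z`, and since `D` vanishes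
  at `z = ∞`, the eigenvalues are zero.

It remains to see that `Ψ P_a Ψ⁻¹` is normalized. Its entries have the right shape for two reasons.
The monodromy `z^(-ρ) ↦ e^(2πiρ) z^(-ρ)` permutes the columns of `Ψ` up to sign and multiplies the
eigenvalues in `P_a` by `e^(2πi q_a)`, so that only exponents in `q_a + ℤ` occur
(`exists_exponent_eq`). And up to the factor `s^(-1/2)` the entries of `Ψ`, without symbols, are
series in `s/z` with coefficients in `ℂ(s)` and rational exponents (`exists_ofRatio_wave`), which
yields the rationality in `s`. For the leading coefficient, the difference equation forces it to be
constant along diagonals (`isBand_of_isTDESolution`), so that it is determined by the first `m₁`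
entries of its first row and the last `m₂` entries of its last row; these are read off from the
equation `M Ψ = Ψ P_a` in the columns `1` and `l`, whose entries are ordered by their order in `z`
(`IsWaveSystem.leading_row`).
-/

namespace OrbifoldTDE

/-! ### Calculus of asymptotic expansions -/

section Asymptotics

open Filter Topology Asymptotics

theorem HasAsymptoticExpansion.isBigO_one {f : ℝ → ℝ} {c : ℕ → ℝ}
    (h : HasAsymptoticExpansion f c) : f =O[atTop] fun _ => (1 : ℝ) := by
  simpa using h 0

theorem HasAsymptoticExpansion.congr {f g : ℝ → ℝ} {c : ℕ → ℝ}
    (h : HasAsymptoticExpansion f c) (hfg : f =ᶠ[atTop] g) : HasAsymptoticExpansion g c := by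
  intro N
  refine (h N).congr' ?_ EventuallyEq.rfl
  filter_upwards [hfg] with x hx
  rw [hx]

theorem HasAsymptoticExpansion.unique {f : ℝ → ℝ} {c d : ℕ → ℝ}
    (hc : HasAsymptoticExpansion f c) (hd : HasAsymptoticExpansion f d) : c = d := by
  funext n
  have h := coeff_eq_zero (n + 1) (fun n => d n - c n) (by
    refine ((hc (n + 1)).sub (hd (n + 1))).congr_left fun x => ?_
    simp only [sub_mul, Finset.sum_sub_distrib]
    ring) n (Nat.lt_succ_self n)
  linarith

/-- The binomial series, as an asymptotic expansion. -/
theorem hasAsymptoticExpansion_rpow (c r : ℝ) :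
    HasAsymptoticExpansion (fun x => (1 + c * x⁻¹) ^ r) fun n => Ring.choose r n * c ^ n := by
  intro N
  have h := Real.one_add_rpow_hasFPowerSeriesAt_zero (a := r)
  have t : Tendsto (fun x : ℝ => c * x⁻¹) atTop (𝓝 0) := by
    simpa using tendsto_inv_atTop_zero.const_mul c
  have h1 := (h.isBigO_sub_partialSum_pow N).comp_tendsto t
  have h2 : (fun x : ℝ => ‖c * x⁻¹‖ ^ N) =O[atTop] fun x : ℝ => (x⁻¹) ^ N := by
    refine IsBigO.of_bound (|c| ^ N) (Eventually.of_forall fun x => ?_)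
    simp [mul_pow]
  refine (h1.trans h2).congr_left fun x => ?_
  simp [FormalMultilinearSeries.partialSum, binomialSeries, mul_pow, mul_comm, mul_left_comm,
    mul_assoc]

/-- The expansion of the product is given by the Cauchy product. -/
theorem HasAsymptoticExpansion.mul {f g : ℝ → ℝ} {c d : ℕ → ℝ}
    (hf : HasAsymptoticExpansion f c) (hg : HasAsymptoticExpansion g d) :
    HasAsymptoticExpansion (fun x => f x * g x)
      fun n => ∑ k ∈ Finset.range (n + 1), c k * d (n - k) := by
  intro N
  set F : ℝ → ℝ := fun x => ∑ n ∈ Finset.range N, c n * (x⁻¹) ^ n with hF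
  have h1 : (fun x => (f x - F x) * g x) =O[atTop] fun x : ℝ => (x⁻¹) ^ N := by
    simpa only [mul_one] using (hf N).mul hg.isBigO_one
  have h2 : (fun x => ∑ k ∈ Finset.range N, c k * (x⁻¹) ^ k *
      (g x - ∑ n ∈ Finset.range (N - k), d n * (x⁻¹) ^ n))
      =O[atTop] fun x : ℝ => (x⁻¹) ^ N := by
    refine IsBigO.fun_sum fun k hk => ?_
    have := ((isBigO_refl (fun x : ℝ => (x⁻¹) ^ k) atTop).const_mul_left (c k)).mul (hg (N - k))
    refine this.congr_right fun x => ?_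
    rw [← pow_add, Nat.add_sub_cancel' (Finset.mem_range.1 hk).le]
  refine (h1.add h2).congr_left fun x => ?_
  have e : ∑ n ∈ Finset.range N, (∑ k ∈ Finset.range (n + 1), c k * d (n - k)) * (x⁻¹) ^ n =
      ∑ k ∈ Finset.range N, c k * (x⁻¹) ^ k *
        ∑ n ∈ Finset.range (N - k), d n * (x⁻¹) ^ n := by
    simp only [Finset.sum_mul, Finset.mul_sum, Finset.range_eq_Ico]
    rw [Finset.sum_sigma', Finset.sum_sigma']
    refine Finset.sum_nbij' (fun p => ⟨p.2, p.1 - p.2⟩) (fun p => ⟨p.1 + p.2, p.1⟩)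
      ?_ ?_ ?_ ?_ ?_
    · rintro ⟨n, k⟩ h
      simp only [Finset.mem_sigma, Finset.mem_Ico] at h ⊢
      omega
    · rintro ⟨n, k⟩ h
      simp only [Finset.mem_sigma, Finset.mem_Ico] at h ⊢
      omega
    · rintro ⟨n, k⟩ h
      simp only [Finset.mem_sigma, Finset.mem_Ico] at h ⊢
      congr 1
      omega
    · rintro ⟨n, k⟩ h
      simp
    · rintro ⟨n, k⟩ h
      simp only [Finset.mem_sigma, Finset.mem_Ico] at h ⊢
      have : (x⁻¹) ^ n = (x⁻¹) ^ k * (x⁻¹) ^ (n - k) := by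
        rw [← pow_add, Nat.add_sub_cancel' (by omega)]
      rw [this]
      ring
  rw [e]
  simp only [mul_sub, Finset.sum_sub_distrib, hF, ← Finset.sum_mul]
  ring

/-- The coefficients of `(1 + c/z)^r ∑ pₖ (z + c)⁻ᵏ` as a series in `z⁻¹`. -/
def shiftCoeff {R : Type*} [CommRing R] [BinomialRing R] (c r : R) (p : ℕ → R) (n : ℕ) : R :=
  ∑ k ∈ Finset.range (n + 1), p k * (Ring.choose (r - k) (n - k) * c ^ (n - k))

theorem HasAsymptoticExpansion.shift {f : ℝ → ℝ} {p : ℕ → ℝ} (hf : HasAsymptoticExpansion f p)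
    (c r : ℝ) : HasAsymptoticExpansion (fun x => (1 + c * x⁻¹) ^ r * f (x + c))
      (shiftCoeff c r p) := by
  intro N
  have ht : Tendsto (fun x : ℝ => x + c) atTop atTop := tendsto_atTop_add_const_right _ _ tendsto_id
  have hinv : (fun x : ℝ => (x + c)⁻¹) =O[atTop] fun x : ℝ => x⁻¹ := by
    refine IsBigO.of_bound 2 ?_
    filter_upwards [eventually_gt_atTop 0, eventually_gt_atTop (2 * |c|)] with x hx hxc
    have h1 := neg_abs_le c
    have h2 : x / 2 ≤ x + c := by linarith
    rw [Real.norm_of_nonneg (by rw [inv_nonneg]; linarith), Real.norm_of_nonneg (by positivity)]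
    calc (x + c)⁻¹ ≤ (x / 2)⁻¹ := by gcongr
      _ = 2 * x⁻¹ := by field_simp
  have h1 : (fun x => (1 + c * x⁻¹) ^ r *
      (f (x + c) - ∑ k ∈ Finset.range N, p k * ((x + c)⁻¹) ^ k))
      =O[atTop] fun x : ℝ => (x⁻¹) ^ N := by
    have := (hasAsymptoticExpansion_rpow c r).isBigO_one.mul
      (((hf N).comp_tendsto ht).trans (hinv.pow N))
    simpa using this
  have h2 : (fun x => ∑ k ∈ Finset.range N, p k * (x⁻¹) ^ k * ((1 + c * x⁻¹) ^ (r - k) -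
      ∑ n ∈ Finset.range (N - k), Ring.choose (r - k) n * c ^ n * (x⁻¹) ^ n))
      =O[atTop] fun x : ℝ => (x⁻¹) ^ N := by
    refine IsBigO.fun_sum fun k hk => ?_
    have := ((isBigO_refl (fun x : ℝ => (x⁻¹) ^ k) atTop).const_mul_left (p k)).mul
      (hasAsymptoticExpansion_rpow c (r - k) (N - k))
    refine this.congr_right fun x => ?_
    rw [← pow_add, Nat.add_sub_cancel' (Finset.mem_range.1 hk).le]
  refine (h1.add h2).congr' ?_ EventuallyEq.rfl
  filter_upwards [eventually_gt_atTop 0, eventually_gt_atTop (-c)] with x hx hxc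
  have hb : 0 < 1 + c * x⁻¹ := by
    have : 1 + c * x⁻¹ = (x + c) * x⁻¹ := by field_simp
    rw [this]
    have : 0 < x + c := by linarith
    positivity
  have e1 : ∀ k : ℕ, (x⁻¹) ^ k * (1 + c * x⁻¹) ^ (r - k) =
      (1 + c * x⁻¹) ^ r * ((x + c)⁻¹) ^ k := by
    intro k
    have : (x + c)⁻¹ = x⁻¹ * (1 + c * x⁻¹)⁻¹ := by
      rw [← mul_inv]
      congr 1
      field_simp
    rw [Real.rpow_sub hb, Real.rpow_natCast, this, mul_pow, inv_pow (1 + c * x⁻¹)]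
    field_simp
  have e : ∑ n ∈ Finset.range N, shiftCoeff c r p n * (x⁻¹) ^ n =
      ∑ k ∈ Finset.range N, p k * (x⁻¹) ^ k *
        ∑ n ∈ Finset.range (N - k), Ring.choose (r - k) n * c ^ n * (x⁻¹) ^ n := by
    simp only [shiftCoeff, Finset.sum_mul, Finset.mul_sum]
    rw [Finset.sum_sigma', Finset.sum_sigma']
    refine Finset.sum_nbij' (fun p => ⟨p.2, p.1 - p.2⟩) (fun p => ⟨p.1 + p.2, p.1⟩)
      ?_ ?_ ?_ ?_ ?_
    · rintro ⟨n, k⟩ h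
      simp only [Finset.mem_sigma, Finset.mem_range] at h ⊢
      omega
    · rintro ⟨n, k⟩ h
      simp only [Finset.mem_sigma, Finset.mem_range] at h ⊢
      omega
    · rintro ⟨n, k⟩ h
      simp only [Finset.mem_sigma, Finset.mem_range] at h ⊢
      congr 1
      omega
    · rintro ⟨n, k⟩ h
      simp
    · rintro ⟨n, k⟩ h
      simp only [Finset.mem_sigma, Finset.mem_range] at h ⊢
      have : (x⁻¹) ^ n = (x⁻¹) ^ k * (x⁻¹) ^ (n - k) := by
        rw [← pow_add, Nat.add_sub_cancel' (by omega)]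
      rw [this]
      ring
  rw [e]
  simp only [mul_sub, Finset.sum_sub_distrib, Finset.mul_sum, mul_assoc, e1]
  simp only [mul_left_comm]
  ring

/-! ### Functional equations of the Stirling series -/

theorem stirlingCoeff_zero (a : ℝ) : stirlingCoeff a 0 = 1 := by
  obtain ⟨b, hb⟩ := logStirling_expand a 0
  have h0 : Tendsto (logStirling a) atTop (𝓝 0) := by
    have : logStirling a =O[atTop] fun x : ℝ => (x⁻¹) ^ (0 + 1) := by simpa using hb
    refine this.trans_tendsto ?_
    simpa using (tendsto_inv_atTop_zero (𝕜 := ℝ))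
  have h1 : Tendsto (stirlingQuotient a) atTop (𝓝 1) := by
    have h2 := (Real.continuous_exp.tendsto 0).comp h0
    rw [Real.exp_zero] at h2
    refine h2.congr' ?_
    filter_upwards [eventually_gt_atTop 0, eventually_gt_atTop (-a)] with x hx hxa
    have hxa' : 0 < x + a := by linarith
    simp only [Function.comp]
    rw [logStirling, Real.exp_add, Real.exp_sub, Real.exp_sub,
      Real.exp_log (Real.Gamma_pos_of_pos hxa'), Real.exp_log (by positivity), stirlingQuotient,
      Real.rpow_def_of_pos hx, mul_comm (Real.log x), Real.exp_neg]
    field_simp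
  have h2 : Tendsto (fun x => stirlingQuotient a x - stirlingCoeff a 0) atTop (𝓝 0) := by
    have := stirlingCoeff_spec a 1
    simp only [Finset.range_one, Finset.sum_singleton, pow_zero, mul_one, pow_one] at this
    exact this.trans_tendsto tendsto_inv_atTop_zero
  have := tendsto_nhds_unique h2 (h1.sub_const _)
  linarith

/-- The functional equation `Γ(x + a + 1) = (x + a) Γ(x + a)`. -/
theorem stirlingCoeff_add_one_succ (a : ℝ) (n : ℕ) :
    stirlingCoeff (a + 1) (n + 1) = stirlingCoeff a (n + 1) + a * stirlingCoeff a n := by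
  have h1 := (hasAsymptoticExpansion_rpow a 1).mul (stirlingCoeff_spec a)
  have h2 := h1.congr (g := stirlingQuotient (a + 1)) (by
    filter_upwards [eventually_gt_atTop 0, eventually_gt_atTop (-a)] with x hx hxa
    have hxa' : 0 < x + a := by linarith
    rw [Real.rpow_one, stirlingQuotient, stirlingQuotient, ← add_assoc,
      Real.Gamma_add_one hxa'.ne', show x + a + 1 - 1 / 2 = (x + a - 1 / 2) + 1 by ring,
      Real.rpow_add_one hx.ne']
    field_simp)
  have h3 := congrFun (h2.unique (stirlingCoeff_spec (a + 1))) (n + 1)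
  rw [← h3, Finset.sum_range_succ', Finset.sum_range_succ']
  have : ∀ k : ℕ, Ring.choose (1 : ℝ) (k + 1 + 1) = 0 := by
    intro k
    have := Ring.choose_natCast (R := ℝ) 1 (k + 1 + 1)
    rw [Nat.cast_one] at this
    rw [this, Nat.choose_eq_zero_of_lt (by omega), Nat.cast_zero]
  simp only [this]
  simp
  ring

/-- `Γ((z + c)/m + a) = Γ(z/m + (a + c/m))` for the Stirling series. The normalizing factors of the
two sides have a quotient that is not a power series; it does not depend on `a`, and comparing two
values of `a` eliminates it. -/
theorem stirlingCoeff_shift (m : ℕ) [NeZero m] (c a b : ℝ) :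
    (fun n => ∑ k ∈ Finset.range (n + 1),
      shiftCoeff c (a - 1 / 2) (fun i => stirlingCoeff a i * (m : ℝ) ^ i) k *
        (stirlingCoeff (b + c / m) (n - k) * (m : ℝ) ^ (n - k))) =
    fun n => ∑ k ∈ Finset.range (n + 1),
      shiftCoeff c (b - 1 / 2) (fun i => stirlingCoeff b i * (m : ℝ) ^ i) k *
        (stirlingCoeff (a + c / m) (n - k) * (m : ℝ) ^ (n - k)) := by
  have hm : (0 : ℝ) < m := by exact_mod_cast NeZero.pos m
  have hs : ∀ a, HasAsymptoticExpansion (fun z => stirlingQuotient a (z / m))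
      (fun i => stirlingCoeff a i * (m : ℝ) ^ i) := by
    intro a N
    have ht : Tendsto (fun x : ℝ => x / m) atTop atTop := tendsto_id.atTop_div_const hm
    have h1 := (stirlingCoeff_spec a N).comp_tendsto ht
    have h2 : (fun x : ℝ => ((x / m)⁻¹) ^ N) =O[atTop] fun x : ℝ => (x⁻¹) ^ N := by
      refine IsBigO.of_bound ((m : ℝ) ^ N) (Eventually.of_forall fun x => ?_)
      rw [← Real.norm_of_nonneg (by positivity : 0 ≤ (m : ℝ) ^ N), ← norm_mul, ← mul_pow, inv_div,
        div_eq_mul_inv]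
    refine (h1.trans h2).congr_left fun x => ?_
    simp only [Function.comp]
    congr 1
    refine Finset.sum_congr rfl fun n _ => ?_
    rw [inv_div, div_pow, inv_pow, div_eq_mul_inv, mul_assoc]
  have key := fun a b => ((hs a).shift c (a - 1 / 2)).mul (hs (b + c / m))
  refine (key a b).unique ((key b a).congr ?_)
  filter_upwards [eventually_gt_atTop 0, eventually_gt_atTop (-c)] with x hx hxc
  have hb : 0 < 1 + c * x⁻¹ := by
    have : 1 + c * x⁻¹ = (x + c) * x⁻¹ := by field_simp
    rw [this]
    have : 0 < x + c := by linarith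
    positivity
  have hxc' : 0 < x + c := by linarith
  have e : ∀ a b, (1 + c * x⁻¹) ^ (a - 1 / 2) * stirlingQuotient a ((x + c) / m) *
      stirlingQuotient (b + c / m) (x / m) =
      Real.Gamma ((x + c) / m + a) * Real.Gamma ((x + c) / m + b) *
      ((√(2 * Real.pi) * ((x + c) / m) ^ ((x + c) / m) * Real.exp (-((x + c) / m)))⁻¹ *
      (√(2 * Real.pi) * Real.exp (-(x / m)))⁻¹ *
        ((x / m) ^ ((x + c) / m + (a + b) - 1))⁻¹) := by
    intro a b
    have h1 : 1 + c * x⁻¹ = ((x + c) / m) / (x / m) := by field_simp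
    rw [h1, Real.div_rpow (by positivity) (by positivity), stirlingQuotient, stirlingQuotient,
      show x / m + (b + c / m) = (x + c) / m + b by ring,
      show (x + c) / m + a - 1 / 2 = (x + c) / m + (a - 1 / 2) by ring,
      show (x + c) / m + (a + b) - 1 = ((x + c) / m + b - 1 / 2) + (a - 1 / 2) by ring,
      Real.rpow_add (by positivity), Real.rpow_add (by positivity)]
    field_simp
  -- Both products have the form `e`, which is symmetric in `a` and `b`.
  rw [e, e, add_comm b a]
  ring

end Asymptotics

noncomputable section

/-! ### Series that vanish to a given order -/

section VanishesBelow

variable {R : Type*} [CommRing R]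

/-- The exponents that occur in `f` are at least `r`; for series in `z⁻¹` this is
`f = O(z^(-r))`. -/
def VanishesBelow (r : ℚ) (f : HahnSeries ℚ R) : Prop := ∀ ρ < r, f.coeff ρ = 0

namespace VanishesBelow

variable {r s : ℚ} {f g : HahnSeries ℚ R}

theorem zero : VanishesBelow r (0 : HahnSeries ℚ R) := fun _ _ => rfl

theorem mono (h : VanishesBelow r f) (hsr : s ≤ r) : VanishesBelow s f :=
  fun ρ hρ => h ρ (hρ.trans_le hsr)

theorem add (hf : VanishesBelow r f) (hg : VanishesBelow r g) : VanishesBelow r (f + g) :=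
  fun ρ hρ => by rw [HahnSeries.coeff_add, hf ρ hρ, hg ρ hρ, add_zero]

theorem neg (hf : VanishesBelow r f) : VanishesBelow r (-f) :=
  fun ρ hρ => by rw [HahnSeries.coeff_neg, hf ρ hρ, neg_zero]

theorem sub (hf : VanishesBelow r f) (hg : VanishesBelow r g) : VanishesBelow r (f - g) := by
  rw [sub_eq_add_neg]
  exact hf.add hg.neg

theorem sum {ι : Type*} {S : Finset ι} {f : ι → HahnSeries ℚ R}
    (h : ∀ i ∈ S, VanishesBelow r (f i)) : VanishesBelow r (∑ i ∈ S, f i) :=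
  fun ρ hρ => by
    rw [HahnSeries.coeff_sum]
    exact Finset.sum_eq_zero fun i hi => h i hi ρ hρ

theorem mul (hf : VanishesBelow r f) (hg : VanishesBelow s g) : VanishesBelow (r + s) (f * g) := by
  intro ρ hρ
  rw [HahnSeries.coeff_mul]
  refine Finset.sum_eq_zero fun ij hij => ?_
  obtain ⟨h1, h2, h3⟩ := Finset.mem_antidiagonal.1 hij
  have h4 : r ≤ ij.1 := le_of_not_gt fun h => h1 (hf _ h)
  have h5 : s ≤ ij.2 := le_of_not_gt fun h => h2 (hg _ h)
  linarith

theorem single (h : r ≤ s) (x : R) : VanishesBelow r (HahnSeries.single s x) :=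
  fun _ hρ => HahnSeries.coeff_single_of_ne (hρ.trans_le h).ne

theorem order (f : HahnSeries ℚ R) : VanishesBelow f.order f :=
  fun _ hρ => HahnSeries.coeff_eq_zero_of_lt_order hρ

/-- A series with exponents `≥ r` is its term of exponent `r` if the next exponent is `≥ s`. -/
theorem sub_single (h : ∀ ρ, ρ < s → ρ ≠ r → f.coeff ρ = 0) :
    VanishesBelow s (f - HahnSeries.single r (f.coeff r)) := by
  intro ρ hρ
  rw [HahnSeries.coeff_sub]
  by_cases hr : ρ = r
  · rw [hr, HahnSeries.coeff_single_same, sub_self]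
  · rw [h ρ hρ hr, HahnSeries.coeff_single_of_ne hr, sub_zero]

end VanishesBelow

end VanishesBelow

/-! ### The shift is a ring homomorphism -/

/-- The rational numbers as coefficients. -/
def ratC : ℚ →+* SSeries := HahnSeries.C.comp (algebraMap ℚ ℂ)

/-- The series with the coefficients `binom(-σ, n) cⁿ f_σ`. -/
def binomialWeight (c : ℚ) (n : ℕ) (f : ZSeries) : ZSeries where
  coeff σ := ratC (Ring.choose (-σ) n * c ^ n) * f.coeff σ
  isPWO_support' := f.isPWO_support.mono fun σ hσ h => hσ (by simp [h])

/-- The term `cⁿ/n! dⁿf/dzⁿ` of the Taylor expansion of `f(z + c)`. -/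
def taylorTerm (c : ℚ) (n : ℕ) (f : ZSeries) : ZSeries :=
  HahnSeries.single (n : ℚ) 1 * binomialWeight c n f

theorem coeff_taylorTerm (c : ℚ) (n : ℕ) (f : ZSeries) (ρ : ℚ) :
    (taylorTerm c n f).coeff ρ = ratC (Ring.choose ((n : ℚ) - ρ) n * c ^ n) * f.coeff (ρ - n) := by
  rw [taylorTerm, HahnSeries.coeff_single_mul, one_mul]
  change ratC (Ring.choose (-(ρ - n)) n * c ^ n) * _ = _
  rw [neg_sub]

theorem coeff_shift (c : ℚ) (f : ZSeries) (ρ : ℚ) :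
    (shift c f).coeff ρ = ∑ᶠ n : ℕ, (taylorTerm c n f).coeff ρ := by
  simp only [coeff_taylorTerm]
  rfl

/-- Leibniz' rule, which amounts to the Chu-Vandermonde identity. -/
theorem binomialWeight_mul (c : ℚ) (n : ℕ) (f g : ZSeries) :
    binomialWeight c n (f * g) =
      ∑ p ∈ Finset.HasAntidiagonal.antidiagonal n,
        binomialWeight c p.1 f * binomialWeight c p.2 g := by
  ext1
  funext ρ
  have hsub : ∀ (k : ℕ) (h : ZSeries), (binomialWeight c k h).support ⊆ h.support :=
    fun k h σ hσ hz => hσ (by change _ * h.coeff σ = 0; rw [hz, mul_zero])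
  have h1 : ∀ p : ℕ × ℕ, (binomialWeight c p.1 f * binomialWeight c p.2 g).coeff ρ =
      ∑ ij ∈ Finset.antidiagonal f.isPWO_support g.isPWO_support ρ,
        (ratC (Ring.choose (-ij.1) p.1 * c ^ p.1) * f.coeff ij.1) *
          (ratC (Ring.choose (-ij.2) p.2 * c ^ p.2) * g.coeff ij.2) := by
    intro p
    rw [HahnSeries.coeff_mul]
    refine Finset.sum_subset (fun ij hij => ?_) ?_
    · obtain ⟨h1, h2, h3⟩ := Finset.mem_antidiagonal.1 hij
      exact Finset.mem_antidiagonal.2 ⟨hsub _ _ h1, hsub _ _ h2, h3⟩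
    intro ij hij hij'
    obtain ⟨-, -, h3⟩ := Finset.mem_antidiagonal.1 hij
    by_contra hne
    exact hij' (Finset.mem_antidiagonal.2
      ⟨left_ne_zero_of_mul hne, right_ne_zero_of_mul hne, h3⟩)
  rw [HahnSeries.coeff_sum]
  simp only [h1]
  rw [Finset.sum_comm]
  change ratC (Ring.choose (-ρ) n * c ^ n) * (f * g).coeff ρ = _
  rw [HahnSeries.coeff_mul, Finset.mul_sum]
  refine Finset.sum_congr rfl fun ij hij => ?_
  obtain ⟨-, -, h3⟩ := Finset.mem_antidiagonal.1 hij
  rw [← h3, neg_add, Ring.add_choose_eq n (Commute.all _ _), Finset.sum_mul, map_sum,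
    Finset.sum_mul]
  refine Finset.sum_congr rfl fun p hp => ?_
  rw [← Finset.HasAntidiagonal.mem_antidiagonal.1 hp, pow_add]
  simp only [map_mul]
  ring

theorem taylorTerm_mul (c : ℚ) (n : ℕ) (f g : ZSeries) :
    taylorTerm c n (f * g) =
      ∑ p ∈ Finset.HasAntidiagonal.antidiagonal n, taylorTerm c p.1 f * taylorTerm c p.2 g := by
  rw [taylorTerm, binomialWeight_mul, Finset.mul_sum]
  refine Finset.sum_congr rfl fun p hp => ?_
  have : (HahnSeries.single (n : ℚ) 1 : ZSeries) =
      HahnSeries.single (p.1 : ℚ) 1 * HahnSeries.single (p.2 : ℚ) 1 := by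
    rw [HahnSeries.single_mul_single, one_mul, ← Nat.cast_add,
      Finset.HasAntidiagonal.mem_antidiagonal.1 hp]
  rw [this, taylorTerm, taylorTerm]
  ring

theorem VanishesBelow.taylorTerm {r : ℚ} {f : ZSeries} (h : VanishesBelow r f) (c : ℚ) (n : ℕ) :
    VanishesBelow (r + n) (taylorTerm c n f) := by
  intro ρ hρ
  rw [coeff_taylorTerm, h _ (by linarith), mul_zero]

theorem VanishesBelow.shift_sub_sum {r : ℚ} {f : ZSeries} (h : VanishesBelow r f) (c : ℚ) (B : ℕ) :
    VanishesBelow (r + B) (shift c f - ∑ n ∈ Finset.range B, OrbifoldTDE.taylorTerm c n f) := by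
  intro ρ hρ
  rw [HahnSeries.coeff_sub, HahnSeries.coeff_sum, coeff_shift,
    finsum_eq_sum_of_support_subset (s := Finset.range B), sub_self]
  intro n hn
  by_contra hB
  apply hn
  have hB' : (B : ℚ) ≤ n := by
    simpa using hB
  exact h.taylorTerm c n ρ (by linarith)

theorem VanishesBelow.shift {r : ℚ} {f : ZSeries} (h : VanishesBelow r f) (c : ℚ) :
    VanishesBelow r (OrbifoldTDE.shift c f) := by
  simpa using h.shift_sub_sum c 0

@[simp] theorem taylorTerm_zero (c : ℚ) (f : ZSeries) : taylorTerm c 0 f = f := by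
  ext1
  funext ρ
  simp [coeff_taylorTerm]

/-- The shift does not change the leading term. -/
theorem VanishesBelow.shift_sub {r : ℚ} {f : ZSeries} (h : VanishesBelow r f) (c : ℚ) :
    VanishesBelow (r + 1) (OrbifoldTDE.shift c f - f) := by
  simpa using h.shift_sub_sum c 1

theorem shift_mul (c : ℚ) (f g : ZSeries) : shift c (f * g) = shift c f * shift c g := by
  rw [← sub_eq_zero]
  ext1
  funext ρ
  obtain ⟨B, hB⟩ := exists_nat_gt (ρ - (f.order + g.order))
  have hf := VanishesBelow.order f
  have hg := VanishesBelow.order g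
  -- Modulo terms of order `≥ ord f + ord g + B`, both sides are equal to
  -- `∑_{i < B} (taylorTerm c i f) * shift c g`.
  have h1 := (hf.mul hg).shift_sub_sum c B
  have e : ∑ n ∈ Finset.range B, taylorTerm c n (f * g) =
      ∑ i ∈ Finset.range B, taylorTerm c i f * ∑ j ∈ Finset.range (B - i), taylorTerm c j g := by
    simp only [taylorTerm_mul, Finset.Nat.sum_antidiagonal_eq_sum_range_succ
      (fun i j => taylorTerm c i f * taylorTerm c j g), Finset.mul_sum]
    rw [Finset.sum_sigma', Finset.sum_sigma']
    refine Finset.sum_nbij' (fun p => ⟨p.2, p.1 - p.2⟩) (fun p => ⟨p.1 + p.2, p.1⟩)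
      ?_ ?_ ?_ ?_ ?_
    · rintro ⟨n, k⟩ h
      simp only [Finset.mem_sigma, Finset.mem_range] at h ⊢
      omega
    · rintro ⟨n, k⟩ h
      simp only [Finset.mem_sigma, Finset.mem_range] at h ⊢
      omega
    · rintro ⟨n, k⟩ h
      simp only [Finset.mem_sigma, Finset.mem_range] at h ⊢
      congr 1
      omega
    · rintro ⟨n, k⟩ h
      simp
    · rintro ⟨n, k⟩ h
      rfl
  have h2 : VanishesBelow (f.order + g.order + B) (∑ i ∈ Finset.range B, taylorTerm c i f *
      (shift c g - ∑ j ∈ Finset.range (B - i), taylorTerm c j g)) := by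
    refine VanishesBelow.sum fun i hi => ?_
    refine ((hf.taylorTerm c i).mul (hg.shift_sub_sum c (B - i))).mono ?_
    rw [Nat.cast_sub (Finset.mem_range.1 hi).le]
    linarith
  have h3 : VanishesBelow (f.order + g.order + B)
      ((shift c f - ∑ n ∈ Finset.range B, taylorTerm c n f) * shift c g) :=
    ((hf.shift_sub_sum c B).mul (hg.shift c)).mono (by linarith)
  have h4 := (h1.sub h2).sub h3
  have : shift c (f * g) - shift c f * shift c g =
      shift c (f * g) - ∑ n ∈ Finset.range B, taylorTerm c n (f * g) -
      (∑ i ∈ Finset.range B, taylorTerm c i f *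
        (shift c g - ∑ j ∈ Finset.range (B - i), taylorTerm c j g)) -
      (shift c f - ∑ n ∈ Finset.range B, taylorTerm c n f) * shift c g := by
    rw [e]
    simp only [mul_sub, Finset.sum_sub_distrib, ← Finset.sum_mul, sub_mul]
    abel
  rw [this]
  exact h4 ρ (by linarith)

theorem shift_add (c : ℚ) (f g : ZSeries) : shift c (f + g) = shift c f + shift c g := by
  rw [← sub_eq_zero]
  ext1
  funext ρ
  have key : ∀ r : ℚ, VanishesBelow r f → VanishesBelow r g →
      (shift c (f + g) - (shift c f + shift c g)).coeff ρ = 0 := by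
    intro r hf hg
    obtain ⟨B, hB⟩ := exists_nat_gt (ρ - r)
    have h := (((hf.add hg).shift_sub_sum c B).sub (hf.shift_sub_sum c B)).sub
      (hg.shift_sub_sum c B)
    have e : ∀ n, taylorTerm c n (f + g) = taylorTerm c n f + taylorTerm c n g := by
      intro n
      ext1
      funext σ
      simp [coeff_taylorTerm, mul_add]
    simp only [e, Finset.sum_add_distrib] at h
    have := h ρ (by linarith)
    rw [← this]
    congr 1
    abel
  exact key (min f.order g.order) ((VanishesBelow.order f).mono (min_le_left _ _))
    ((VanishesBelow.order g).mono (min_le_right _ _))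

@[simp] theorem shift_C (c : ℚ) (x : SSeries) : shift c (HahnSeries.C x) = HahnSeries.C x := by
  ext1
  funext ρ
  rw [coeff_shift]
  simp only [coeff_taylorTerm, HahnSeries.C_apply, HahnSeries.coeff_single]
  rw [finsum_eq_single _ 0]
  · simp
  · intro n hn
    split_ifs with h
    · have : (n : ℚ) - ρ = 0 := by linarith
      rw [this, Ring.choose_zero_ite, if_neg hn]
      simp
    · rw [mul_zero]

/-- The substitution `z ↦ z + c` as a ring homomorphism. -/
def shiftHom (c : ℚ) : ZSeries →+* ZSeries where
  toFun := shift c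
  map_one' := by simpa using shift_C c 1
  map_mul' := shift_mul c
  map_zero' := by simpa using shift_C c 0
  map_add' := shift_add c

@[simp] theorem shiftHom_apply (c : ℚ) (f : ZSeries) : shiftHom c f = shift c f := rfl

/-! ### Series in `z⁻¹` with constant coefficients -/

theorem coeff_zPow_mul (r : ℚ) (f : ZSeries) (ρ : ℚ) : (zPow r * f).coeff ρ = f.coeff (ρ + r) := by
  rw [zPow, HahnSeries.coeff_single_mul, one_mul, sub_neg_eq_add]

theorem zPow_mul_zPow (r s : ℚ) : zPow r * zPow s = zPow (r + s) := by
  rw [zPow, zPow, HahnSeries.single_mul_single, one_mul, zPow, neg_add]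

@[simp] theorem zPow_zero : zPow 0 = 1 := by
  simp [zPow]

theorem coeff_ofPS (p : PowerSeries ℂ) (n : ℕ) :
    (ofPS p).coeff (n : ℚ) = HahnSeries.C (PowerSeries.coeff n p) := by
  rw [ofPS, HahnSeries.ofPowerSeries_apply_coeff, PowerSeries.coeff_map]

theorem coeff_zPow_mul_ofPS (r : ℚ) (p : PowerSeries ℂ) (n : ℕ) :
    (zPow r * ofPS p).coeff (-r + n) = HahnSeries.C (PowerSeries.coeff n p) := by
  rw [coeff_zPow_mul, ← coeff_ofPS]
  congr 1
  ring

theorem coeff_zPow_mul_ofPS_eq_zero {r : ℚ} {p : PowerSeries ℂ} {ρ : ℚ}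
    (h : ¬ ∃ n : ℕ, ρ = -r + n) : (zPow r * ofPS p).coeff ρ = 0 := by
  by_contra hne
  refine h (support_zPow_mul_ofPS 1 r p ?_)
  simpa using hne

theorem vanishesBelow_zPow_mul_ofPS (r : ℚ) (p : PowerSeries ℂ) :
    VanishesBelow (-r) (zPow r * ofPS p) := by
  intro ρ hρ
  refine coeff_zPow_mul_ofPS_eq_zero ?_
  rintro ⟨n, rfl⟩
  have : (0 : ℚ) ≤ n := n.cast_nonneg
  linarith

theorem ofPS_mul (p q : PowerSeries ℂ) : ofPS (p * q) = ofPS p * ofPS q := by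
  simp [ofPS]

@[simp] theorem ofPS_one : ofPS 1 = 1 := by
  simp [ofPS]

theorem shift_zPow_mul_ofPS (c r : ℚ) (p : PowerSeries ℂ) :
    shift c (zPow r * ofPS p) = zPow r * ofPS (PowerSeries.mk
      (shiftCoeff (c : ℂ) (r : ℂ) fun n => PowerSeries.coeff n p)) := by
  ext1
  funext ρ
  rw [coeff_shift]
  simp only [coeff_taylorTerm]
  by_cases h : ∃ n : ℕ, ρ = -r + n
  · obtain ⟨n, rfl⟩ := h
    rw [coeff_zPow_mul_ofPS, PowerSeries.coeff_mk, shiftCoeff,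
      finsum_eq_sum_of_support_subset (s := Finset.range (n + 1)),
      ← Finset.sum_range_reflect, map_sum]
    · refine Finset.sum_congr rfl fun i hi => ?_
      have hi' : i ≤ n := Nat.lt_succ_iff.1 (Finset.mem_range.1 hi)
      rw [show n + 1 - 1 - i = n - i by omega]
      have e : -r + (n : ℚ) - ((n - i : ℕ) : ℚ) = -r + (i : ℚ) := by
        rw [Nat.cast_sub hi']
        ring
      have e2 : ((n - i : ℕ) : ℚ) - (-r + (n : ℚ)) = r - i := by
        rw [Nat.cast_sub hi']
        ring
      have e3 : ((Ring.choose (r - (i : ℚ)) (n - i) : ℚ) : ℂ) =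
          Ring.choose ((r : ℂ) - i) (n - i) := by
        have := Ring.map_choose (algebraMap ℚ ℂ) (r - (i : ℚ)) (n - i)
        simpa using this
      rw [e, e2, coeff_zPow_mul_ofPS, ratC, mul_comm, RingHom.comp_apply, ← map_mul,
        map_mul (algebraMap ℚ ℂ), map_pow]
      simp only [eq_ratCast, e3]
    · intro k hk
      by_contra hkn
      apply hk
      have hkn' : n + 1 ≤ k := by simpa using hkn
      have hkn'' : (n : ℚ) + 1 ≤ k := by exact_mod_cast hkn'
      dsimp only
      rw [vanishesBelow_zPow_mul_ofPS r p _ (by linarith), mul_zero]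
  · rw [coeff_zPow_mul_ofPS_eq_zero h]
    refine (finsum_congr fun k => ?_).trans finsum_zero
    rw [coeff_zPow_mul_ofPS_eq_zero, mul_zero]
    rintro ⟨n, hn⟩
    refine h ⟨n + k, ?_⟩
    push_cast
    linarith

end

noncomputable section

/-! ### Gamma factors under the shift -/

theorem sqrt_two_pi_ne_zero : ((√(2 * Real.pi) : ℝ) : ℂ) ≠ 0 := by
  have : √(2 * Real.pi) ≠ 0 := (Real.sqrt_pos.2 (by positivity)).ne'
  exact_mod_cast this

theorem natPow_add (m : ℕ) [NeZero m] (r s : ℚ) : natPow m (r + s) = natPow m r * natPow m s := by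
  have hm : (0 : ℝ) < m := by exact_mod_cast NeZero.pos m
  rw [natPow, natPow, natPow, ← Complex.ofReal_mul, ← Real.rpow_add hm]
  push_cast
  rfl

@[simp] theorem natPow_zero (m : ℕ) : natPow m 0 = 1 := by
  simp [natPow]

theorem natPow_one (m : ℕ) : natPow m 1 = m := by
  simp [natPow]

theorem natPow_ne_zero (m : ℕ) [NeZero m] (r : ℚ) : natPow m r ≠ 0 := by
  intro h
  have := natPow_add m r (-r)
  rw [h, add_neg_cancel, natPow_zero, zero_mul] at this
  exact one_ne_zero this

theorem natPow_neg (m : ℕ) [NeZero m] (r : ℚ) : natPow m (-r) = (natPow m r)⁻¹ := by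
  refine eq_inv_of_mul_eq_one_left ?_
  rw [← natPow_add, neg_add_cancel, natPow_zero]

/-- The constant factor of `gammaSeries`. -/
def gammaConst (m : ℕ) (a : ℚ) : ℂ := (√(2 * Real.pi) : ℝ) * natPow m (1 / 2 - a)

theorem gammaConst_ne_zero (m : ℕ) [NeZero m] (a : ℚ) : gammaConst m a ≠ 0 :=
  mul_ne_zero sqrt_two_pi_ne_zero (natPow_ne_zero m _)

theorem coeff_gammaSeries (m : ℕ) (a : ℚ) (n : ℕ) : PowerSeries.coeff n (gammaSeries m a) =
    gammaConst m a * ((stirlingCoeff a n * (m : ℝ) ^ n : ℝ) : ℂ) := by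
  rw [gammaSeries, PowerSeries.coeff_mk, gammaConst]
  push_cast
  ring

theorem constantCoeff_gammaSeries (m : ℕ) (a : ℚ) :
    PowerSeries.constantCoeff (gammaSeries m a) = gammaConst m a := by
  rw [← PowerSeries.coeff_zero_eq_constantCoeff_apply, coeff_gammaSeries, stirlingCoeff_zero]
  simp

theorem gammaPart_mul_recipGammaPart (m : ℕ) [NeZero m] (a : ℚ) :
    gammaPart m a * recipGammaPart m a = 1 := by
  rw [gammaPart, recipGammaPart, mul_mul_mul_comm, zPow_mul_zPow, ← ofPS_mul,
    PowerSeries.mul_inv_cancel _ (by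
      rw [constantCoeff_gammaSeries]
      exact gammaConst_ne_zero m a),
    show a - 1 / 2 + (1 / 2 - a) = 0 by ring, zPow_zero, ofPS_one, one_mul]

theorem gammaPart_ne_zero (m : ℕ) [NeZero m] (a : ℚ) : gammaPart m a ≠ 0 :=
  left_ne_zero_of_mul_eq_one (gammaPart_mul_recipGammaPart m a)

theorem recipGammaPart_eq_inv (m : ℕ) [NeZero m] (a : ℚ) :
    recipGammaPart m a = (gammaPart m a)⁻¹ :=
  eq_inv_of_mul_eq_one_right (gammaPart_mul_recipGammaPart m a)

/-- The constant series with value `x`. -/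
def constC : ℂ →+* ZSeries := HahnSeries.C.comp HahnSeries.C

theorem ofPS_C (x : ℂ) : ofPS (PowerSeries.C x) = constC x := by
  rw [ofPS, PowerSeries.map_C, HahnSeries.ofPowerSeries_C]
  rfl

/-- The functional equation `Γ(z/m + a + 1) = (z/m + a) Γ(z/m + a)`. -/
theorem gammaPart_add_one (m : ℕ) [NeZero m] (a : ℚ) :
    constC m * gammaPart m (a + 1) = (zPow 1 + constC (m * a)) * gammaPart m a := by
  have hm : (m : ℂ) ≠ 0 := Nat.cast_ne_zero.2 (NeZero.ne m)
  have e1 : zPow 1 + constC (m * a) =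
      zPow 1 * ofPS (1 + PowerSeries.C ((m : ℂ) * a) * PowerSeries.X) := by
    have hX : ofPS PowerSeries.X = zPow (-1) := by
      simp [ofPS, zPow]
    have : ofPS (1 + PowerSeries.C ((m : ℂ) * a) * PowerSeries.X) =
        ofPS 1 + ofPS (PowerSeries.C ((m : ℂ) * a) * PowerSeries.X) := by
      simp [ofPS]
    rw [this, ofPS_mul, hX, ofPS_C, ofPS_one, mul_add, mul_one, mul_left_comm, zPow_mul_zPow]
    simp
  have e2 : PowerSeries.C (m : ℂ) * gammaSeries m (a + 1) =
      (1 + PowerSeries.C ((m : ℂ) * a) * PowerSeries.X) * gammaSeries m a := by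
    have hc : (m : ℂ) * gammaConst m (a + 1) = gammaConst m a := by
      rw [gammaConst, gammaConst, show (1 : ℚ) / 2 - a = (1 / 2 - (a + 1)) + 1 by ring,
        natPow_add m _ 1, natPow_one]
      ring
    ext n
    rw [PowerSeries.coeff_C_mul, add_mul, one_mul, map_add, mul_assoc, PowerSeries.coeff_C_mul]
    cases n with
    | zero =>
      rw [coeff_gammaSeries, coeff_gammaSeries, ← mul_assoc, hc, stirlingCoeff_zero,
        stirlingCoeff_zero]
      simp
    | succ n =>
      rw [PowerSeries.coeff_succ_X_mul, coeff_gammaSeries, coeff_gammaSeries, coeff_gammaSeries,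
        ← mul_assoc, hc, Rat.cast_add, Rat.cast_one, stirlingCoeff_add_one_succ]
      push_cast
      ring
  rw [gammaPart, gammaPart, e1, mul_mul_mul_comm, zPow_mul_zPow, ← ofPS_mul, ← e2, ofPS_mul, ofPS_C,
    show (1 : ℚ) + (a - 1 / 2) = a + 1 - 1 / 2 by ring]
  ring

/-- The quotient of `shift c (gammaPart m a)` by `gammaPart m (a + c/m)` does not depend on `a`. -/
theorem shift_gammaPart_mul (m : ℕ) [NeZero m] (c a b : ℚ) :
    shift c (gammaPart m a) * gammaPart m (b + c / m) =
      shift c (gammaPart m b) * gammaPart m (a + c / m) := by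
  have key : ∀ a b : ℚ, shift c (gammaPart m a) * gammaPart m (b + c / m) =
      zPow (a + b + c / m - 1) * (constC (gammaConst m a * gammaConst m (b + c / m)) *
        ofPS (PowerSeries.mk fun n => ((∑ k ∈ Finset.range (n + 1),
          shiftCoeff (c : ℝ) ((a : ℝ) - 1 / 2) (fun i => stirlingCoeff a i * (m : ℝ) ^ i) k *
            (stirlingCoeff (b + c / m) (n - k) * (m : ℝ) ^ (n - k)) : ℝ) : ℂ))) := by
    intro a b
    rw [gammaPart, gammaPart, shift_zPow_mul_ofPS, mul_mul_mul_comm, zPow_mul_zPow, ← ofPS_mul,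
      ← ofPS_C, ← ofPS_mul, show a - 1 / 2 + (b + c / m - 1 / 2) = a + b + c / m - 1 by ring]
    congr 2
    ext n
    rw [PowerSeries.coeff_mul, PowerSeries.coeff_C_mul, PowerSeries.coeff_mk,
      Finset.Nat.sum_antidiagonal_eq_sum_range_succ_mk, Complex.ofReal_sum, Finset.mul_sum]
    refine Finset.sum_congr rfl fun k _ => ?_
    have hch : ∀ (r : ℚ) (n : ℕ), ((Ring.choose (r : ℝ) n : ℝ) : ℂ) = Ring.choose (r : ℂ) n := by
      intro r n
      have := Ring.map_choose (algebraMap ℝ ℂ) (r : ℝ) n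
      simpa using this
    rw [PowerSeries.coeff_mk, coeff_gammaSeries]
    simp only [shiftCoeff, coeff_gammaSeries, Complex.ofReal_mul, Complex.ofReal_sum,
      Finset.mul_sum, Finset.sum_mul]
    refine Finset.sum_congr rfl fun i _ => ?_
    have h1 := hch (a - 1 / 2 - i) (k - i)
    push_cast at h1 ⊢
    rw [h1]
    ring
  rw [key, key]
  congr 1
  · rw [add_comm a b]
  · have h := stirlingCoeff_shift m c a b
    congr 1
    · congr 1
      simp only [gammaConst]
      rw [mul_mul_mul_comm, mul_mul_mul_comm (_ : ℂ) (natPow m (1 / 2 - b)), ← natPow_add,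
        ← natPow_add]
      congr 2
      ring
    · congr 2
      funext n
      congr 1
      exact congrFun h n

/-- The series `E(z)/E(z - 1)`, where `E(z) = e^(-(1 + log m) z/m) z^(z/m)` is the factor of
`Γ(z/m + a)` that `gammaPart m a` leaves out. It is computed from `a = 0`; by `shift_gammaPart`
every other `a` gives the same series. -/
def gammaMult (m : ℕ) : ZSeries := shift (-1) (gammaPart m 0) / gammaPart m (-1 / m)

theorem shift_gammaPart (m : ℕ) [NeZero m] (a : ℚ) :
    shift (-1) (gammaPart m a) = gammaMult m * gammaPart m (a - 1 / m) := by
  have h := shift_gammaPart_mul m (-1) a 0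
  rw [gammaMult, div_mul_eq_mul_div, eq_div_iff (gammaPart_ne_zero m _)]
  rw [zero_add] at h
  rw [h]
  congr 2
  ring

theorem shift_ne_zero (c : ℚ) {f : ZSeries} (hf : f ≠ 0) : shift c f ≠ 0 :=
  (map_ne_zero (shiftHom c)).2 hf

theorem gammaMult_ne_zero (m : ℕ) [NeZero m] : gammaMult m ≠ 0 :=
  div_ne_zero (shift_ne_zero _ (gammaPart_ne_zero m _)) (gammaPart_ne_zero m _)

theorem shift_inv (c : ℚ) (f : ZSeries) : shift c f⁻¹ = (shift c f)⁻¹ := map_inv₀ (shiftHom c) f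

theorem shift_recipGammaPart (m : ℕ) [NeZero m] (a : ℚ) :
    gammaMult m * shift (-1) (recipGammaPart m a) = recipGammaPart m (a - 1 / m) := by
  rw [recipGammaPart_eq_inv, recipGammaPart_eq_inv, shift_inv, shift_gammaPart, mul_inv,
    mul_inv_cancel_left₀ (gammaMult_ne_zero m)]

/-! ### Leading terms -/

/-- `f = g (1 + O(z⁻¹))`. -/
def SameLeading (f g : ZSeries) : Prop := ∃ e : ZSeries, VanishesBelow 1 e ∧ f = g * (1 + e)

theorem one_add_ne_zero {e : ZSeries} (he : VanishesBelow 1 e) : 1 + e ≠ 0 := by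
  intro h
  have := congrArg (fun f : ZSeries => f.coeff 0) h
  simp [he 0 one_pos] at this

theorem inv_one_add {e : ZSeries} (he : VanishesBelow 1 e) :
    ∃ e', VanishesBelow 1 e' ∧ (1 + e)⁻¹ = 1 + e' := by
  have hv : (1 + e).order = 0 := by
    apply le_antisymm
    · apply HahnSeries.order_le_of_coeff_ne_zero
      simp [he 0 one_pos]
    · rw [HahnSeries.le_order_iff_forall (one_add_ne_zero he)]
      intro ρ hρ
      rw [HahnSeries.coeff_add, he ρ (by linarith), add_zero, HahnSeries.coeff_one,
        if_neg hρ.ne]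
  have hi : (1 + e)⁻¹.order = 0 := by
    have h := HahnSeries.order_mul (one_add_ne_zero he) (inv_ne_zero (one_add_ne_zero he))
    rw [mul_inv_cancel₀ (one_add_ne_zero he), hv, HahnSeries.order_one] at h
    linarith
  refine ⟨-(e * (1 + e)⁻¹), ?_, ?_⟩
  · have := (he.mul (VanishesBelow.order (1 + e)⁻¹)).neg
    rwa [hi, add_zero] at this
  · field_simp [one_add_ne_zero he]
    ring

namespace SameLeading

variable {f g h k : ZSeries}

theorem refl (f : ZSeries) : SameLeading f f := ⟨0, VanishesBelow.zero, by simp⟩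

theorem mul (h₁ : SameLeading f g) (h₂ : SameLeading h k) : SameLeading (f * h) (g * k) := by
  obtain ⟨e, he, rfl⟩ := h₁
  obtain ⟨e', he', rfl⟩ := h₂
  refine ⟨e + e' + e * e', (he.add he').add ((he.mul he').mono (by norm_num)), by ring⟩

theorem trans (h₁ : SameLeading f g) (h₂ : SameLeading g h) : SameLeading f h := by
  obtain ⟨e, he, rfl⟩ := h₁
  obtain ⟨e', he', rfl⟩ := h₂
  refine ⟨e + e' + e * e', (he.add he').add ((he.mul he').mono (by norm_num)), by ring⟩

theorem symm (h₁ : SameLeading f g) : SameLeading g f := by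
  obtain ⟨e, he, rfl⟩ := h₁
  obtain ⟨e', he', h'⟩ := inv_one_add he
  refine ⟨e', he', ?_⟩
  rw [← h', mul_inv_cancel_right₀ (one_add_ne_zero he)]

theorem inv (h₁ : SameLeading f g) : SameLeading f⁻¹ g⁻¹ := by
  obtain ⟨e, he, rfl⟩ := h₁
  obtain ⟨e', he', h'⟩ := inv_one_add he
  exact ⟨e', he', by rw [mul_inv, h']⟩

theorem div (h₁ : SameLeading f g) (h₂ : SameLeading h k) : SameLeading (f / h) (g / k) := by
  rw [div_eq_mul_inv, div_eq_mul_inv]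
  exact h₁.mul h₂.inv

theorem ne_zero (h₁ : SameLeading f g) (hg : g ≠ 0) : f ≠ 0 := by
  obtain ⟨e, he, rfl⟩ := h₁
  exact mul_ne_zero hg (one_add_ne_zero he)

theorem shift (c : ℚ) (f : ZSeries) : SameLeading (shift c f) f := by
  by_cases hf : f = 0
  · refine ⟨0, VanishesBelow.zero, ?_⟩
    have : OrbifoldTDE.shift c 0 = 0 := map_zero (shiftHom c)
    rw [hf, this, zero_mul]
  · have hi : f⁻¹.order = - f.order := by
      have h := HahnSeries.order_mul hf (inv_ne_zero hf)
      rw [mul_inv_cancel₀ hf, HahnSeries.order_one] at h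
      linarith
    refine ⟨(OrbifoldTDE.shift c f - f) * f⁻¹, ?_, ?_⟩
    · refine (((VanishesBelow.order f).shift_sub c).mul (VanishesBelow.order f⁻¹)).mono ?_
      rw [hi]
      linarith
    · field_simp
      ring

/-- Monomials with the same leading term are equal. -/
theorem single_eq {r s : ℚ} {x y : SSeries} (hx : x ≠ 0)
    (h : SameLeading (HahnSeries.single r x) (HahnSeries.single s y)) : r = s ∧ x = y := by
  have hy : y ≠ 0 := by
    rintro rfl
    obtain ⟨e, he, h⟩ := h
    rw [HahnSeries.single_eq_zero, zero_mul, HahnSeries.single_eq_zero_iff] at h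
    exact hx h
  have key : ∀ ρ < s + 1, (HahnSeries.single r x : ZSeries).coeff ρ =
      (HahnSeries.single s y : ZSeries).coeff ρ := by
    obtain ⟨e, he, h⟩ := h
    intro ρ hρ
    rw [h, mul_add, mul_one, HahnSeries.coeff_add,
      ((VanishesBelow.single le_rfl y).mul he) ρ hρ, add_zero]
  have h1 := key s (by linarith)
  rw [HahnSeries.coeff_single_same, HahnSeries.coeff_single] at h1
  split_ifs at h1 with hsr
  · exact ⟨hsr.symm, h1⟩
  · exact absurd h1.symm hy

end SameLeading

theorem sameLeading_zPow_mul_ofPS (r : ℚ) {p : PowerSeries ℂ}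
    (hp : PowerSeries.constantCoeff p ≠ 0) :
    SameLeading (zPow r * ofPS p)
      (HahnSeries.single (-r) (HahnSeries.C (PowerSeries.constantCoeff p))) := by
  set x := PowerSeries.constantCoeff p with hx
  have hp' : p = PowerSeries.C x * (1 + PowerSeries.C x⁻¹ * (p - PowerSeries.C x)) := by
    rw [mul_add, ← mul_assoc, ← map_mul, mul_inv_cancel₀ hp]
    simp
  refine ⟨ofPS (PowerSeries.C x⁻¹ * (p - PowerSeries.C x)), ?_, ?_⟩
  · intro ρ hρ
    by_cases h : ∃ n : ℕ, ρ = n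
    · obtain ⟨n, rfl⟩ := h
      have : n = 0 := by
        have : n < 1 := by exact_mod_cast hρ
        omega
      subst this
      rw [coeff_ofPS]
      simp [hx]
    · have := coeff_zPow_mul_ofPS_eq_zero (r := 0) (p := PowerSeries.C x⁻¹ * (p - PowerSeries.C x))
        (ρ := ρ) (by simpa using h)
      simpa using this
  · have e : ofPS p = constC x * (1 + ofPS (PowerSeries.C x⁻¹ * (p - PowerSeries.C x))) := by
      conv_lhs => rw [hp']
      rw [ofPS_mul, ofPS_C]
      congr 1
      simp [ofPS]
    rw [e, ← mul_assoc, zPow, constC, RingHom.comp_apply, HahnSeries.C_apply,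
      HahnSeries.single_mul_single, add_zero, one_mul]

theorem sameLeading_gammaPart (m : ℕ) [NeZero m] (a : ℚ) : SameLeading (gammaPart m a)
    (HahnSeries.single (1 / 2 - a) (HahnSeries.C (gammaConst m a))) := by
  have h := sameLeading_zPow_mul_ofPS (a - 1 / 2) (p := gammaSeries m a)
    (by rw [constantCoeff_gammaSeries]; exact gammaConst_ne_zero m a)
  rwa [constantCoeff_gammaSeries, neg_sub] at h

theorem sameLeading_gammaMult (m : ℕ) [NeZero m] : SameLeading (gammaMult m)
    (HahnSeries.single (-1 / m : ℚ) (HahnSeries.C (natPow m (-1 / m)))) := by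
  have h := ((SameLeading.shift (-1) (gammaPart m 0)).trans (sameLeading_gammaPart m 0)).div
    (sameLeading_gammaPart m (-1 / m))
  have e : (HahnSeries.single (1 / 2 - 0) (HahnSeries.C (gammaConst m 0)) : ZSeries) /
      HahnSeries.single (1 / 2 - -1 / m : ℚ) (HahnSeries.C (gammaConst m (-1 / m))) =
      HahnSeries.single (-1 / m : ℚ) (HahnSeries.C (natPow m (-1 / m))) := by
    rw [HahnSeries.single_div_single, ← map_div₀]
    have h1 : (1 : ℚ) / 2 - 0 - (1 / 2 - -1 / m) = -1 / m := by ring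
    have h2 : gammaConst m 0 / gammaConst m (-1 / m) = natPow m (-1 / m) := by
      rw [div_eq_iff (gammaConst_ne_zero m _), gammaConst, gammaConst, mul_left_comm, ← natPow_add]
      congr 2
      ring
    rw [h1, h2]
  rwa [e] at h

end

noncomputable section

/-! ### Twists of generalised power series by characters -/

section Twist

variable {R S : Type*} [CommRing R] [CommRing S]

/-- The ring homomorphism `∑ f_ρ t^ρ ↦ ∑ χ(ρ) φ(f_ρ) t^ρ`, for a ring homomorphism `φ` and a
character `χ`. -/
def twist (φ : R →+* S) (χ : Multiplicative ℚ →* S) : HahnSeries ℚ R →+* HahnSeries ℚ S where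
  toFun f :=
    { coeff := fun ρ => χ (.ofAdd ρ) * φ (f.coeff ρ)
      isPWO_support' := f.isPWO_support.mono fun ρ hρ h => hρ (by simp [h]) }
  map_zero' := by ext; simp
  map_add' f g := by ext; simp [mul_add]
  map_one' := by
    ext ρ
    simp only [HahnSeries.coeff_one]
    split_ifs with h
    · simp [h]
    · simp
  map_mul' f g := by
    ext1
    funext ρ
    change χ (.ofAdd ρ) * φ ((f * g).coeff ρ) = _
    rw [HahnSeries.coeff_mul, HahnSeries.coeff_mul, map_sum, Finset.mul_sum]
    symm
    refine (Finset.sum_subset (s₂ := Finset.antidiagonal f.isPWO_support g.isPWO_support ρ)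
      (fun ij hij => ?_) ?_).trans (Finset.sum_congr rfl fun ij hij => ?_)
    · obtain ⟨h1, h2, h3⟩ := Finset.mem_antidiagonal.1 hij
      refine Finset.mem_antidiagonal.2 ⟨fun h => h1 ?_, fun h => h2 ?_, h3⟩
      · simp [h]
      · simp [h]
    · intro ij hij hij'
      obtain ⟨-, -, h3⟩ := Finset.mem_antidiagonal.1 hij
      by_contra hne
      exact hij' (Finset.mem_antidiagonal.2
        ⟨left_ne_zero_of_mul hne, right_ne_zero_of_mul hne, h3⟩)
    · obtain ⟨-, -, h3⟩ := Finset.mem_antidiagonal.1 hij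
      change (χ (.ofAdd ij.1) * φ (f.coeff ij.1)) * (χ (.ofAdd ij.2) * φ (g.coeff ij.2)) = _
      rw [← h3, ofAdd_add, map_mul, map_mul]
      ring

theorem coeff_twist (φ : R →+* S) (χ : Multiplicative ℚ →* S) (f : HahnSeries ℚ R) (ρ : ℚ) :
    (twist φ χ f).coeff ρ = χ (.ofAdd ρ) * φ (f.coeff ρ) := rfl

end Twist

/-- The root of unity `e^(2πir)`. -/
def cexp2 (r : ℚ) : ℂ := Complex.exp (2 * Real.pi * Complex.I * r)

theorem cexp2_add (r s : ℚ) : cexp2 (r + s) = cexp2 r * cexp2 s := by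
  rw [cexp2, cexp2, cexp2, ← Complex.exp_add]
  push_cast
  ring_nf

@[simp] theorem cexp2_zero : cexp2 0 = 1 := by
  simp [cexp2]

@[simp] theorem cexp2_intCast (n : ℤ) : cexp2 n = 1 := by
  rw [cexp2, ← Complex.exp_int_mul_two_pi_mul_I n]
  push_cast
  ring_nf

theorem cexp2_half : cexp2 (1 / 2) = -1 := by
  rw [cexp2, ← Complex.exp_pi_mul_I]
  push_cast
  ring_nf

theorem cexp2_ne_zero (r : ℚ) : cexp2 r ≠ 0 := Complex.exp_ne_zero _

theorem cexp2_neg (r : ℚ) : cexp2 (-r) = (cexp2 r)⁻¹ := by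
  refine eq_inv_of_mul_eq_one_left ?_
  rw [← cexp2_add, neg_add_cancel, cexp2_zero]

theorem cexp2_eq_one {r : ℚ} (h : cexp2 r = 1) : ∃ n : ℤ, r = n := by
  obtain ⟨n, hn⟩ := Complex.exp_eq_one_iff.1 h
  refine ⟨n, ?_⟩
  have h2 : (2 * Real.pi * Complex.I : ℂ) ≠ 0 := Complex.two_pi_I_ne_zero
  rw [mul_comm (n : ℂ)] at hn
  exact_mod_cast mul_left_cancel₀ h2 hn

theorem sPow_eq (k : ℤ) (r : ℚ) : sPow k r = HahnSeries.single r (cexp2 (k * r)) := by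
  rw [sPow, cexp2]
  push_cast
  ring_nf

theorem sPow_mul_sPow (k : ℤ) (r r' : ℚ) : sPow k r * sPow k r' = sPow k (r + r') := by
  rw [sPow_eq, sPow_eq, sPow_eq, HahnSeries.single_mul_single, ← cexp2_add]
  ring_nf

theorem sPow_one (k : ℤ) : sPow k 1 = sPow 0 1 := by
  rw [sPow_eq, sPow_eq]
  simp

theorem sPow_ne_zero (k : ℤ) (r : ℚ) : sPow k r ≠ 0 := by
  rw [sPow_eq]
  exact HahnSeries.single_ne_zero (cexp2_ne_zero _)

@[simp] theorem sPow_zero (k : ℤ) : sPow k 0 = 1 := by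
  rw [sPow_eq]
  simp

theorem sPow_neg (k : ℤ) (r : ℚ) : sPow k (-r) = (sPow k r)⁻¹ := by
  refine eq_inv_of_mul_eq_one_left ?_
  rw [sPow_mul_sPow, neg_add_cancel, sPow_zero]

theorem sPow_add_left (k k' : ℤ) (r : ℚ) :
    sPow (k + k') r = HahnSeries.C (cexp2 (k' * r)) * sPow k r := by
  rw [sPow_eq, sPow_eq, HahnSeries.C_apply, HahnSeries.single_mul_single, ← cexp2_add]
  push_cast
  ring_nf

/-- The monodromy of `z⁻¹` around the origin: `z^(-ρ)` is multiplied by `e^(2πiρ)`. -/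
def monodromy : ZSeries →+* ZSeries :=
  twist (RingHom.id SSeries)
    { toFun := fun ρ => HahnSeries.C (cexp2 ρ.toAdd)
      map_one' := by simp
      map_mul' := fun ρ σ => by rw [toAdd_mul, cexp2_add, map_mul] }

theorem coeff_monodromy (f : ZSeries) (ρ : ℚ) :
    (monodromy f).coeff ρ = HahnSeries.C (cexp2 ρ) * f.coeff ρ := rfl

/-- The embedding `∑ x_ρ t^ρ ↦ ∑ x_ρ (s/z)^ρ` of the generalised power series in `t` over the
field of rational functions in `s`. -/
def ofRatio : HahnSeries ℚ (RatFunc ℂ) →+* ZSeries :=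
  twist ofRat
    { toFun := fun ρ => sPow 0 ρ.toAdd
      map_one' := by simp
      map_mul' := fun ρ σ => by rw [toAdd_mul, sPow_mul_sPow] }

theorem coeff_ofRatio (f : HahnSeries ℚ (RatFunc ℂ)) (ρ : ℚ) :
    (ofRatio f).coeff ρ = sPow 0 ρ * ofRat (f.coeff ρ) := rfl

theorem exists_ofRatio_eq {f : ZSeries} (h : ∀ ρ, ∃ x, f.coeff ρ = sPow 0 ρ * ofRat x) :
    ∃ g, ofRatio g = f := by
  choose x hx using h
  refine ⟨⟨x, f.isPWO_support.mono fun ρ hρ h => hρ ?_⟩, ?_⟩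
  · have h0 := hx ρ
    rw [h, eq_comm, mul_eq_zero, or_iff_right (sPow_ne_zero 0 ρ)] at h0
    exact (map_eq_zero ofRat).1 h0
  · ext1
    funext ρ
    rw [coeff_ofRatio, hx]

open scoped RatFunc in
theorem ofRat_C (x : ℂ) : ofRat (RatFunc.C x) = HahnSeries.C x := by
  have : (algebraMap (RatFunc ℂ) (LaurentSeries ℂ)) (RatFunc.C x) = HahnSeries.C x := by
    rw [← RatFunc.algebraMap_C]
    exact (RatFunc.coe_coe _).symm.trans (by simp)
  rw [ofRat, RingHom.comp_apply, this]
  exact HahnSeries.embDomainRingHom_C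

open scoped RatFunc in
theorem ofRat_X : ofRat RatFunc.X = sPow 0 1 := by
  have : (algebraMap (RatFunc ℂ) (LaurentSeries ℂ)) RatFunc.X = HahnSeries.single 1 1 :=
    RatFunc.coe_X
  rw [ofRat, RingHom.comp_apply, this, sPow_eq, ofLaurent]
  change HahnSeries.embDomain _ _ = _
  rw [HahnSeries.embDomain_single]
  simp

theorem ofRat_X_zpow (n : ℤ) : ofRat (RatFunc.X ^ n) = sPow 0 n := by
  have hnat : ∀ n : ℕ, sPow 0 1 ^ n = sPow 0 n := by
    intro n
    induction n with
    | zero => simp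
    | succ n ih => rw [pow_succ, ih, sPow_mul_sPow]; push_cast; rfl
  rw [map_zpow₀, ofRat_X]
  obtain ⟨n, rfl | rfl⟩ := n.eq_nat_or_neg
  · rw [zpow_natCast, hnat]
    simp
  · rw [zpow_neg, zpow_natCast, hnat, ← sPow_neg]
    simp

/-! ### Formal infinite sums -/

/-- `y` is the formal sum of the series `t j`. -/
def IsSum (t : ℕ → ZSeries) (y : ZSeries) : Prop :=
  ∃ F : HahnSeries.SummableFamily ℚ SSeries ℕ, (∀ j, F j = t j) ∧ F.hsum = y

namespace IsSum

variable {t t' : ℕ → ZSeries} {y y' : ZSeries}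

theorem coeff (h : IsSum t y) (ρ : ℚ) : y.coeff ρ = ∑ᶠ j, (t j).coeff ρ := by
  obtain ⟨F, hF, rfl⟩ := h
  simp only [← hF]
  rfl

theorem finite (h : IsSum t y) (ρ : ℚ) :
    (Function.support fun j => (t j).coeff ρ).Finite := by
  obtain ⟨F, hF, rfl⟩ := h
  simp only [← hF]
  exact F.finite_co_support ρ

theorem unique (h : IsSum t y) (h' : IsSum t y') : y = y' := by
  ext1
  funext ρ
  rw [h.coeff, h'.coeff]

theorem add (h : IsSum t y) (h' : IsSum t' y') : IsSum (fun j => t j + t' j) (y + y') := by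
  obtain ⟨F, hF, rfl⟩ := h
  obtain ⟨F', hF', rfl⟩ := h'
  exact ⟨F + F', fun j => by simp [hF, hF'], HahnSeries.SummableFamily.hsum_add⟩

theorem mul_left (h : IsSum t y) (x : ZSeries) : IsSum (fun j => x * t j) (x * y) := by
  obtain ⟨F, hF, rfl⟩ := h
  exact ⟨x • F, fun j => by rw [HahnSeries.SummableFamily.smul_apply, hF]; rfl,
    HahnSeries.SummableFamily.hsum_smul⟩

theorem congr (h : IsSum t y) (h' : ∀ j, t j = t' j) : IsSum t' y := by
  obtain ⟨F, hF, rfl⟩ := h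
  exact ⟨F, fun j => by rw [hF, h'], rfl⟩

theorem of_succ (h : IsSum (fun j => t (j + 1)) y) (h0 : t 0 = 0) : IsSum t y := by
  obtain ⟨F, hF, rfl⟩ := h
  refine ⟨F.embDomain ⟨Nat.succ, Nat.succ_injective⟩, fun j => ?_,
    HahnSeries.SummableFamily.hsum_embDomain _ _⟩
  cases j with
  | zero =>
    rw [HahnSeries.SummableFamily.embDomain_of_notMem_range, h0]
    rintro ⟨n, hn⟩
    exact Nat.succ_ne_zero n hn
  | succ j =>
    exact (HahnSeries.SummableFamily.embDomain_image F ⟨Nat.succ, Nat.succ_injective⟩).trans (hF j)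

theorem twist (h : IsSum t y) {φ : SSeries →+* SSeries} {χ : Multiplicative ℚ →* SSeries}
    (h' : IsSum (fun j => OrbifoldTDE.twist φ χ (t j)) y') : OrbifoldTDE.twist φ χ y = y' := by
  ext1
  funext ρ
  have hs : (Function.support fun j => (OrbifoldTDE.twist φ χ (t j)).coeff ρ) ⊆
      (h.finite ρ).toFinset := by
    intro j hj
    rw [Set.Finite.coe_toFinset]
    intro h0
    dsimp only at h0
    exact hj (by simp only [coeff_twist]; rw [h0, map_zero, mul_zero])
  rw [coeff_twist, h.coeff, h'.coeff, finsum_eq_sum_of_support_subset _ hs,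
    finsum_eq_sum_of_support_subset (s := (h.finite ρ).toFinset) _ (by simp), map_sum,
    Finset.mul_sum]
  rfl

theorem shift {c : ℚ} (h : IsSum t y) (h' : IsSum (fun j => OrbifoldTDE.shift c (t j)) y') :
    OrbifoldTDE.shift c y = y' := by
  ext1
  funext ρ
  -- All the supports lie in a well-ordered set, so that only finitely many terms of the Taylor
  -- expansions contribute to a given coefficient.
  obtain ⟨r, hr⟩ : ∃ r : ℚ, ∀ j, VanishesBelow r (t j) := by
    obtain ⟨F, hF, -⟩ := h
    by_cases hne : (⋃ j, (F j).support).Nonempty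
    · refine ⟨F.isPWO_iUnion_support.isWF.min hne, fun j σ hσ => ?_⟩
      by_contra h0
      refine F.isPWO_iUnion_support.isWF.not_lt_min hne (Set.mem_iUnion.2 ⟨j, ?_⟩) hσ
      rw [hF]
      exact h0
    · refine ⟨0, fun j σ _ => ?_⟩
      by_contra h0
      refine hne ⟨σ, Set.mem_iUnion.2 ⟨j, ?_⟩⟩
      rw [hF]
      exact h0
  have hy : VanishesBelow r y := fun σ hσ => by
    rw [h.coeff]
    exact (finsum_congr fun j => hr j σ hσ).trans finsum_zero
  obtain ⟨B, hB⟩ := exists_nat_gt (ρ - r)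
  have key : ∀ f : ZSeries, VanishesBelow r f → (OrbifoldTDE.shift c f).coeff ρ =
      ∑ n ∈ Finset.range B, (taylorTerm c n f).coeff ρ := by
    intro f hf
    have := hf.shift_sub_sum c B ρ (by linarith)
    rwa [HahnSeries.coeff_sub, HahnSeries.coeff_sum, sub_eq_zero] at this
  rw [key y hy, h'.coeff]
  simp only [key _ (hr _), coeff_taylorTerm]
  rw [finsum_sum_comm]
  · refine Finset.sum_congr rfl fun n _ => ?_
    rw [h.coeff, mul_finsum]
  · intro n _
    refine (h.finite (ρ - n)).subset fun j hj h0 => hj ?_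
    dsimp only at h0 ⊢
    rw [h0, mul_zero]

end IsSum

end

noncomputable section

/-! ### The quasi-wave functions without their symbols -/

/-- The multiplication by `s`. -/
def sMul : ZSeries := HahnSeries.C (sPow 0 1)

theorem sMul_ne_zero : sMul ≠ 0 := HahnSeries.C_ne_zero (sPow_ne_zero 0 1)

/-- The series `z - 1/2`. -/
def zHalf : ZSeries := zPow 1 - constC (1 / 2)

/-- The monomial `κ (e^(2πik) s)^r` as a constant in `z`. -/
def sMonomial (κ : ℂ) (k : ℤ) (r : ℚ) : ZSeries := HahnSeries.C (HahnSeries.C κ * sPow k r)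

theorem sMonomial_mul (κ κ' : ℂ) (k : ℤ) (r r' : ℚ) :
    sMonomial κ k r * sMonomial κ' k r' = sMonomial (κ * κ') k (r + r') := by
  rw [sMonomial, sMonomial, sMonomial, ← map_mul, mul_mul_mul_comm, ← map_mul, sPow_mul_sPow]

theorem sMul_mul_sMonomial (κ : ℂ) (k : ℤ) (r : ℚ) :
    sMul * sMonomial κ k r = sMonomial κ k (r + 1) := by
  have : sMul = sMonomial 1 k 1 := by
    rw [sMul, sMonomial, map_one, one_mul, sPow_one k]
  rw [this, sMonomial_mul, one_mul, add_comm]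

theorem constC_mul_sMonomial (x κ : ℂ) (k : ℤ) (r : ℚ) :
    constC x * sMonomial κ k r = sMonomial (x * κ) k r := by
  rw [constC, RingHom.comp_apply, sMonomial, ← map_mul, ← mul_assoc, ← map_mul, sMonomial]

theorem shift_sMonomial_mul (c : ℚ) (κ : ℂ) (k : ℤ) (r : ℚ) (f : ZSeries) :
    shift c (sMonomial κ k r * f) = sMonomial κ k r * shift c f := by
  rw [shift_mul, sMonomial, shift_C]

/-- `ψ_A(z + c, e^(2πik) s)` without its symbol `e^(αz) z^(βz) s^(γz)`. -/
def waveA (m₁ m₂ : ℕ) [NeZero m₁] [NeZero m₂] (k : ℤ) (c : ℚ) : ZSeries :=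
  HahnSeries.C (sPow k ((c - 1 / 2) / m₁)) * constC (natPow m₁ (-(c - 1 / 2) / m₁)) *
    (familyA m₁ m₂ c k).hsum

/-- `ψ_B(z + c, e^(2πik) s)` without its symbol `e^(αz) z^(βz) s^(γz)`. -/
def waveB (m₁ m₂ : ℕ) [NeZero m₁] [NeZero m₂] (k : ℤ) (c : ℚ) : ZSeries :=
  HahnSeries.C (sPow k (-(c - 1 / 2) / m₂)) * constC (natPow m₂ ((c - 1 / 2) / m₂)) *
    (familyB m₁ m₂ c k).hsum

section Waves

variable (m₁ m₂ : ℕ) [NeZero m₁] [NeZero m₂]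

/-- The terms of the series `waveA`. -/
def waveTermA (k : ℤ) (c : ℚ) (j : ℕ) : ZSeries :=
  sMonomial (natPow m₁ (-(c - 1 / 2 + m₂ * j) / m₁) * ((-1) ^ j / ((m₂ : ℂ) ^ j * j.factorial))) k
      ((c - 1 / 2 + (m₁ + m₂) * j) / m₁) *
    recipGammaPart m₁ ((c - 1 / 2 + m₂ * j) / m₁ + 1)

/-- The terms of the series `waveB`. -/
def waveTermB (k : ℤ) (c : ℚ) (j : ℕ) : ZSeries :=
  sMonomial (natPow m₂ ((c - 1 / 2 - m₁ * j) / m₂) * (1 / ((m₁ : ℂ) ^ j * j.factorial))) k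
      ((-(c - 1 / 2) + (m₁ + m₂) * j) / m₂) *
    gammaPart m₂ ((c - 1 / 2 - m₁ * j) / m₂)

theorem isSum_waveA (k : ℤ) (c : ℚ) : IsSum (waveTermA m₁ m₂ k c) (waveA m₁ m₂ k c) := by
  have h : IsSum (termA m₁ m₂ c k) (familyA m₁ m₂ c k).hsum := ⟨_, fun _ => rfl, rfl⟩
  refine (h.mul_left _).congr fun j => ?_
  have e : HahnSeries.C (sPow k ((c - 1 / 2) / m₁)) * constC (natPow m₁ (-(c - 1 / 2) / m₁)) =
      sMonomial (natPow m₁ (-(c - 1 / 2) / m₁)) k ((c - 1 / 2) / m₁) := by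
    rw [mul_comm, constC, RingHom.comp_apply, ← map_mul, sMonomial]
  rw [e, termA, waveTermA, ← mul_assoc]
  congr 1
  refine (sMonomial_mul _ _ _ _ _).trans ?_
  have h1 : natPow m₁ (-(c - 1 / 2) / m₁) *
      ((-1) ^ j / (natPow m₁ (m₂ * j / m₁) * (m₂ : ℂ) ^ j * (j.factorial : ℂ))) =
      natPow m₁ (-(c - 1 / 2 + m₂ * j) / m₁) * ((-1) ^ j / ((m₂ : ℂ) ^ j * j.factorial)) := by
    rw [show -(c - 1 / 2 + m₂ * j) / m₁ = -(c - 1 / 2) / m₁ + -(m₂ * j / m₁) by ring, natPow_add,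
      natPow_neg m₁ (m₂ * j / m₁), mul_assoc (natPow m₁ (m₂ * j / m₁)), div_mul_eq_div_div_swap]
    ring
  have h2 : (c - 1 / 2) / m₁ + (m₁ + m₂) * j / m₁ = (c - 1 / 2 + (m₁ + m₂) * j) / m₁ := by ring
  rw [h1, h2]

theorem isSum_waveB (k : ℤ) (c : ℚ) : IsSum (waveTermB m₁ m₂ k c) (waveB m₁ m₂ k c) := by
  have h : IsSum (termB m₁ m₂ c k) (familyB m₁ m₂ c k).hsum := ⟨_, fun _ => rfl, rfl⟩
  refine (h.mul_left _).congr fun j => ?_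
  have e : HahnSeries.C (sPow k (-(c - 1 / 2) / m₂)) * constC (natPow m₂ ((c - 1 / 2) / m₂)) =
      sMonomial (natPow m₂ ((c - 1 / 2) / m₂)) k (-(c - 1 / 2) / m₂) := by
    rw [mul_comm, constC, RingHom.comp_apply, ← map_mul, sMonomial]
  rw [e, termB, waveTermB, ← mul_assoc]
  congr 1
  refine (sMonomial_mul _ _ _ _ _).trans ?_
  have h1 : natPow m₂ ((c - 1 / 2) / m₂) *
      (1 / ((m₁ : ℂ) ^ j * natPow m₂ (m₁ * j / m₂) * (j.factorial : ℂ))) =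
      natPow m₂ ((c - 1 / 2 - m₁ * j) / m₂) * (1 / ((m₁ : ℂ) ^ j * j.factorial)) := by
    rw [show (c - 1 / 2 - m₁ * j) / m₂ = (c - 1 / 2) / m₂ + -(m₁ * j / m₂) by ring, natPow_add,
      natPow_neg m₂ (m₁ * j / m₂), mul_comm ((m₁ : ℂ) ^ j), mul_assoc (natPow m₂ (m₁ * j / m₂)),
      div_mul_eq_div_div_swap]
    ring
  have h2 : -(c - 1 / 2) / m₂ + (m₁ + m₂) * j / m₂ = (-(c - 1 / 2) + (m₁ + m₂) * j) / m₂ := by ring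
  rw [h1, h2]

/-! ### The shift of the quasi-wave functions -/

/-- The multiplier of `waveA` under `z ↦ z - 1`. -/
def multA (k : ℤ) : ZSeries := sMonomial (natPow m₁ (-1 / m₁)) k (1 / m₁) * (gammaMult m₁)⁻¹

/-- The multiplier of `waveB` under `z ↦ z - 1`. -/
def multB (k : ℤ) : ZSeries := sMonomial (natPow m₂ (1 / m₂)) k (-1 / m₂) * gammaMult m₂

theorem shift_waveA (k : ℤ) (c : ℚ) :
    shift (-1) (waveA m₁ m₂ k c) = multA m₁ k * waveA m₁ m₂ k (c - 1) := by
  refine (isSum_waveA m₁ m₂ k c).shift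
    (((isSum_waveA m₁ m₂ k (c - 1)).mul_left _).congr fun j => ?_)
  have h : shift (-1) (recipGammaPart m₁ ((c - 1 / 2 + m₂ * j) / m₁ + 1)) =
      (gammaMult m₁)⁻¹ * recipGammaPart m₁ ((c - 1 - 1 / 2 + m₂ * j) / m₁ + 1) := by
    rw [show (c - 1 - 1 / 2 + m₂ * j) / m₁ + 1 = (c - 1 / 2 + m₂ * j) / m₁ + 1 - 1 / m₁ by ring,
      ← shift_recipGammaPart, inv_mul_cancel_left₀ (gammaMult_ne_zero m₁)]
  have h1 : ∀ x : ℂ, natPow m₁ (-1 / m₁) * (natPow m₁ (-(c - 1 - 1 / 2 + m₂ * j) / m₁) * x) =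
      natPow m₁ (-(c - 1 / 2 + m₂ * j) / m₁) * x := by
    intro x
    rw [← mul_assoc, ← natPow_add]
    congr 2
    ring
  have h2 : (1 : ℚ) / m₁ + (c - 1 - 1 / 2 + (m₁ + m₂) * j) / m₁ =
      (c - 1 / 2 + (m₁ + m₂) * j) / m₁ := by ring
  rw [waveTermA, waveTermA, shift_sMonomial_mul, h, multA, mul_mul_mul_comm, sMonomial_mul, h1, h2]

theorem shift_waveB (k : ℤ) (c : ℚ) :
    shift (-1) (waveB m₁ m₂ k c) = multB m₂ k * waveB m₁ m₂ k (c - 1) := by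
  refine (isSum_waveB m₁ m₂ k c).shift
    (((isSum_waveB m₁ m₂ k (c - 1)).mul_left _).congr fun j => ?_)
  have h : shift (-1) (gammaPart m₂ ((c - 1 / 2 - m₁ * j) / m₂)) =
      gammaMult m₂ * gammaPart m₂ ((c - 1 - 1 / 2 - m₁ * j) / m₂) := by
    rw [show (c - 1 - 1 / 2 - m₁ * j) / m₂ = (c - 1 / 2 - m₁ * j) / m₂ - 1 / m₂ by ring,
      shift_gammaPart]
  have h1 : ∀ x : ℂ, natPow m₂ (1 / m₂) * (natPow m₂ ((c - 1 - 1 / 2 - m₁ * j) / m₂) * x) =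
      natPow m₂ ((c - 1 / 2 - m₁ * j) / m₂) * x := by
    intro x
    rw [← mul_assoc, ← natPow_add]
    congr 2
    ring
  have h2 : (-1 : ℚ) / m₂ + (-(c - 1 - 1 / 2) + (m₁ + m₂) * j) / m₂ =
      (-(c - 1 / 2) + (m₁ + m₂) * j) / m₂ := by ring
  rw [waveTermB, waveTermB, shift_sMonomial_mul, h, multB, mul_mul_mul_comm, sMonomial_mul, h1, h2]

theorem sameLeading_multA (k : ℤ) :
    SameLeading (multA m₁ k) (HahnSeries.single (1 / m₁ : ℚ) (sPow k (1 / m₁))) := by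
  have h := (SameLeading.refl (sMonomial (natPow m₁ (-1 / m₁)) k (1 / m₁))).mul
    (sameLeading_gammaMult m₁).inv
  rw [HahnSeries.inv_single, sMonomial, HahnSeries.C_apply, HahnSeries.single_mul_single, zero_add,
    mul_right_comm, mul_inv_cancel₀ (HahnSeries.C_ne_zero (natPow_ne_zero m₁ _)), one_mul,
    ← neg_div, neg_neg] at h
  exact h

theorem sameLeading_multB (k : ℤ) :
    SameLeading (multB m₂ k) (HahnSeries.single (-1 / m₂ : ℚ) (sPow k (-1 / m₂))) := by
  have h := (SameLeading.refl (sMonomial (natPow m₂ (1 / m₂)) k (-1 / m₂))).mul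
    (sameLeading_gammaMult m₂)
  rw [sMonomial, HahnSeries.C_apply, HahnSeries.single_mul_single, zero_add,
    mul_right_comm, ← map_mul, ← natPow_add, neg_div, add_neg_cancel, natPow_zero, map_one,
    one_mul] at h
  rw [multB, sMonomial, neg_div]
  exact h

/-! ### The three-term recurrence -/

/-- If `y = ∑ T_j`, `s y₁ = ∑ (z - 1/2 + κ j) T_j` and `s y₂ = -∑ κ (j + 1) T_(j+1)`, then the terms
with `κ` cancel in `s (y₁ + y₂)`. -/
theorem three_term {T U V : ℕ → ZSeries} {y y₁ y₂ κ : ZSeries} (hy : IsSum T y)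
    (hy₁ : IsSum U y₁) (hy₂ : IsSum V y₂)
    (hU : ∀ j : ℕ, sMul * U j = (zHalf + κ * (j : ℕ)) * T j)
    (hV : ∀ j : ℕ, sMul * V j = -κ * (j + 1 : ℕ) * T (j + 1)) :
    zHalf * y = sMul * (y₁ + y₂) := by
  have h1 : IsSum (fun j => κ * (j : ℕ) * T j) (sMul * y₁ + -zHalf * y) :=
    ((hy₁.mul_left sMul).add (hy.mul_left (-zHalf))).congr fun j => by rw [hU]; ring
  have h2 : IsSum (fun j => -κ * (j : ℕ) * T j) (sMul * y₂) :=
    ((hy₂.mul_left sMul).congr hV).of_succ (t := fun j => -κ * (j : ℕ) * T j) (by simp)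
  have h3 := (h2.mul_left (-1)).congr (t' := fun j => κ * (j : ℕ) * T j) fun j => by ring
  linear_combination -(h1.unique h3)

theorem waveA_recurrence (k : ℤ) :
    zHalf * waveA m₁ m₂ k 0 = sMul * (waveA m₁ m₂ k (-m₁) + waveA m₁ m₂ k m₂) := by
  have hm₁ : (m₁ : ℂ) ≠ 0 := Nat.cast_ne_zero.2 (NeZero.ne m₁)
  have hm₁' : (m₁ : ℚ) ≠ 0 := Nat.cast_ne_zero.2 (NeZero.ne m₁)
  have hm₂ : (m₂ : ℂ) ≠ 0 := Nat.cast_ne_zero.2 (NeZero.ne m₂)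
  refine three_term (κ := constC m₂) (isSum_waveA m₁ m₂ k 0) (isSum_waveA m₁ m₂ k (-m₁))
    (isSum_waveA m₁ m₂ k m₂) (fun j => ?_) (fun j => ?_)
  · set a : ℚ := (0 - 1 / 2 + m₂ * j) / m₁ with ha
    have h1 : constC m₁ * recipGammaPart m₁ a = (zPow 1 + constC (m₁ * a)) *
        recipGammaPart m₁ (a + 1) := by
      have := gammaPart_add_one m₁ a
      rw [recipGammaPart_eq_inv, recipGammaPart_eq_inv, ← div_eq_mul_inv, ← div_eq_mul_inv,
        div_eq_div_iff (gammaPart_ne_zero m₁ _) (gammaPart_ne_zero m₁ _), this]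
    have h2 : zPow 1 + constC (m₁ * a) = zHalf + constC m₂ * (j : ℕ) := by
      have : (m₁ : ℂ) * a = -(1 / 2) + m₂ * j := by
        rw [ha]
        push_cast
        field_simp
        ring
      rw [this, zHalf, map_add, map_neg, map_mul, map_natCast constC j]
      ring
    rw [← h2, waveTermA, waveTermA, ← mul_assoc, sMul_mul_sMonomial, mul_left_comm, ← ha, ← h1,
      ← mul_assoc, mul_comm (sMonomial _ _ _) (constC _), constC_mul_sMonomial, ← mul_assoc,
      ← natPow_one m₁, ← natPow_add]
    congr 1
    · congr 1
      · congr 2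
        field_simp
        ring
      · field_simp
        ring
    · congr 1
      rw [ha]
      field_simp
      ring
  · have e : -constC m₂ * ((j + 1 : ℕ) : ZSeries) = constC (-m₂ * (j + 1 : ℕ)) := by
      rw [map_mul, map_neg, map_natCast constC (j + 1)]
    rw [waveTermA, waveTermA, ← mul_assoc, sMul_mul_sMonomial, e, ← mul_assoc, constC_mul_sMonomial]
    congr 1
    · congr 1
      · rw [mul_left_comm]
        congr 1
        · congr 1
          push_cast
          ring
        · rw [Nat.factorial_succ]
          have : (j.factorial : ℂ) ≠ 0 := Nat.cast_ne_zero.2 (Nat.factorial_ne_zero j)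
          have : (j : ℂ) + 1 ≠ 0 := Nat.cast_add_one_ne_zero j
          push_cast
          field_simp
          ring
      · push_cast
        field_simp
        ring
    · congr 1
      push_cast
      ring

theorem waveB_recurrence (k : ℤ) :
    zHalf * waveB m₁ m₂ k 0 = sMul * (waveB m₁ m₂ k (-m₁) + waveB m₁ m₂ k m₂) := by
  have hm₁ : (m₁ : ℂ) ≠ 0 := Nat.cast_ne_zero.2 (NeZero.ne m₁)
  have hm₂ : (m₂ : ℂ) ≠ 0 := Nat.cast_ne_zero.2 (NeZero.ne m₂)
  have hm₂' : (m₂ : ℚ) ≠ 0 := Nat.cast_ne_zero.2 (NeZero.ne m₂)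
  -- In comparison with `ψ_A`, the shifts by `-m₁` and by `m₂` change places.
  rw [add_comm (waveB m₁ m₂ k (-m₁))]
  refine three_term (κ := -constC m₁) (isSum_waveB m₁ m₂ k 0) (isSum_waveB m₁ m₂ k m₂)
    (isSum_waveB m₁ m₂ k (-m₁)) (fun j => ?_) (fun j => ?_)
  · set a : ℚ := (0 - 1 / 2 - m₁ * j) / m₂ with ha
    have h1 := gammaPart_add_one m₂ a
    have h2 : zPow 1 + constC (m₂ * a) = zHalf + -constC m₁ * (j : ℕ) := by
      have : (m₂ : ℂ) * a = -(1 / 2) - m₁ * j := by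
        rw [ha]
        push_cast
        field_simp
        ring
      rw [this, zHalf, map_sub, map_neg, map_mul, map_natCast constC j]
      ring
    rw [← h2, waveTermB, waveTermB, ← mul_assoc, sMul_mul_sMonomial, mul_left_comm, ← ha, ← h1,
      ← mul_assoc, mul_comm (sMonomial _ _ _) (constC _), constC_mul_sMonomial, ← mul_assoc,
      ← natPow_one m₂, ← natPow_add]
    congr 1
    · congr 1
      · congr 2
        rw [ha]
        field_simp
        ring
      · field_simp
        ring
    · congr 1
      rw [ha]
      field_simp
      ring
  · have e : - -constC m₁ * ((j + 1 : ℕ) : ZSeries) = constC (m₁ * (j + 1 : ℕ)) := by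
      rw [map_mul, neg_neg, map_natCast constC (j + 1)]
    rw [waveTermB, waveTermB, ← mul_assoc, sMul_mul_sMonomial, e, ← mul_assoc, constC_mul_sMonomial]
    congr 1
    · congr 1
      · rw [mul_left_comm]
        congr 1
        · congr 1
          push_cast
          ring
        · rw [Nat.factorial_succ]
          have : (j.factorial : ℂ) ≠ 0 := Nat.cast_ne_zero.2 (Nat.factorial_ne_zero j)
          have : (j : ℂ) + 1 ≠ 0 := Nat.cast_add_one_ne_zero j
          push_cast
          field_simp
          ring
      · push_cast
        field_simp
        ring
    · congr 1
      push_cast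
      ring

end Waves

end

noncomputable section

/-! ### Exponents, monodromy and rationality of the quasi-wave functions -/

theorem coeff_sMonomial_mul (κ : ℂ) (k : ℤ) (r : ℚ) (f : ZSeries) (ρ : ℚ) :
    (sMonomial κ k r * f).coeff ρ = HahnSeries.C κ * sPow k r * f.coeff ρ := by
  rw [sMonomial, HahnSeries.C_apply, HahnSeries.coeff_single_zero_mul]

/-- In every term of `ψ_A` and `ψ_B` the exponents of `s` and `z⁻¹` differ by an element of
`1/2 + ℤ`, so that going around `z⁻¹ = 0` has the effect of `s ↦ e^(2πi) s`, up to sign. -/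
theorem monodromy_term (κ : ℂ) (k : ℤ) {r e : ℚ} (p : PowerSeries ℂ) {j : ℕ}
    (h : r + e + 1 / 2 = j) : monodromy (sMonomial κ k r * (zPow e * ofPS p)) =
      -1 * (sMonomial κ (k + 1) r * (zPow e * ofPS p)) := by
  ext1
  funext ρ
  rw [neg_one_mul, HahnSeries.coeff_neg, coeff_monodromy, coeff_sMonomial_mul, coeff_sMonomial_mul,
    sPow_add_left]
  by_cases hρ : ∃ n : ℕ, ρ = -e + n
  · obtain ⟨n, rfl⟩ := hρ
    have : cexp2 (-e + n) = -cexp2 (((1 : ℤ) : ℚ) * r) := by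
      rw [show -e + (n : ℚ) = ((1 : ℤ) : ℚ) * r + 1 / 2 + ((n - j : ℤ) : ℚ) by push_cast; linarith,
        cexp2_add, cexp2_add, cexp2_half, cexp2_intCast]
      ring
    rw [this, map_neg]
    ring
  · rw [coeff_zPow_mul_ofPS_eq_zero hρ]
    simp

/-- The coefficients of the terms of `ψ_A` and `ψ_B` are rational functions of `s`, up to the
fractional power of `s` that the exponent of `z` determines. -/
theorem coeff_term_mem (κ : ℂ) (k : ℤ) {r e : ℚ} (p : PowerSeries ℂ) {j : ℕ}
    (h : r + e + 1 / 2 = j) (ρ : ℚ) : ∃ x, (sMonomial κ k r * (zPow e * ofPS p)).coeff ρ =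
      sPow 0 (ρ - 1 / 2) * ofRat x := by
  by_cases hρ : ∃ n : ℕ, ρ = -e + n
  · obtain ⟨n, rfl⟩ := hρ
    refine ⟨RatFunc.C (κ * cexp2 (k * r) * PowerSeries.coeff n p) * RatFunc.X ^ (j - n : ℤ), ?_⟩
    have h1 : sPow k r = HahnSeries.C (cexp2 (k * r)) * sPow 0 r := by
      have := sPow_add_left 0 k r
      rwa [zero_add] at this
    have h2 : sPow 0 r = sPow 0 (-e + n - 1 / 2) * sPow 0 (j - n : ℤ) := by
      rw [sPow_mul_sPow]
      congr 1
      push_cast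
      linarith
    rw [coeff_sMonomial_mul, coeff_zPow_mul_ofPS, map_mul, ofRat_C, ofRat_X_zpow, h1, h2, map_mul,
      map_mul]
    ring
  · refine ⟨0, ?_⟩
    rw [coeff_sMonomial_mul, coeff_zPow_mul_ofPS_eq_zero hρ, map_zero, mul_zero, mul_zero]

theorem IsSum.exists_ofRatio {t : ℕ → ZSeries} {y : ZSeries} (h : IsSum t y)
    (ht : ∀ j ρ, ∃ x, (t j).coeff ρ = sPow 0 (ρ - 1 / 2) * ofRat x) :
    ∃ g, y = HahnSeries.C (sPow 0 (-1 / 2)) * ofRatio g := by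
  have hy : ∀ ρ, ∃ x, y.coeff ρ = sPow 0 (ρ - 1 / 2) * ofRat x := by
    intro ρ
    choose x hx using fun j => ht j ρ
    rw [h.coeff, finsum_eq_sum_of_support_subset (s := (h.finite ρ).toFinset) _ (by simp)]
    refine ⟨∑ j ∈ (h.finite ρ).toFinset, x j, ?_⟩
    rw [map_sum, Finset.mul_sum]
    exact Finset.sum_congr rfl fun j _ => hx j
  obtain ⟨g, hg⟩ := exists_ofRatio_eq (f := HahnSeries.C (sPow 0 (1 / 2)) * y) (fun ρ => by
    obtain ⟨x, hx⟩ := hy ρ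
    refine ⟨x, ?_⟩
    rw [HahnSeries.C_apply, HahnSeries.coeff_single_zero_mul, hx, ← mul_assoc, sPow_mul_sPow]
    congr 2
    ring)
  refine ⟨g, ?_⟩
  rw [hg, ← mul_assoc, ← map_mul, sPow_mul_sPow, neg_div, neg_add_cancel, sPow_zero, map_one,
    one_mul]

/-- The term with `j = 0` is the only one that contributes to the leading coefficient. -/
theorem IsSum.ne_zero {t : ℕ → ZSeries} {y : ZSeries} (h : IsSum t y) {κ : ℕ → ℂ} {k : ℤ}
    {r e : ℕ → ℚ} {p : ℕ → PowerSeries ℂ}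
    (ht : ∀ j, t j = sMonomial (κ j) k (r j) * (zPow (e j) * ofPS (p j)))
    (he : ∀ j, j ≠ 0 → e j < e 0) (hκ : κ 0 ≠ 0) (hp : PowerSeries.constantCoeff (p 0) ≠ 0) :
    y ≠ 0 := by
  intro h0
  have h1 := h.coeff (-e 0)
  rw [h0, HahnSeries.coeff_zero, finsum_eq_single _ 0] at h1
  · rw [ht, coeff_sMonomial_mul] at h1
    have h2 := coeff_zPow_mul_ofPS (e 0) (p 0) 0
    rw [Nat.cast_zero, add_zero] at h2
    rw [h2, PowerSeries.coeff_zero_eq_constantCoeff_apply] at h1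
    exact mul_ne_zero (mul_ne_zero (HahnSeries.C_ne_zero hκ) (sPow_ne_zero k _))
      (HahnSeries.C_ne_zero hp) h1.symm
  · intro j hj
    have := he j hj
    rw [ht, coeff_sMonomial_mul, vanishesBelow_zPow_mul_ofPS _ _ _ (by linarith), mul_zero]

theorem ratCast_ne_zero (m : ℕ) [NeZero m] : (m : ℚ) ≠ 0 := Nat.cast_ne_zero.2 (NeZero.ne m)

theorem exponent_waveTermA (m₁ m₂ : ℕ) [NeZero m₁] (c : ℚ) (j : ℕ) :
    (c - 1 / 2 + (m₁ + m₂) * j) / m₁ + (1 / 2 - ((c - 1 / 2 + m₂ * j) / m₁ + 1)) + 1 / 2 =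
      (j : ℚ) := by
  have := ratCast_ne_zero m₁
  field_simp
  ring

theorem exponent_waveTermB (m₁ m₂ : ℕ) [NeZero m₂] (c : ℚ) (j : ℕ) :
    (-(c - 1 / 2) + (m₁ + m₂) * j) / m₂ + ((c - 1 / 2 - m₁ * j) / m₂ - 1 / 2) + 1 / 2 =
      (j : ℚ) := by
  have := ratCast_ne_zero m₂
  field_simp
  ring

/-- The index `(α, β, γ)` of the symbol `e^(αz) z^(βz) s^(γz)` of `ψ_A(z, e^(2πik) s)`. -/
def symbolA (m₁ : ℕ) (k : ℤ) : ℂ × ℚ × ℚ :=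
  ((2 * Real.pi * Complex.I * k * (1 / m₁ : ℚ), 0, 1 / m₁) : ℂ × ℚ × ℚ) +
    (((-1 / m₁ : ℚ) * Real.log m₁, 0, 0) : ℂ × ℚ × ℚ) +
    (((1 + Real.log m₁) / m₁, -1 / m₁, 0) : ℂ × ℚ × ℚ)

/-- The index `(α, β, γ)` of the symbol `e^(αz) z^(βz) s^(γz)` of `ψ_B(z, e^(2πik) s)`. -/
def symbolB (m₂ : ℕ) (k : ℤ) : ℂ × ℚ × ℚ :=
  ((2 * Real.pi * Complex.I * k * (-1 / m₂ : ℚ), 0, -1 / m₂) : ℂ × ℚ × ℚ) +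
    (((1 / m₂ : ℚ) * Real.log m₂, 0, 0) : ℂ × ℚ × ℚ) +
    ((-(1 + Real.log m₂) / m₂, 1 / m₂, 0) : ℂ × ℚ × ℚ)

section Waves

variable (m₁ m₂ : ℕ) [NeZero m₁] [NeZero m₂] (k : ℤ) (c : ℚ)

theorem monodromy_waveA : monodromy (waveA m₁ m₂ k c) = -1 * waveA m₁ m₂ (k + 1) c :=
  (isSum_waveA m₁ m₂ k c).twist (((isSum_waveA m₁ m₂ (k + 1) c).mul_left (-1)).congr fun j =>
    (monodromy_term _ _ _ (exponent_waveTermA m₁ m₂ c j)).symm)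

theorem monodromy_waveB : monodromy (waveB m₁ m₂ k c) = -1 * waveB m₁ m₂ (k + 1) c :=
  (isSum_waveB m₁ m₂ k c).twist (((isSum_waveB m₁ m₂ (k + 1) c).mul_left (-1)).congr fun j =>
    (monodromy_term _ _ _ (exponent_waveTermB m₁ m₂ c j)).symm)

theorem exists_ofRatio_waveA :
    ∃ g, waveA m₁ m₂ k c = HahnSeries.C (sPow 0 (-1 / 2)) * ofRatio g :=
  (isSum_waveA m₁ m₂ k c).exists_ofRatio fun j ρ =>
    coeff_term_mem _ _ _ (exponent_waveTermA m₁ m₂ c j) ρ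

theorem exists_ofRatio_waveB :
    ∃ g, waveB m₁ m₂ k c = HahnSeries.C (sPow 0 (-1 / 2)) * ofRatio g :=
  (isSum_waveB m₁ m₂ k c).exists_ofRatio fun j ρ =>
    coeff_term_mem _ _ _ (exponent_waveTermB m₁ m₂ c j) ρ

theorem waveA_ne_zero : waveA m₁ m₂ k c ≠ 0 := by
  refine (isSum_waveA m₁ m₂ k c).ne_zero (fun j => rfl) (fun j hj => ?_) ?_ ?_
  · have h1 : (0 : ℚ) < m₁ := Nat.cast_pos.2 (NeZero.pos m₁)
    have h2 : (0 : ℚ) < m₂ := Nat.cast_pos.2 (NeZero.pos m₂)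
    have h3 : (0 : ℚ) < j := Nat.cast_pos.2 (Nat.pos_of_ne_zero hj)
    have : (c - 1 / 2 + m₂ * (0 : ℕ)) / m₁ < (c - 1 / 2 + m₂ * j) / m₁ := by
      gcongr
      simpa using h3
    linarith
  · exact mul_ne_zero (natPow_ne_zero m₁ _) (by simp)
  · rw [PowerSeries.constantCoeff_inv, constantCoeff_gammaSeries]
    exact inv_ne_zero (gammaConst_ne_zero m₁ _)

theorem waveB_ne_zero : waveB m₁ m₂ k c ≠ 0 := by
  refine (isSum_waveB m₁ m₂ k c).ne_zero (fun j => rfl) (fun j hj => ?_) ?_ ?_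
  · have h1 : (0 : ℚ) < m₁ := Nat.cast_pos.2 (NeZero.pos m₁)
    have h2 : (0 : ℚ) < m₂ := Nat.cast_pos.2 (NeZero.pos m₂)
    have h3 : (0 : ℚ) < j := Nat.cast_pos.2 (Nat.pos_of_ne_zero hj)
    have : (c - 1 / 2 - m₁ * j) / m₂ < (c - 1 / 2 - m₁ * (0 : ℕ)) / m₂ := by
      gcongr
      simpa using h3
    linarith
  · exact mul_ne_zero (natPow_ne_zero m₂ _) (by simp)
  · rw [constantCoeff_gammaSeries]
    exact gammaConst_ne_zero m₂ _

theorem sMonomial_add_period (κ : ℂ) {m : ℕ} {r : ℚ} {n : ℤ} (h : m * r = n + 1 / 2) :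
    sMonomial κ (k + m) r = -1 * sMonomial κ k r := by
  rw [sMonomial, sPow_add_left, Int.cast_natCast, h, cexp2_add, cexp2_half, cexp2_intCast,
    sMonomial]
  simp

theorem waveA_add_period (c : ℤ) : waveA m₁ m₂ (k + m₁) c = -1 * waveA m₁ m₂ k c := by
  refine (isSum_waveA m₁ m₂ (k + m₁) c).unique
    (((isSum_waveA m₁ m₂ k c).mul_left (-1)).congr fun j => ?_)
  rw [waveTermA, waveTermA, sMonomial_add_period (n := c - 1 + (m₁ + m₂) * j), mul_assoc]
  have := ratCast_ne_zero m₁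
  push_cast
  field_simp
  ring

theorem waveB_add_period (c : ℤ) : waveB m₁ m₂ (k + m₂) c = -1 * waveB m₁ m₂ k c := by
  refine (isSum_waveB m₁ m₂ (k + m₂) c).unique
    (((isSum_waveB m₁ m₂ k c).mul_left (-1)).congr fun j => ?_)
  rw [waveTermB, waveTermB, sMonomial_add_period (n := -c + (m₁ + m₂) * j), mul_assoc]
  have := ratCast_ne_zero m₂
  push_cast
  field_simp
  ring

theorem psiA_eq : psiA m₁ m₂ c k = AddMonoidAlgebra.single (symbolA m₁ k) (waveA m₁ m₂ k c) := by
  rw [psiA, sPowLin, natPowLin, expMul, expMul, expMul, AddMonoidAlgebra.single_mul_single,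
    AddMonoidAlgebra.single_mul_single]
  rfl

theorem psiB_eq : psiB m₁ m₂ c k = AddMonoidAlgebra.single (symbolB m₂ k) (waveB m₁ m₂ k c) := by
  rw [psiB, sPowLin, natPowLin, expMul, expMul, expMul, AddMonoidAlgebra.single_mul_single,
    AddMonoidAlgebra.single_mul_single]
  rfl

end Waves

end

noncomputable section

open Matrix

/-! ### The matrix of the difference equation -/

section Matrices

variable (m₁ m₂ : ℕ) [NeZero m₂]

theorem W_apply (i j : Fin (m₁ + m₂)) : W m₁ m₂ i j =
    (if (i : ℕ) = 0 ∧ (j : ℕ) + 1 = m₁ then zHalf else 0) -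
      (if (i : ℕ) = 0 ∧ (j : ℕ) + 1 = m₁ + m₂ then sMul else 0) +
      (if (i : ℕ) = (j : ℕ) + 1 then sMul else 0) := by
  have h : ∑ k ∈ Finset.Icc 2 (m₁ + m₂), matrixUnit ZSeries (m₁ + m₂) k (k - 1) i j =
      if (i : ℕ) = (j : ℕ) + 1 then 1 else 0 := by
    split_ifs with hij
    · rw [Finset.sum_eq_single_of_mem ((i : ℕ) + 1)]
      · simp [matrixUnit, hij]
      · rw [Finset.mem_Icc]
        omega
      · intro k _ hk
        simp [matrixUnit, Ne.symm hk]
    · refine Finset.sum_eq_zero fun k hk => ?_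
      rw [Finset.mem_Icc] at hk
      simp only [matrixUnit, of_apply]
      rw [if_neg]
      omega
  have hz : zPow 1 - HahnSeries.C (HahnSeries.C (1 / 2)) = zHalf := rfl
  have hs : (HahnSeries.C (sPow 0 1) : ZSeries) = sMul := rfl
  rw [W, hz, hs, Matrix.add_apply, Matrix.sub_apply, Matrix.smul_apply, Matrix.smul_apply,
    Matrix.smul_apply, Matrix.sum_apply, h]
  simp [matrixUnit]

theorem W_mulVec_zero (v : Fin (m₁ + m₂) → ZSeries) (i p t : Fin (m₁ + m₂)) (hi : (i : ℕ) = 0)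
    (hp : (p : ℕ) + 1 = m₁) (ht : (t : ℕ) + 1 = m₁ + m₂) :
    (W m₁ m₂ *ᵥ v) i = zHalf * v p - sMul * v t := by
  have e : ∀ j, W m₁ m₂ i j * v j = (if j = p then zHalf * v j else 0) -
      (if j = t then sMul * v j else 0) := by
    intro j
    have h1 : (j : ℕ) + 1 = m₁ ↔ j = p := by rw [Fin.ext_iff]; omega
    have h2 : (j : ℕ) + 1 = m₁ + m₂ ↔ j = t := by rw [Fin.ext_iff]; omega
    rw [W_apply, if_neg (by omega : ¬ (i : ℕ) = (j : ℕ) + 1)]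
    simp only [hi, true_and, h1, h2, add_zero, sub_mul, ite_mul, zero_mul]
  simp [mulVec, dotProduct, e]

theorem W_mulVec_succ (v : Fin (m₁ + m₂) → ZSeries) (i p : Fin (m₁ + m₂))
    (hi : (i : ℕ) = p + 1) : (W m₁ m₂ *ᵥ v) i = sMul * v p := by
  have e : ∀ j, W m₁ m₂ i j * v j = if j = p then sMul * v j else 0 := by
    intro j
    have h1 : (i : ℕ) = (j : ℕ) + 1 ↔ j = p := by rw [Fin.ext_iff]; omega
    rw [W_apply, if_neg (by omega), if_neg (by omega)]
    simp only [h1, sub_zero, zero_add, ite_mul, zero_mul]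
  simp [mulVec, dotProduct, e]

theorem vecMul_W_of_lt (v : Fin (m₁ + m₂) → ZSeries) (j p : Fin (m₁ + m₂))
    (hp : (p : ℕ) = j + 1) (hj : (j : ℕ) + 1 ≠ m₁) : (v ᵥ* W m₁ m₂) j = sMul * v p := by
  have e : ∀ i, v i * W m₁ m₂ i j = if i = p then sMul * v i else 0 := by
    intro i
    have h1 : (i : ℕ) = (j : ℕ) + 1 ↔ i = p := by rw [Fin.ext_iff]; omega
    rw [W_apply, if_neg (by tauto), if_neg (by omega)]
    simp only [h1, sub_zero, zero_add, mul_ite, mul_zero, mul_comm]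
  simp [vecMul, dotProduct, e]

theorem vecMul_W_of_eq (v : Fin (m₁ + m₂) → ZSeries) (j p t : Fin (m₁ + m₂))
    (hp : (p : ℕ) = j + 1) (hj : (j : ℕ) + 1 = m₁) (ht : (t : ℕ) = 0) :
    (v ᵥ* W m₁ m₂) j = zHalf * v t + sMul * v p := by
  have e : ∀ i, v i * W m₁ m₂ i j = (if i = t then zHalf * v i else 0) +
      if i = p then sMul * v i else 0 := by
    intro i
    have h1 : (i : ℕ) = m₁ ↔ i = p := by rw [Fin.ext_iff]; omega
    have h2 : (i : ℕ) = 0 ↔ i = t := by rw [Fin.ext_iff]; omega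
    rw [W_apply, if_neg (by omega : ¬ ((i : ℕ) = 0 ∧ (j : ℕ) + 1 = m₁ + m₂))]
    simp only [h1, h2, hj, and_true, sub_zero, mul_add, mul_ite, mul_zero, mul_comm]
  simp [vecMul, dotProduct, e, Finset.sum_add_distrib]

theorem vecMul_W_last (v : Fin (m₁ + m₂) → ZSeries) (j t : Fin (m₁ + m₂))
    (hj : (j : ℕ) + 1 = m₁ + m₂) (ht : (t : ℕ) = 0) :
    (v ᵥ* W m₁ m₂) j = -(sMul * v t) := by
  have hm₂ := NeZero.pos m₂
  have e : ∀ i, v i * W m₁ m₂ i j = -(if i = t then sMul * v i else 0) := by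
    intro i
    have h2 : (i : ℕ) = 0 ↔ i = t := by rw [Fin.ext_iff]; omega
    rw [W_apply, if_neg (by omega), if_neg (by omega : ¬ (i : ℕ) = (j : ℕ) + 1)]
    simp only [h2, hj, and_true, zero_sub, add_zero, mul_neg, mul_ite, mul_zero, mul_comm]
  simp [vecMul, dotProduct, e]

variable [NeZero m₁]

theorem det_W_ne_zero : (W m₁ m₂).det ≠ 0 := by
  have hm₁ := NeZero.pos m₁
  have hm₂ := NeZero.pos m₂
  intro h
  obtain ⟨v, hv, hWv⟩ := exists_mulVec_eq_zero_iff.2 h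
  apply hv
  have h1 : ∀ p : Fin (m₁ + m₂), (p : ℕ) + 1 < m₁ + m₂ → v p = 0 := by
    intro p hp
    have := W_mulVec_succ m₁ m₂ v ⟨p + 1, hp⟩ p rfl
    rw [hWv, Pi.zero_apply, eq_comm, mul_eq_zero] at this
    exact this.resolve_left sMul_ne_zero
  funext p
  by_cases hp : (p : ℕ) + 1 < m₁ + m₂
  · exact h1 p hp
  · have := W_mulVec_zero m₁ m₂ v ⟨0, by omega⟩ ⟨m₁ - 1, by omega⟩ p rfl
      (Nat.sub_add_cancel hm₁) (by omega)
    rw [hWv, h1 ⟨m₁ - 1, by omega⟩ (by simp only; omega), Pi.zero_apply, mul_zero, zero_sub,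
      eq_comm, neg_eq_zero, mul_eq_zero] at this
    exact this.resolve_left sMul_ne_zero

end Matrices

/-! ### Systems of solutions of the scalar difference equation -/

/-- A system of solutions `y_j` of the scalar equation
`(z - 1/2) y(z) = s (y(z - m₁) + y(z + m₂))`, where the series `y j c` stands for `y_j(z + c)` up
to a symbol, which multiplies by `u_j⁻¹` under `z ↦ z - 1`. The leading terms `κ_j z^(-ν_j)` of
the multipliers `u_j` are different from each other. -/
structure IsWaveSystem (m₁ m₂ : ℕ) (y : Fin (m₁ + m₂) → ℤ → ZSeries)
    (u : Fin (m₁ + m₂) → ZSeries) (ν : Fin (m₁ + m₂) → ℚ) (κ : Fin (m₁ + m₂) → SSeries) :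
    Prop where
  shift_eq : ∀ j c, shift (-1) (y j c) = u j * y j (c - 1)
  sameLeading : ∀ j, SameLeading (u j) (HahnSeries.single (ν j) (κ j))
  coeff_ne_zero : ∀ j, κ j ≠ 0
  ne_zero : ∀ j c, y j c ≠ 0
  recurrence : ∀ j, zHalf * y j 0 = sMul * (y j (-m₁) + y j m₂)
  injective : ∀ i j, ν i = ν j → κ i = κ j → i = j

/-- The argument shift `-m₁ + i` that belongs to the row `i` of `Ψ`. -/
def rowShift (m₁ : ℕ) {l : ℕ} (i : Fin l) : ℤ := -m₁ + ((i : ℕ) + 1)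

/-- The matrix `(y_j(z - m₁ + i))` of a system of functions. -/
def waveMatrix (m₁ : ℕ) {l : ℕ} (y : Fin l → ℤ → ZSeries) : Matrix (Fin l) (Fin l) ZSeries :=
  of fun i j => y j (rowShift m₁ i)

/-- A series that is invariant under `z ↦ z - 1` is constant. -/
theorem eq_C_of_shift_eq {f : ZSeries} (h : shift (-1) f = f) :
    f = HahnSeries.C (f.coeff 0) := by
  rw [← sub_eq_zero]
  by_contra hg
  set g := f - HahnSeries.C (f.coeff 0) with hgdef
  have hs : shift (-1) g = g := by
    have := map_sub (shiftHom (-1)) f (HahnSeries.C (f.coeff 0))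
    rw [shiftHom_apply, shiftHom_apply, shiftHom_apply, h, shift_C] at this
    exact this
  have h0 : g.coeff 0 = 0 := by
    rw [hgdef, HahnSeries.coeff_sub, HahnSeries.C_apply, HahnSeries.coeff_single_same, sub_self]
  have hr : g.coeff g.order ≠ 0 := fun h => hg (HahnSeries.coeff_order_eq_zero.1 h)
  have hne : g.order ≠ 0 := fun h => hr (by rw [h, h0])
  -- The coefficient of `z^(-r-1)` in `g(z - 1) - g(z)` is `r g_r`, where `r` is the order of `g`.
  have key := (VanishesBelow.order g).shift_sub_sum (-1) 2 (g.order + 1)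
    (by push_cast; linarith)
  rw [hs, Finset.sum_range_succ, Finset.sum_range_one, taylorTerm_zero, sub_add_cancel_left,
    HahnSeries.coeff_neg, coeff_taylorTerm, neg_eq_zero, Nat.cast_one, add_sub_cancel_right,
    Ring.choose_one_right, mul_eq_zero, or_iff_left hr] at key
  have : (1 - (g.order + 1)) * (-1) ^ 1 = (0 : ℚ) := (map_eq_zero ratC).1 key
  apply hne
  linarith

namespace IsWaveSystem

variable {m₁ m₂ : ℕ} {y : Fin (m₁ + m₂) → ℤ → ZSeries}
  {u : Fin (m₁ + m₂) → ZSeries} {ν : Fin (m₁ + m₂) → ℚ} {κ : Fin (m₁ + m₂) → SSeries}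

theorem mult_ne_zero (h : IsWaveSystem m₁ m₂ y u ν κ) (j : Fin (m₁ + m₂)) : u j ≠ 0 :=
  (h.sameLeading j).ne_zero (HahnSeries.single_ne_zero (h.coeff_ne_zero j))

theorem eq_of_shift_eq (h : IsWaveSystem m₁ m₂ y u ν κ) {i j : Fin (m₁ + m₂)} {f : ZSeries}
    (hf : f ≠ 0) (hs : u j * shift (-1) f = u i * f) : i = j := by
  have h1 : SameLeading (u i) (u j) := by
    have := (SameLeading.refl (u j)).mul ((SameLeading.shift (-1) f).div (SameLeading.refl f))
    rwa [← mul_div_assoc, hs, mul_div_assoc, div_self hf, mul_one, mul_one] at this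
  have h2 := ((h.sameLeading i).symm.trans h1).trans (h.sameLeading j)
  obtain ⟨h3, h4⟩ := h2.single_eq (h.coeff_ne_zero i)
  exact h.injective i j h3 h4

theorem isUnit_det_diagonal (h : IsWaveSystem m₁ m₂ y u ν κ) : IsUnit (diagonal u).det := by
  rw [det_diagonal]
  exact isUnit_iff_ne_zero.2 (Finset.prod_ne_zero_iff.2 fun j _ => h.mult_ne_zero j)

variable [NeZero m₁] [NeZero m₂]

/-- The matrix form `W(z) Φ(z) = s Φ(z - 1)` of the scalar equation. -/
theorem W_mul (h : IsWaveSystem m₁ m₂ y u ν κ) :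
    W m₁ m₂ * waveMatrix m₁ y * diagonal u = sMul • (waveMatrix m₁ y).map (shiftHom (-1)) := by
  have hm₁ := NeZero.pos m₁
  have hm₂ := NeZero.pos m₂
  ext1 i j
  rw [mul_diagonal, Matrix.smul_apply, map_apply, smul_eq_mul, shiftHom_apply]
  change (W m₁ m₂ *ᵥ fun p => waveMatrix m₁ y p j) i * u j = sMul * shift (-1) (y j _)
  rw [h.shift_eq]
  by_cases hi : (i : ℕ) = 0
  · rw [W_mulVec_zero m₁ m₂ _ i ⟨m₁ - 1, by omega⟩ ⟨m₁ + m₂ - 1, by omega⟩ hi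
      (Nat.sub_add_cancel hm₁) (Nat.sub_add_cancel (by omega))]
    have e1 : rowShift m₁ (⟨m₁ - 1, by omega⟩ : Fin (m₁ + m₂)) = 0 := by
      simp only [rowShift]; omega
    have e2 : rowShift m₁ (⟨m₁ + m₂ - 1, by omega⟩ : Fin (m₁ + m₂)) = m₂ := by
      simp only [rowShift]; omega
    have e3 : rowShift m₁ i - 1 = -m₁ := by
      simp only [rowShift]; omega
    simp only [waveMatrix, of_apply]
    rw [e1, e2, e3, h.recurrence]
    ring
  · rw [W_mulVec_succ m₁ m₂ _ i ⟨i - 1, by omega⟩ (by simp only; omega)]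
    have e3 : rowShift m₁ (⟨i - 1, by omega⟩ : Fin (m₁ + m₂)) = rowShift m₁ i - 1 := by
      simp only [rowShift]; omega
    simp only [waveMatrix, of_apply]
    rw [e3]
    ring

/-- The functions of the system are linearly independent over all series: a relation with as few
terms as possible can be subtracted from its shift. -/
theorem det_ne_zero (h : IsWaveSystem m₁ m₂ y u ν κ) : (waveMatrix m₁ y).det ≠ 0 := by
  intro hdet
  obtain ⟨v, hv, hΦv⟩ := exists_mulVec_eq_zero_iff.2 hdet
  set Φ := waveMatrix m₁ y with hΦ
  have key : ∀ (S : Finset (Fin (m₁ + m₂))) (v : Fin (m₁ + m₂) → ZSeries),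
      (∀ j, j ∉ S → v j = 0) → Φ *ᵥ v = 0 → v = 0 := by
    intro S
    induction S using Finset.induction_on with
    | empty =>
      intro v hv _
      funext j
      exact hv j (Finset.notMem_empty j)
    | insert i S hi ih =>
      intro v hv hΦv
      by_cases hvi : v i = 0
      · refine ih v (fun j hj => ?_) hΦv
        by_cases hji : j = i
        · rw [hji, hvi]
        · exact hv j (by simp [hji, hj])
      · exfalso
        set w : Fin (m₁ + m₂) → ZSeries := (v i)⁻¹ • v with hw
        have hwi : w i = 1 := by
          simp [hw, hvi]
        have hΦw : Φ *ᵥ w = 0 := by rw [hw, mulVec_smul, hΦv, smul_zero]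
        set w' : Fin (m₁ + m₂) → ZSeries := diagonal u *ᵥ fun j => shift (-1) (w j) with hw'
        have hΦw' : Φ *ᵥ w' = 0 := by
          have h1 : W m₁ m₂ *ᵥ (Φ *ᵥ w') = 0 := by
            have h2 : (Φ.map (shiftHom (-1))) *ᵥ (fun j => shift (-1) (w j)) = 0 := by
              funext p
              have := RingHom.map_mulVec (shiftHom (-1)) Φ w p
              rw [hΦw, Pi.zero_apply, map_zero] at this
              exact this.symm
            rw [hw', mulVec_mulVec, mulVec_mulVec, h.W_mul, smul_mulVec, h2, smul_zero]
          by_contra hne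
          exact det_W_ne_zero m₁ m₂ (exists_mulVec_eq_zero_iff.1 ⟨_, hne, h1⟩)
        have hx := ih (w' - u i • w) (fun j hj => ?_) (by
          rw [mulVec_sub, mulVec_smul, hΦw, hΦw', smul_zero, sub_zero])
        · have hwj : ∀ j, j ≠ i → w j = 0 := by
            intro j hji
            by_contra hne
            have h1 := congrFun hx j
            rw [Pi.sub_apply, Pi.zero_apply, sub_eq_zero, hw', mulVec_diagonal, Pi.smul_apply,
              smul_eq_mul] at h1
            exact hji (h.eq_of_shift_eq hne h1).symm
          have hm₁ := NeZero.pos m₁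
          have h1 := congrFun hΦw ⟨0, by omega⟩
          rw [mulVec, dotProduct,
            Finset.sum_eq_single i (fun j _ hji => by rw [hwj j hji, mul_zero])
              (fun hni => absurd (Finset.mem_univ i) hni), hwi, mul_one] at h1
          exact h.ne_zero _ _ h1
        · rw [Pi.sub_apply, hw', mulVec_diagonal, Pi.smul_apply, smul_eq_mul]
          by_cases hji : j = i
          · have h1 : shift (-1) (1 : ZSeries) = 1 := map_one (shiftHom (-1))
            rw [hji, hwi, h1, sub_self]
          · have h1 : w j = 0 := by
              rw [hw, Pi.smul_apply, hv j (by simp [hji, hj]), smul_zero]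
            have h2 : shift (-1) (0 : ZSeries) = 0 := map_zero (shiftHom (-1))
            rw [h1, h2, mul_zero, mul_zero, sub_zero]
  exact hv (key Finset.univ v (fun j hj => absurd (Finset.mem_univ j) hj) hΦv)

theorem isUnit_det (h : IsWaveSystem m₁ m₂ y u ν κ) : IsUnit (waveMatrix m₁ y).det :=
  isUnit_iff_ne_zero.2 h.det_ne_zero

/-- A matrix that has the functions of the system as eigenvectors, with eigenvalues that do not
depend on `z`, solves the topological difference equation. -/
theorem isTDESolution (h : IsWaveSystem m₁ m₂ y u ν κ) {x : Fin (m₁ + m₂) → SSeries}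
    {M : Matrix (Fin (m₁ + m₂)) (Fin (m₁ + m₂)) ZSeries}
    (hM : M * waveMatrix m₁ y = waveMatrix m₁ y * diagonal fun j => HahnSeries.C (x j)) :
    IsTDESolution m₁ m₂ M := by
  set Φ := waveMatrix m₁ y with hΦ
  have hW := h.W_mul
  have h1 : M.map (shiftHom (-1)) * Φ.map (shiftHom (-1)) =
      Φ.map (shiftHom (-1)) * diagonal fun j => HahnSeries.C (x j) := by
    rw [← Matrix.map_mul, hM, Matrix.map_mul, diagonal_map (map_zero _)]
    congr 2
    funext j
    exact shift_C _ _
  have h2 : M.map (shiftHom (-1)) * W m₁ m₂ * (Φ * diagonal u) =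
      W m₁ m₂ * M * (Φ * diagonal u) := by
    calc M.map (shiftHom (-1)) * W m₁ m₂ * (Φ * diagonal u)
        = M.map (shiftHom (-1)) * (W m₁ m₂ * Φ * diagonal u) := by simp only [Matrix.mul_assoc]
      _ = (W m₁ m₂ * Φ * diagonal u) * diagonal fun j => HahnSeries.C (x j) := by
          rw [hW, Matrix.mul_smul, h1, Matrix.smul_mul]
      _ = W m₁ m₂ * (Φ * diagonal fun j => HahnSeries.C (x j)) * diagonal u := by
          simp only [Matrix.mul_assoc, diagonal_mul_diagonal, mul_comm]
      _ = W m₁ m₂ * M * (Φ * diagonal u) := by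
          rw [← hM]
          simp only [Matrix.mul_assoc]
  have hu : IsUnit (Φ * diagonal u) := by
    rw [isUnit_iff_isUnit_det, det_mul]
    exact h.isUnit_det.mul h.isUnit_det_diagonal
  exact hu.mul_right_cancel h2

/-- A solution of the topological difference equation that vanishes at `z = ∞` is zero. -/
theorem eq_zero_of_isTDESolution (h : IsWaveSystem m₁ m₂ y u ν κ)
    {D : Matrix (Fin (m₁ + m₂)) (Fin (m₁ + m₂)) ZSeries} (hD : IsTDESolution m₁ m₂ D)
    {r : ℚ} (hr : 0 < r) (hv : ∀ i j, VanishesBelow r (D i j)) : D = 0 := by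
  set Φ := waveMatrix m₁ y with hΦ
  have hW := h.W_mul
  have hu := h.isUnit_det
  set C := Φ⁻¹ * D * Φ with hC
  have hDC : D * Φ = Φ * C := by
    rw [hC, ← Matrix.mul_assoc, ← Matrix.mul_assoc, mul_nonsing_inv _ hu, Matrix.one_mul]
  have hτ : D.map (shiftHom (-1)) * Φ.map (shiftHom (-1)) =
      Φ.map (shiftHom (-1)) * C.map (shiftHom (-1)) := by
    rw [← Matrix.map_mul, hDC, Matrix.map_mul]
  have hD' : D.map (shiftHom (-1)) * W m₁ m₂ = W m₁ m₂ * D := hD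
  have h1 : W m₁ m₂ * Φ * (C * diagonal u) =
      W m₁ m₂ * Φ * (diagonal u * C.map (shiftHom (-1))) := by
    calc W m₁ m₂ * Φ * (C * diagonal u) = W m₁ m₂ * (Φ * C) * diagonal u := by
          simp only [Matrix.mul_assoc]
      _ = D.map (shiftHom (-1)) * (W m₁ m₂ * Φ * diagonal u) := by
          rw [← hDC, ← Matrix.mul_assoc, ← hD']
          simp only [Matrix.mul_assoc]
      _ = W m₁ m₂ * Φ * diagonal u * C.map (shiftHom (-1)) := by
          rw [hW, Matrix.mul_smul, hτ, Matrix.smul_mul]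
      _ = _ := by simp only [Matrix.mul_assoc]
  have hWu : IsUnit (W m₁ m₂ * Φ) := by
    rw [isUnit_iff_isUnit_det, det_mul]
    exact (isUnit_iff_ne_zero.2 (det_W_ne_zero m₁ m₂)).mul hu
  have h2 := hWu.mul_left_cancel h1
  have h3 : ∀ i j, u i * shift (-1) (C i j) = u j * C i j := by
    intro i j
    have := congrFun (congrFun h2 i) j
    rw [mul_diagonal, diagonal_mul, map_apply, shiftHom_apply] at this
    rw [← this, mul_comm]
  have h4 : ∀ i j, i ≠ j → C i j = 0 := by
    intro i j hij
    by_contra hne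
    exact hij (h.eq_of_shift_eq hne (h3 i j)).symm
  have h5 : ∀ j, C j j = HahnSeries.C ((C j j).coeff 0) := fun j =>
    eq_C_of_shift_eq (mul_left_cancel₀ (h.mult_ne_zero j) (h3 j j))
  have h6 : ∀ i j, ∑ p, D i p * Φ p j = Φ i j * HahnSeries.C ((C j j).coeff 0) := by
    intro i j
    have := congrFun (congrFun hDC i) j
    have e : ∑ p, Φ i p * C p j = Φ i j * C j j :=
      Finset.sum_eq_single j (fun p _ hp => by rw [h4 p j hp, mul_zero])
        (fun hni => absurd (Finset.mem_univ j) hni)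
    rw [mul_apply, mul_apply, e] at this
    rw [this, ← h5 j]
  have h7 : ∀ j, (C j j).coeff 0 = 0 := by
    intro j
    by_contra hx
    have : Nonempty (Fin (m₁ + m₂)) := ⟨j⟩
    -- In the row where the `j`-th column has the least order, `D Φ` has a greater order.
    obtain ⟨i, hi⟩ := Finite.exists_min fun p => (Φ p j).order
    have h8 : VanishesBelow (r + (Φ i j).order) (∑ p, D i p * Φ p j) :=
      VanishesBelow.sum fun p _ => (hv i p).mul ((VanishesBelow.order (Φ p j)).mono (hi p))
    have h9 := h8 (Φ i j).order (by linarith)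
    rw [h6, mul_comm, HahnSeries.C_apply, HahnSeries.coeff_single_zero_mul, mul_eq_zero,
      or_iff_right hx, HahnSeries.coeff_order_eq_zero] at h9
    exact h.ne_zero _ _ h9
  have h10 : C = 0 := by
    ext1 i j
    by_cases hij : i = j
    · rw [hij, h5 j, h7 j, map_zero]
      rfl
    · exact h4 i j hij
  have h11 : D * Φ = 0 := by rw [hDC, h10, Matrix.mul_zero]
  rw [← Matrix.mul_one D, ← mul_nonsing_inv Φ hu, ← Matrix.mul_assoc, h11, Matrix.zero_mul]

end IsWaveSystem

end

noncomputable section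

open Matrix

/-! ### The leading coefficient of a solution -/

/-- The condition that the topological difference equation puts on the leading coefficient `A` of a
solution: `A` is constant along the diagonals on both sides of the line between the columns `m₁`
and `m₁ + 1`, and the first and the last column contain one entry each. -/
structure IsBand {R : Type*} [Zero R] {l : ℕ} (m₁ : ℕ) (A : Matrix (Fin l) (Fin l) R) : Prop where
  first_col : ∀ i j : Fin l, (j : ℕ) = 0 → (i : ℕ) ≠ 0 → A i j = 0
  step : ∀ i i' j j' : Fin l, (i' : ℕ) = i + 1 → (j' : ℕ) = j + 1 → (j' : ℕ) ≠ m₁ →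
    A i' j' = A i j
  last_col : ∀ i j : Fin l, (j : ℕ) + 1 = l → (i : ℕ) + 1 ≠ l → A i j = 0

theorem IsBand.ext {R : Type*} [Zero R] {l m₁ : ℕ} {A B : Matrix (Fin l) (Fin l) R}
    (hA : IsBand m₁ A) (hB : IsBand m₁ B)
    (h₀ : ∀ i j : Fin l, (i : ℕ) = 0 → (j : ℕ) < m₁ → A i j = B i j)
    (h₁ : ∀ i j : Fin l, (i : ℕ) + 1 = l → m₁ ≤ (j : ℕ) → A i j = B i j) : A = B := by
  have k₀ : ∀ n : ℕ, ∀ i j : Fin l, (i : ℕ) = n → (j : ℕ) < m₁ → A i j = B i j := by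
    intro n
    induction n with
    | zero => exact h₀
    | succ n ih =>
      intro i j hi hj
      by_cases hj0 : (j : ℕ) = 0
      · rw [hA.first_col i j hj0 (by omega), hB.first_col i j hj0 (by omega)]
      · have hi' : n < l := by omega
        have hj' : (j : ℕ) - 1 < l := by omega
        rw [hA.step ⟨n, hi'⟩ i ⟨j - 1, hj'⟩ j hi (by simp only; omega) hj.ne,
          hB.step ⟨n, hi'⟩ i ⟨j - 1, hj'⟩ j hi (by simp only; omega) hj.ne]
        exact ih _ _ rfl (by simp only; omega)
  have k₁ : ∀ n : ℕ, ∀ i j : Fin l, (i : ℕ) + 1 + n = l → m₁ ≤ (j : ℕ) → A i j = B i j := by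
    intro n
    induction n with
    | zero => exact h₁
    | succ n ih =>
      intro i j hi hj
      by_cases hj0 : (j : ℕ) + 1 = l
      · rw [hA.last_col i j hj0 (by omega), hB.last_col i j hj0 (by omega)]
      · have hi' : (i : ℕ) + 1 < l := by omega
        have hj' : (j : ℕ) + 1 < l := by omega
        rw [← hA.step i ⟨i + 1, hi'⟩ j ⟨j + 1, hj'⟩ rfl rfl (by simp only; omega),
          ← hB.step i ⟨i + 1, hi'⟩ j ⟨j + 1, hj'⟩ rfl rfl (by simp only; omega)]
        exact ih _ _ (by simp only; omega) (by simp only; omega)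
  ext1 i j
  by_cases hj : (j : ℕ) < m₁
  · exact k₀ _ i j rfl hj
  · exact k₁ (l - 1 - i) i j (by omega) (by omega)

theorem IsBand.zero {R : Type*} [Zero R] {l m₁ : ℕ} : IsBand m₁ (0 : Matrix (Fin l) (Fin l) R) :=
  ⟨fun _ _ _ _ => rfl, fun _ _ _ _ _ _ _ => rfl, fun _ _ _ _ => rfl⟩

theorem VanishesBelow.coeff_shift_self {r : ℚ} {f : ZSeries} (h : VanishesBelow r f) (c : ℚ) :
    (OrbifoldTDE.shift c f).coeff r = f.coeff r := by
  have := h.shift_sub c r (by linarith)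
  rwa [HahnSeries.coeff_sub, sub_eq_zero] at this

theorem coeff_sMul_mul (f : ZSeries) (ρ : ℚ) : (sMul * f).coeff ρ = sPow 0 1 * f.coeff ρ := by
  rw [sMul, HahnSeries.C_apply, HahnSeries.coeff_single_zero_mul]

theorem VanishesBelow.coeff_zHalf_mul {r : ℚ} {f : ZSeries} (h : VanishesBelow r f) :
    (zHalf * f).coeff (r - 1) = f.coeff r := by
  rw [zHalf, sub_mul, HahnSeries.coeff_sub, coeff_zPow_mul, sub_add_cancel, constC,
    RingHom.comp_apply, HahnSeries.C_apply, HahnSeries.coeff_single_zero_mul,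
    h (r - 1) (by linarith),
    mul_zero, sub_zero]

/-- Each of the conditions compares the lowest coefficients in one entry of the difference equation;
the first one comes from the column that contains `z - 1/2`. -/
theorem isBand_of_isTDESolution {m₁ m₂ : ℕ} [NeZero m₁] [NeZero m₂]
    {M : Matrix (Fin (m₁ + m₂)) (Fin (m₁ + m₂)) ZSeries} (hM : IsTDESolution m₁ m₂ M) {p : ℚ}
    (hv : ∀ i j, VanishesBelow p (M i j)) : IsBand m₁ (M.map fun f => f.coeff p) := by
  have hm₁ := NeZero.pos m₁
  have hm₂ := NeZero.pos m₂
  have hs : sPow 0 1 ≠ 0 := sPow_ne_zero 0 1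
  have row : ∀ i j, ((fun q => shift (-1) (M i q)) ᵥ* W m₁ m₂) j = (W m₁ m₂ *ᵥ fun q => M q j) i :=
    fun i j => congrFun (congrFun hM i) j
  have first : ∀ i j : Fin (m₁ + m₂), (j : ℕ) = 0 → (i : ℕ) ≠ 0 → (M i j).coeff p = 0 := by
    intro i j hj hi
    have h := row i ⟨m₁ - 1, by omega⟩
    rw [vecMul_W_of_eq m₁ m₂ _ ⟨m₁ - 1, by omega⟩ ⟨m₁, by omega⟩ j (by simp only; omega)
      (Nat.sub_add_cancel hm₁) hj, W_mulVec_succ m₁ m₂ _ i ⟨i - 1, by omega⟩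
      (by simp only; omega)] at h
    have h' := congrArg (fun f : ZSeries => f.coeff (p - 1)) h
    simp only [HahnSeries.coeff_add, coeff_sMul_mul] at h'
    rwa [((hv i j).shift (-1)).coeff_zHalf_mul, (hv i j).coeff_shift_self,
      ((hv _ _).shift (-1)) (p - 1) (by linarith), hv _ _ (p - 1) (by linarith), mul_zero,
      add_zero] at h'
  refine ⟨first, ?_, ?_⟩
  · intro i i' j j' hi hj hne
    have h := row i' j
    rw [vecMul_W_of_lt m₁ m₂ _ j j' hj (by omega), W_mulVec_succ m₁ m₂ _ i' i hi] at h
    have h' := mul_left_cancel₀ sMul_ne_zero h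
    simp only [map_apply]
    rw [← (hv i' j').coeff_shift_self (-1), h']
  · intro i j hj hi
    have h := row ⟨i + 1, by omega⟩ j
    rw [vecMul_W_last m₁ m₂ _ j ⟨0, by omega⟩ hj rfl, W_mulVec_succ m₁ m₂ _ _ i rfl, ← mul_neg] at h
    have h' := congrArg (fun f : ZSeries => f.coeff p) (mul_left_cancel₀ sMul_ne_zero h)
    simp only [HahnSeries.coeff_neg] at h'
    rw [(hv _ _).coeff_shift_self, first _ _ rfl (Nat.succ_ne_zero _), neg_zero] at h'
    exact h'.symm

/-- The product of two series with the leading terms `x z^(-p)` and `w z^(-r)`. -/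
theorem SameLeading.vanishesBelow_mul_sub {m g : ZSeries} {p r : ℚ} {x w : SSeries}
    (hm : VanishesBelow (p + 1) (m - HahnSeries.single p x))
    (hg : SameLeading g (HahnSeries.single r w)) :
    VanishesBelow (p + r + 1) (m * g - HahnSeries.single (p + r) (x * w)) := by
  obtain ⟨e, he, rfl⟩ := hg
  have h : m * (HahnSeries.single r w * (1 + e)) - HahnSeries.single (p + r) (x * w) =
      (m - HahnSeries.single p x) * HahnSeries.single r w +
        m * (HahnSeries.single r w * e) := by
    rw [← HahnSeries.single_mul_single]
    ring
  have hm' : VanishesBelow p m := by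
    have := (hm.mono (by linarith : p ≤ p + 1)).add (VanishesBelow.single (le_refl p) x)
    rwa [sub_add_cancel] at this
  rw [h]
  refine ((hm.mul (VanishesBelow.single le_rfl w)).mono (by linarith)).add
    ((hm'.mul ((VanishesBelow.single le_rfl w).mul he)).mono (by linarith))

namespace IsWaveSystem

variable {m₁ m₂ : ℕ} {y : Fin (m₁ + m₂) → ℤ → ZSeries}
  {u : Fin (m₁ + m₂) → ZSeries} {ν : Fin (m₁ + m₂) → ℚ} {κ : Fin (m₁ + m₂) → SSeries}

/-- `y_j(z + c) = (κ_j z^(-ν_j))^c y_j(z) (1 + O(z⁻¹))`. -/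
theorem sameLeading_div (h : IsWaveSystem m₁ m₂ y u ν κ) (j : Fin (m₁ + m₂)) (c : ℤ) :
    SameLeading (y j c / y j 0) (HahnSeries.single (c * ν j) (κ j ^ c)) := by
  have hκ := h.coeff_ne_zero j
  set e : ZSeries := HahnSeries.single (ν j) (κ j) with he
  have he0 : e ≠ 0 := HahnSeries.single_ne_zero hκ
  have step : ∀ c, SameLeading (y j c) (e * y j (c - 1)) := fun c =>
    (SameLeading.shift (-1) (y j c)).symm.trans (by
      rw [h.shift_eq]
      exact (h.sameLeading j).mul (SameLeading.refl _))
  have key : SameLeading (y j c) (HahnSeries.single (c * ν j) (κ j ^ c) * y j 0) := by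
    induction c using Int.induction_on with
    | zero => simpa using SameLeading.refl (y j 0)
    | succ c ih =>
      have h1 := (step (c + 1)).trans ((SameLeading.refl e).mul (by
        rw [add_sub_cancel_right]
        exact ih))
      rw [← mul_assoc, he, HahnSeries.single_mul_single, ← zpow_one_add₀ hκ] at h1
      convert h1 using 3
      · congr 1
        push_cast
        ring
      · rw [add_comm]
    | pred c ih =>
      have h1 := (SameLeading.refl e⁻¹).mul ((step (-c)).symm.trans ih)
      rw [inv_mul_cancel_left₀ he0, ← mul_assoc, he, HahnSeries.inv_single,
        HahnSeries.single_mul_single, ← _root_.zpow_neg_one, ← zpow_add₀ hκ] at h1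
      convert h1 using 3
      · congr 1
        push_cast
        ring
      · rw [sub_eq_neg_add]
  have := key.div (SameLeading.refl (y j 0))
  rwa [mul_div_cancel_right₀ _ (h.ne_zero j 0)] at this

/-- The leading coefficients in a row of the equation `M Φ = Φ diag(x)`, as far as they are seen in
the `j`-th column. -/
theorem leading_row (h : IsWaveSystem m₁ m₂ y u ν κ)
    {M : Matrix (Fin (m₁ + m₂)) (Fin (m₁ + m₂)) ZSeries} {x : Fin (m₁ + m₂) → SSeries}
    (hM : M * waveMatrix m₁ y = waveMatrix m₁ y * diagonal fun j => HahnSeries.C (x j)) {p : ℚ}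
    {A : Matrix (Fin (m₁ + m₂)) (Fin (m₁ + m₂)) SSeries}
    (hA : ∀ i q, VanishesBelow (p + 1) (M i q - HahnSeries.single p (A i q)))
    (i j t : Fin (m₁ + m₂)) (hν : ν j ≠ 0)
    (h₁ : ∀ q : Fin (m₁ + m₂), (rowShift m₁ t : ℚ) * ν j < rowShift m₁ q * ν j + 1)
    (h₂ : p + rowShift m₁ t * ν j < rowShift m₁ i * ν j + 1) :
    A i t = if p + ((t : ℚ) - i) * ν j = 0 then x j * κ j ^ ((i : ℤ) - t) else 0 := by
  have hκ := h.coeff_ne_zero j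
  have hy := h.ne_zero j 0
  set g : Fin (m₁ + m₂) → ZSeries := fun q => y j (rowShift m₁ q) / y j 0 with hg
  have eq : ∑ q, M i q * g q = HahnSeries.C (x j) * g i := by
    have := congrFun (congrFun hM i) j
    rw [mul_apply, mul_diagonal] at this
    have h1 : ∀ q, M i q * g q = M i q * waveMatrix m₁ y q j / y j 0 := fun q =>
      (mul_div_assoc _ _ _).symm
    simp only [h1]
    rw [← Finset.sum_div, this, mul_comm, mul_div_assoc]
    rfl
  have hl : (∑ q, M i q * g q).coeff (p + rowShift m₁ t * ν j) =
      A i t * κ j ^ rowShift m₁ t := by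
    have h1 : ∀ q, (M i q * g q).coeff (p + rowShift m₁ t * ν j) =
        if q = t then A i t * κ j ^ rowShift m₁ t else 0 := by
      intro q
      have h2 := SameLeading.vanishesBelow_mul_sub (hA i q) (h.sameLeading_div j (rowShift m₁ q))
        (p + rowShift m₁ t * ν j) (by have := h₁ q; linarith)
      rw [HahnSeries.coeff_sub, sub_eq_zero, HahnSeries.coeff_single] at h2
      rw [hg, h2]
      by_cases hqt : q = t
      · rw [hqt, if_pos rfl, if_pos rfl]
      · rw [if_neg hqt, if_neg]
        intro h3
        apply hqt
        have h4 : (rowShift m₁ t : ℚ) = rowShift m₁ q := mul_right_cancel₀ hν (add_left_cancel h3)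
        have h5 : rowShift m₁ t = rowShift m₁ q := by exact_mod_cast h4
        rw [Fin.ext_iff]
        simp only [rowShift] at h5
        omega
    rw [HahnSeries.coeff_sum, Finset.sum_congr rfl fun q _ => h1 q]
    simp
  have hr := SameLeading.vanishesBelow_mul_sub (m := HahnSeries.C (x j)) (p := 0) (x := x j)
    (by rw [HahnSeries.C_apply, sub_self]; exact VanishesBelow.zero)
    (h.sameLeading_div j (rowShift m₁ i)) (p + rowShift m₁ t * ν j) (by linarith)
  rw [HahnSeries.coeff_sub, sub_eq_zero, HahnSeries.coeff_single] at hr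
  have hcast : (rowShift m₁ t : ℚ) - rowShift m₁ i = (t : ℚ) - i := by
    simp only [rowShift]
    push_cast
    ring
  have hcond : p + rowShift m₁ t * ν j = 0 + rowShift m₁ i * ν j ↔ p + ((t : ℚ) - i) * ν j = 0 := by
    rw [← hcast]
    constructor <;> intro h3 <;> linarith
  have key : A i t * κ j ^ rowShift m₁ t =
      if p + ((t : ℚ) - i) * ν j = 0 then x j * κ j ^ rowShift m₁ i else 0 := by
    rw [← hl, eq, hr]
    by_cases hc : p + ((t : ℚ) - i) * ν j = 0
    · rw [if_pos hc, if_pos (hcond.2 hc)]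
    · rw [if_neg hc, if_neg fun h3 => hc (hcond.1 h3)]
  have hz := zpow_ne_zero (rowShift m₁ t) hκ
  rw [eq_div_of_mul_eq hz key]
  split_ifs
  · rw [mul_div_assoc, ← zpow_sub₀ hκ]
    congr 2
    simp only [rowShift]
    ring
  · rw [zero_div]

end IsWaveSystem

end

noncomputable section

open Matrix

/-! ### The system of the quasi-wave functions -/

theorem sPow_zpow (k : ℤ) (r : ℚ) (n : ℤ) : sPow k r ^ n = sPow k (n * r) := by
  induction n using Int.induction_on with
  | zero => simp
  | succ n ih =>
    rw [zpow_add_one₀ (sPow_ne_zero k r), ih, sPow_mul_sPow]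
    push_cast
    ring_nf
  | pred n ih =>
    rw [zpow_sub_one₀ (sPow_ne_zero k r), ih, ← sPow_neg, sPow_mul_sPow]
    push_cast
    ring_nf

section Definitions

variable (m₁ m₂ : ℕ)

/-- The integer `k` such that the `j`-th column of `Ψ` consists of values at `e^(2πik) s`. -/
def branch (j : Fin (m₁ + m₂)) : ℤ := if (j : ℕ) + 1 ≤ m₁ then (j : ℕ) else m₁ + m₂ - ((j : ℕ) + 1)

/-- The exponent `ν` such that the `j`-th column is multiplied by `(s/z)^ν` and a constant, up to
`O(z⁻¹)`, under `z ↦ z + 1`. -/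
def slope (j : Fin (m₁ + m₂)) : ℚ := if (j : ℕ) + 1 ≤ m₁ then 1 / m₁ else -1 / m₂

/-- `ψ_j(z + c, s)` without its symbol. -/
def wave [NeZero m₁] [NeZero m₂] (j : Fin (m₁ + m₂)) (c : ℤ) : ZSeries :=
  if (j : ℕ) + 1 ≤ m₁ then waveA m₁ m₂ (branch m₁ m₂ j) c else waveB m₁ m₂ (branch m₁ m₂ j) c

/-- The multiplier of the `j`-th column under `z ↦ z - 1`. -/
def mult (j : Fin (m₁ + m₂)) : ZSeries :=
  if (j : ℕ) + 1 ≤ m₁ then multA m₁ (branch m₁ m₂ j) else multB m₂ (branch m₁ m₂ j)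

/-- The constant factor of the `j`-th eigenvalue of `P_a`. -/
def eigenConst (a : ℕ) (j : Fin (m₁ + m₂)) : ℂ :=
  if a ≤ m₁ ↔ (j : ℕ) + 1 ≤ m₁ then
    (if a ≤ m₁ then 1 else -1) * cexp2 (-(branch m₁ m₂ j * q m₁ m₂ a))
  else 0

/-- The `j`-th eigenvalue of `P_a`. -/
def eigenvalue (a : ℕ) (j : Fin (m₁ + m₂)) : SSeries :=
  HahnSeries.C (eigenConst m₁ m₂ a j) * sPow 0 (1 - q m₁ m₂ a)

end Definitions

variable (m₁ m₂ : ℕ) [NeZero m₁] [NeZero m₂]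

theorem slope_ne_zero (j : Fin (m₁ + m₂)) : slope m₁ m₂ j ≠ 0 := by
  have h₁ := ratCast_ne_zero m₁
  have h₂ := ratCast_ne_zero m₂
  rw [slope]
  split_ifs
  · exact div_ne_zero one_ne_zero h₁
  · exact div_ne_zero (by norm_num) h₂

theorem eq_zero_of_cexp2_div {m : ℕ} [NeZero m] {n : ℤ} (h : cexp2 (n / m) = 1) (h₁ : n < m)
    (h₂ : -m < n) : n = 0 := by
  obtain ⟨t, ht⟩ := cexp2_eq_one h
  have hm := ratCast_ne_zero m
  rw [div_eq_iff hm] at ht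
  have h3 : n = t * m := by exact_mod_cast ht
  exact Int.eq_zero_of_abs_lt_dvd ⟨t, by rw [h3, mul_comm]⟩ (abs_lt.2 ⟨h₂, h₁⟩)

theorem eq_of_slope_eq {i j : Fin (m₁ + m₂)} (h : slope m₁ m₂ i = slope m₁ m₂ j) :
    (i : ℕ) + 1 ≤ m₁ ↔ (j : ℕ) + 1 ≤ m₁ := by
  have h₁ : (0 : ℚ) < 1 / m₁ := one_div_pos.2 (Nat.cast_pos.2 (NeZero.pos m₁))
  have h₂ : (0 : ℚ) < 1 / m₂ := one_div_pos.2 (Nat.cast_pos.2 (NeZero.pos m₂))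
  have h₃ : (-1 : ℚ) / m₂ = -(1 / m₂) := neg_div _ _
  rw [slope, slope, h₃] at h
  split_ifs at h with h4 h5 h5
  · simp [h4, h5]
  · linarith
  · linarith
  · simp [h4, h5]

theorem isWaveSystem_wave : IsWaveSystem m₁ m₂ (wave m₁ m₂) (mult m₁ m₂) (slope m₁ m₂)
    fun j => sPow (branch m₁ m₂ j) (slope m₁ m₂ j) where
  shift_eq j c := by
    rw [wave, wave, mult]
    split_ifs
    · rw [shift_waveA]
      push_cast
      rfl
    · rw [shift_waveB]
      push_cast
      rfl
  sameLeading j := by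
    rw [mult, slope]
    split_ifs
    · exact sameLeading_multA m₁ _
    · exact sameLeading_multB m₂ _
  coeff_ne_zero j := sPow_ne_zero _ _
  ne_zero j c := by
    rw [wave]
    split_ifs
    · exact waveA_ne_zero m₁ m₂ _ _
    · exact waveB_ne_zero m₁ m₂ _ _
  recurrence j := by
    simp only [wave]
    split_ifs
    · simpa using waveA_recurrence m₁ m₂ (branch m₁ m₂ j)
    · simpa using waveB_recurrence m₁ m₂ (branch m₁ m₂ j)
  injective i j hν hκ := by
    have hij := eq_of_slope_eq m₁ m₂ hν
    rw [sPow_eq, sPow_eq, hν] at hκ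
    have h1 := HahnSeries.single_injective _ hκ
    have h2 : cexp2 ((branch m₁ m₂ i - branch m₁ m₂ j) * slope m₁ m₂ j) = 1 := by
      rw [sub_mul, sub_eq_add_neg, cexp2_add, cexp2_neg, h1, mul_inv_cancel₀ (cexp2_ne_zero _)]
    rw [Fin.ext_iff]
    by_cases hj : (j : ℕ) + 1 ≤ m₁
    · have hi := hij.2 hj
      simp only [branch, slope, if_pos hi, if_pos hj] at h2
      have := eq_zero_of_cexp2_div (m := m₁) (n := (i : ℤ) - j)
        (by rw [← h2]; congr 1; push_cast; ring) (by omega) (by omega)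
      omega
    · have hi := fun hi => hj (hij.1 hi)
      simp only [branch, slope, if_neg hi, if_neg hj] at h2
      have := eq_zero_of_cexp2_div (m := m₂) (n := (i : ℤ) - j)
        (by rw [← h2]; congr 1; push_cast; ring) (by omega) (by omega)
      omega

theorem exists_ofRatio_wave (j : Fin (m₁ + m₂)) (c : ℤ) :
    ∃ g, wave m₁ m₂ j c = HahnSeries.C (sPow 0 (-1 / 2)) * ofRatio g := by
  rw [wave]
  split_ifs
  · exact exists_ofRatio_waveA m₁ m₂ _ _
  · exact exists_ofRatio_waveB m₁ m₂ _ _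

/-! ### The solution of the difference equation -/

variable (a : ℕ)

/-- The matrix `Ψ` without the symbols of its columns. -/
def reducedPsi : Matrix (Fin (m₁ + m₂)) (Fin (m₁ + m₂)) ZSeries := waveMatrix m₁ (wave m₁ m₂)

/-- The matrix `Ψ P_a Ψ⁻¹`, in which the symbols of the columns of `Ψ` cancel. -/
def solution : Matrix (Fin (m₁ + m₂)) (Fin (m₁ + m₂)) ZSeries :=
  reducedPsi m₁ m₂ * (diagonal fun j => HahnSeries.C (eigenvalue m₁ m₂ a j)) *
    (reducedPsi m₁ m₂)⁻¹

theorem isUnit_det_reducedPsi : IsUnit (reducedPsi m₁ m₂).det :=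
  (isWaveSystem_wave m₁ m₂).isUnit_det

theorem isUnit_reducedPsi : IsUnit (reducedPsi m₁ m₂) :=
  (isUnit_iff_isUnit_det _).2 (isUnit_det_reducedPsi m₁ m₂)

theorem solution_mul : solution m₁ m₂ a * reducedPsi m₁ m₂ =
    reducedPsi m₁ m₂ * diagonal fun j => HahnSeries.C (eigenvalue m₁ m₂ a j) := by
  rw [solution, Matrix.mul_assoc, nonsing_inv_mul _ (isUnit_det_reducedPsi m₁ m₂), Matrix.mul_one]

theorem isTDESolution_solution : IsTDESolution m₁ m₂ (solution m₁ m₂ a) :=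
  (isWaveSystem_wave m₁ m₂).isTDESolution (solution_mul m₁ m₂ a)

/-- `e^(-2πi n q_a)` has the period in `n` that the branches of the columns with nonzero eigenvalues
have. -/
theorem cexp2_mul_q {m : ℕ} (n : ℤ) (ha : a ≤ m₁ ∧ m = m₁ ∨ ¬ a ≤ m₁ ∧ m = m₂) :
    cexp2 (-((n + m : ℤ) * q m₁ m₂ a)) = cexp2 (-(n * q m₁ m₂ a)) := by
  have h₁ := ratCast_ne_zero m₁
  have h₂ := ratCast_ne_zero m₂
  have : ∃ t : ℤ, (m : ℚ) * q m₁ m₂ a = t := by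
    obtain ⟨ha, rfl⟩ | ⟨ha, rfl⟩ := ha
    · refine ⟨a, ?_⟩
      rw [q, if_pos ha, mul_div_cancel₀ _ h₁]
      rfl
    · refine ⟨m₁ + m - a, ?_⟩
      rw [q, if_neg ha, mul_div_cancel₀ _ h₂]
      push_cast
      rfl
  obtain ⟨t, ht⟩ := this
  have e : -((n + m : ℤ) * q m₁ m₂ a) = -(n * q m₁ m₂ a) + (-t : ℤ) := by
    push_cast
    rw [← ht]
    ring
  rw [e, cexp2_add, cexp2_intCast, mul_one]

/-- The monodromy permutes the columns of `Ψ` up to sign, and it multiplies the eigenvalues by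
`e^(2πi q_a)`. -/
theorem exists_monodromy_eq (j : Fin (m₁ + m₂)) : ∃ (j' : Fin (m₁ + m₂)) (ε : ZSeries), ε ≠ 0 ∧
    (∀ c, monodromy (wave m₁ m₂ j' c) = ε * wave m₁ m₂ j c) ∧
    eigenConst m₁ m₂ a j' = cexp2 (q m₁ m₂ a) * eigenConst m₁ m₂ a j := by
  have hm₁ := NeZero.pos m₁
  have hm₂ := NeZero.pos m₂
  have hone : (-1 : ZSeries) ≠ 0 := neg_ne_zero.2 one_ne_zero
  have hq : ∀ k : ℤ, cexp2 (-((k - 1 : ℤ) * q m₁ m₂ a)) =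
      cexp2 (q m₁ m₂ a) * cexp2 (-(k * q m₁ m₂ a)) := by
    intro k
    rw [← cexp2_add]
    congr 1
    push_cast
    ring
  have hc : ∀ (x y : ℂ) (ε : ℂ) (p : Prop) [Decidable p], x = cexp2 (q m₁ m₂ a) * y ∨ ¬ p →
      (if p then ε * x else 0) = cexp2 (q m₁ m₂ a) * (if p then ε * y else 0) := by
    intro x y ε p _ h
    split_ifs with hp
    · rw [h.resolve_right (not_not.2 hp)]
      ring
    · rw [mul_zero]
  by_cases hj : (j : ℕ) + 1 ≤ m₁
  · by_cases hk : (j : ℕ) = 0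
    · refine ⟨⟨m₁ - 1, by omega⟩, 1, one_ne_zero, fun c => ?_, ?_⟩
      · simp only [wave, branch, Nat.sub_add_cancel hm₁, le_refl, if_true, if_pos hj]
        rw [monodromy_waveA, show ((m₁ - 1 : ℕ) : ℤ) + 1 = (j : ℕ) + m₁ by omega,
          waveA_add_period]
        ring
      · simp only [eigenConst, branch, Nat.sub_add_cancel hm₁, le_refl, hj, if_true]
        apply hc
        by_cases ha : a ≤ m₁
        · left
          rw [← cexp2_mul_q m₁ m₂ a (j : ℕ) (Or.inl ⟨ha, rfl⟩), ← hq]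
          congr 4
          omega
        · exact Or.inr (by simpa using ha)
    · have hj' : (j : ℕ) - 1 + 1 ≤ m₁ := by omega
      refine ⟨⟨j - 1, by omega⟩, -1, hone, fun c => ?_, ?_⟩
      · simp only [wave, branch, if_pos hj', if_pos hj]
        rw [monodromy_waveA]
        congr 2
        omega
      · simp only [eigenConst, branch, hj', hj, if_true]
        apply hc
        left
        rw [← hq]
        congr 4
        omega
  · by_cases hk : (j : ℕ) + 1 = m₁ + m₂
    · have hj' : ¬ m₁ + 1 ≤ m₁ := by omega
      refine ⟨⟨m₁, by omega⟩, 1, one_ne_zero, fun c => ?_, ?_⟩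
      · simp only [wave, branch, if_neg hj', if_neg hj]
        rw [monodromy_waveB, show ((m₁ : ℕ) : ℤ) + m₂ - ((m₁ : ℕ) + 1) + 1 =
          m₁ + m₂ - ((j : ℕ) + 1) + m₂ by omega, waveB_add_period]
        ring
      · simp only [eigenConst, branch, hj', hj, if_false]
        apply hc
        by_cases ha : a ≤ m₁
        · exact Or.inr (by simpa using ha)
        · left
          rw [← cexp2_mul_q m₁ m₂ a (m₁ + m₂ - ((j : ℕ) + 1)) (Or.inr ⟨ha, rfl⟩), ← hq]
          congr 4
          omega
    · have hj' : ¬ (j : ℕ) + 1 + 1 ≤ m₁ := by omega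
      refine ⟨⟨j + 1, by omega⟩, -1, hone, fun c => ?_, ?_⟩
      · simp only [wave, branch, if_neg hj', if_neg hj]
        rw [monodromy_waveB]
        congr 2
        omega
      · simp only [eigenConst, branch, hj', hj, if_false]
        apply hc
        left
        rw [← hq]
        congr 4
        omega

theorem monodromy_C (x : SSeries) : monodromy (HahnSeries.C x) = HahnSeries.C x := by
  ext1
  funext ρ
  rw [coeff_monodromy, HahnSeries.C_apply x]
  by_cases hρ : ρ = 0
  · rw [hρ, cexp2_zero, map_one, one_mul]
  · rw [HahnSeries.coeff_single_of_ne hρ, mul_zero]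

theorem monodromy_solution (i j : Fin (m₁ + m₂)) :
    monodromy (solution m₁ m₂ a i j) = constC (cexp2 (q m₁ m₂ a)) * solution m₁ m₂ a i j := by
  set M := solution m₁ m₂ a with hM
  have key : M.map monodromy * reducedPsi m₁ m₂ =
      (constC (cexp2 (q m₁ m₂ a)) • M) * reducedPsi m₁ m₂ := by
    rw [Matrix.smul_mul, solution_mul]
    ext1 i j
    obtain ⟨j', ε, hε, h1, h2⟩ := exists_monodromy_eq m₁ m₂ a j
    have h3 := congrArg monodromy (congrFun (congrFun (solution_mul m₁ m₂ a) i) j')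
    rw [mul_apply, map_sum, mul_diagonal, map_mul, monodromy_C] at h3
    have h4 : ∀ p, monodromy (reducedPsi m₁ m₂ p j') = ε * reducedPsi m₁ m₂ p j := fun p => h1 _
    simp only [map_mul, h4, mul_left_comm _ ε] at h3
    rw [← Finset.mul_sum, mul_assoc] at h3
    have h5 := mul_left_cancel₀ hε h3
    rw [mul_apply, Matrix.smul_apply, mul_diagonal, smul_eq_mul]
    refine h5.trans ?_
    rw [eigenvalue, eigenvalue, h2, constC, RingHom.comp_apply]
    simp only [map_mul]
    ring
  exact congrFun (congrFun ((isUnit_reducedPsi m₁ m₂).mul_right_cancel key) i) j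

/-- The exponents of `z⁻¹` in the solution are congruent to `q_a` modulo the integers. -/
theorem exists_exponent_eq {i j : Fin (m₁ + m₂)} {ρ : ℚ}
    (h : (solution m₁ m₂ a i j).coeff ρ ≠ 0) : ∃ n : ℤ, ρ = q m₁ m₂ a - 1 + n := by
  have h1 := congrArg (fun f : ZSeries => f.coeff ρ) (monodromy_solution m₁ m₂ a i j)
  simp only [constC, RingHom.comp_apply] at h1
  rw [coeff_monodromy, HahnSeries.C_apply (_ : SSeries), HahnSeries.coeff_single_zero_mul] at h1
  have h2 := HahnSeries.C_injective (mul_right_cancel₀ h h1)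
  obtain ⟨n, hn⟩ := cexp2_eq_one (r := ρ - q m₁ m₂ a) (by
    rw [sub_eq_add_neg, cexp2_add, cexp2_neg, h2, mul_inv_cancel₀ (cexp2_ne_zero _)])
  refine ⟨n + 1, ?_⟩
  push_cast
  linarith

theorem ofRatio_C (x : ℂ) : ofRatio (HahnSeries.C (RatFunc.C x)) = constC x := by
  ext1
  funext ρ
  rw [coeff_ofRatio, constC, RingHom.comp_apply, HahnSeries.C_apply, HahnSeries.C_apply]
  by_cases hρ : ρ = 0
  · rw [hρ, HahnSeries.coeff_single_same, HahnSeries.coeff_single_same, sPow_zero, one_mul, ofRat_C]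
  · rw [HahnSeries.coeff_single_of_ne hρ, HahnSeries.coeff_single_of_ne hρ, map_zero, mul_zero]

/-- The coefficient of `z^(-ρ)` in the solution is `s^(ρ+1-q_a)` times a rational function. -/
theorem exists_ofRatio_solution : ∃ X : Matrix (Fin (m₁ + m₂)) (Fin (m₁ + m₂))
    (HahnSeries ℚ (RatFunc ℂ)), ∀ i j, solution m₁ m₂ a i j =
      HahnSeries.C (sPow 0 (1 - q m₁ m₂ a)) * ofRatio (X i j) := by
  choose g hg using fun j i => exists_ofRatio_wave m₁ m₂ j (rowShift m₁ i)
  set G : Matrix (Fin (m₁ + m₂)) (Fin (m₁ + m₂)) (HahnSeries ℚ (RatFunc ℂ)) :=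
    of fun i j => g j i with hG
  set e : ZSeries := HahnSeries.C (sPow 0 (-1 / 2)) with he
  have hΦ : reducedPsi m₁ m₂ = e • G.map ofRatio := by
    ext1 i j
    exact hg j i
  have hdet : IsUnit G.det := by
    rw [isUnit_iff_ne_zero]
    intro h0
    have := isUnit_det_reducedPsi m₁ m₂
    rw [hΦ, det_smul, ← RingHom.mapMatrix_apply, ← RingHom.map_det, h0, map_zero, mul_zero] at this
    exact not_isUnit_zero this
  set X := G * (diagonal fun j => HahnSeries.C (RatFunc.C (eigenConst m₁ m₂ a j))) * G⁻¹ with hX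
  have hXG : X * G = G * diagonal fun j => HahnSeries.C (RatFunc.C (eigenConst m₁ m₂ a j)) := by
    rw [hX, Matrix.mul_assoc, nonsing_inv_mul _ hdet, Matrix.mul_one]
  refine ⟨X, ?_⟩
  have key : solution m₁ m₂ a * reducedPsi m₁ m₂ =
      ((HahnSeries.C (sPow 0 (1 - q m₁ m₂ a)) : ZSeries) • X.map ofRatio) * reducedPsi m₁ m₂ := by
    rw [solution_mul, hΦ, Matrix.smul_mul, Matrix.mul_smul, Matrix.smul_mul, ← Matrix.map_mul, hXG,
      Matrix.map_mul, diagonal_map (map_zero _)]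
    congr 1
    ext1 i j
    rw [mul_diagonal, Matrix.smul_apply, mul_diagonal, ofRatio_C, smul_eq_mul, eigenvalue, map_mul,
      constC, RingHom.comp_apply]
    ac_rfl
  intro i j
  exact congrFun (congrFun ((isUnit_reducedPsi m₁ m₂).mul_right_cancel key) i) j

end

noncomputable section

open Matrix

variable (m₁ m₂ : ℕ) (a : ℕ)

/-! ### The leading coefficient of the solution -/

theorem K_apply {R : Type} [Ring R] (ha' : a < m₁ + m₂) (i j : Fin (m₁ + m₂)) :
    K R m₁ m₂ a i j =
      if a ≤ m₁ then if (i : ℕ) < a ∧ (j : ℕ) = m₁ - a + i then 1 else 0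
      else if m₁ ≤ (j : ℕ) ∧ (i : ℕ) = j + (a - m₁) then -1 else 0 := by
  rw [K]
  split_ifs with ha h h
  · rw [Matrix.sum_apply, Finset.sum_eq_single_of_mem ((i : ℕ) + 1)
      (Finset.mem_Icc.2 ⟨by omega, by omega⟩)]
    · simp only [matrixUnit, of_apply]
      rw [if_pos ⟨trivial, by omega⟩]
    · intro b _ hb
      simp only [matrixUnit, of_apply]
      rw [if_neg (by omega)]
  · rw [Matrix.sum_apply]
    refine Finset.sum_eq_zero fun b hb => ?_
    rw [Finset.mem_Icc] at hb
    simp only [matrixUnit, of_apply]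
    rw [if_neg (by omega)]
  · rw [Matrix.neg_apply, Matrix.sum_apply, Finset.sum_eq_single_of_mem ((j : ℕ) - m₁ + 1)
      (Finset.mem_Icc.2 ⟨by omega, by omega⟩)]
    · simp only [matrixUnit, of_apply]
      rw [if_pos ⟨by omega, by omega⟩]
    · intro b _ hb
      simp only [matrixUnit, of_apply]
      rw [if_neg (by omega)]
  · rw [Matrix.neg_apply, Matrix.sum_apply, neg_eq_zero]
    refine Finset.sum_eq_zero fun b hb => ?_
    rw [Finset.mem_Icc] at hb
    simp only [matrixUnit, of_apply]
    rw [if_neg (by omega)]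

theorem map_K_apply {R S : Type} [Ring R] [Ring S] (φ : R →+* S) (ha' : a < m₁ + m₂)
    (i j : Fin (m₁ + m₂)) : φ (K R m₁ m₂ a i j) = K S m₁ m₂ a i j := by
  rw [K_apply m₁ m₂ a ha', K_apply m₁ m₂ a ha']
  split_ifs <;> simp

theorem coeff_K_laurent (ha' : a < m₁ + m₂) (i j : Fin (m₁ + m₂)) (n : ℤ) :
    (K (LaurentSeries (RatFunc ℂ)) m₁ m₂ a i j).coeff n =
      if n = 0 then K (RatFunc ℂ) m₁ m₂ a i j else 0 := by
  rw [← map_K_apply m₁ m₂ a (HahnSeries.C : RatFunc ℂ →+* LaurentSeries (RatFunc ℂ)) ha',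
    HahnSeries.C_apply]
  split_ifs with h
  · rw [h, HahnSeries.coeff_single_same]
  · exact HahnSeries.coeff_single_of_ne h

variable [NeZero m₁] [NeZero m₂]

theorem isBand_K {R : Type} [Ring R] (ha' : a < m₁ + m₂) :
    IsBand m₁ (K R m₁ m₂ a) := by
  have hm₁ := NeZero.pos m₁
  have hm₂ := NeZero.pos m₂
  refine ⟨fun i j hj hi => ?_, fun i i' j j' hi hj hne => ?_, fun i j hj hi => ?_⟩
  · rw [K_apply m₁ m₂ a ha']
    split_ifs <;> first | rfl | omega
  · rw [K_apply m₁ m₂ a ha', K_apply m₁ m₂ a ha']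
    split_ifs <;> first | rfl | omega
  · rw [K_apply m₁ m₂ a ha']
    split_ifs <;> first | rfl | omega

theorem q_le_one : q m₁ m₂ a ≤ 1 := by
  rw [q]
  split_ifs with h
  · rw [div_le_one (Nat.cast_pos.2 (NeZero.pos m₁))]
    exact_mod_cast h
  · rw [div_le_one (Nat.cast_pos.2 (NeZero.pos m₂))]
    have : (m₁ : ℚ) < a := by exact_mod_cast not_le.1 h
    linarith

/-- The leading coefficients in the first and in the last row of the solution, computed from the
columns of `Ψ` on the principal branch. -/
theorem coeff_solution_row {n : ℤ} (hn : n ≤ 0)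
    (hv : ∀ i j, VanishesBelow (q m₁ m₂ a - 1 + n) (solution m₁ m₂ a i j))
    {i t : Fin (m₁ + m₂)} (hi : branch m₁ m₂ i = 0)
    (ht : ∀ p : Fin (m₁ + m₂), ((t : ℚ) - p) * slope m₁ m₂ i < 1) :
    (solution m₁ m₂ a i t).coeff (q m₁ m₂ a - 1 + n) =
      if q m₁ m₂ a - 1 + n + ((t : ℚ) - i) * slope m₁ m₂ i = 0 then
        HahnSeries.C (eigenConst m₁ m₂ a i) * sPow 0 n
      else 0 := by
  set p : ℚ := q m₁ m₂ a - 1 + n with hp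
  have hA : ∀ i j, VanishesBelow (p + 1) (solution m₁ m₂ a i j -
      HahnSeries.single p ((solution m₁ m₂ a i j).coeff p)) := by
    intro i j
    refine VanishesBelow.sub_single fun ρ hρ hne => ?_
    by_contra h
    obtain ⟨k, hk⟩ := exists_exponent_eq m₁ m₂ a h
    have h1 : ¬ ρ < p := fun hlt => h (hv i j ρ hlt)
    rw [hk, hp, add_lt_add_iff_left, Int.cast_lt, not_lt] at h1
    rw [hk, hp, add_assoc, add_lt_add_iff_left] at hρ
    have h2 : k < n + 1 := by exact_mod_cast hρ
    apply hne
    rw [hk, hp, show k = n by omega]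
  have hn' : (n : ℚ) ≤ 0 := by exact_mod_cast hn
  have hq := q_le_one m₁ m₂ a
  have hcast : ∀ p' : Fin (m₁ + m₂), ((t : ℚ) - p') * slope m₁ m₂ i =
      rowShift m₁ t * slope m₁ m₂ i - rowShift m₁ p' * slope m₁ m₂ i := by
    intro p'
    simp only [rowShift]
    push_cast
    ring
  have hr := (isWaveSystem_wave m₁ m₂).leading_row (solution_mul m₁ m₂ a)
    (A := of fun i j => (solution m₁ m₂ a i j).coeff p) hA i i t (slope_ne_zero m₁ m₂ i)
    (fun p' => by have := ht p'; rw [hcast] at this; linarith)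
    (by have := ht i; rw [hcast] at this; linarith)
  refine hr.trans ?_
  split_ifs with hc
  · have e : 1 - q m₁ m₂ a + ((i : ℤ) - t : ℤ) * slope m₁ m₂ i = n := by
      push_cast
      linarith
    rw [hi, sPow_zpow, eigenvalue, mul_assoc, sPow_mul_sPow, e]
  · rfl

theorem branch_eq_zero {i : Fin (m₁ + m₂)} (hi : (i : ℕ) = 0 ∨ (i : ℕ) + 1 = m₁ + m₂) :
    branch m₁ m₂ i = 0 := by
  have hm₁ := NeZero.pos m₁
  have hm₂ := NeZero.pos m₂
  rw [branch]
  split_ifs <;> omega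

/-- A nonzero leading coefficient of the solution in an order `≤ q_a - 1` occurs in the order
`q_a - 1` only, where it is `K_a`. -/
theorem coeff_solution_eq (ha : 1 ≤ a) (ha' : a < m₁ + m₂) {n : ℤ} (hn : n ≤ 0)
    (hv : ∀ i j, VanishesBelow (q m₁ m₂ a - 1 + n) (solution m₁ m₂ a i j)) :
    ((solution m₁ m₂ a).map fun f => f.coeff (q m₁ m₂ a - 1 + n)) =
      if n = 0 then K SSeries m₁ m₂ a else 0 := by
  have hm₁ := NeZero.pos m₁
  have hm₂ := NeZero.pos m₂
  have hp₁ : (0 : ℚ) < m₁ := Nat.cast_pos.2 hm₁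
  have hp₂ : (0 : ℚ) < m₂ := Nat.cast_pos.2 hm₂
  have hband : IsBand m₁ (if n = 0 then K SSeries m₁ m₂ a else 0) := by
    split_ifs
    · exact isBand_K m₁ m₂ a ha'
    · exact IsBand.zero
  have hn₁ : n = 0 ∨ n * m₁ ≤ -m₁ := by
    rcases eq_or_lt_of_le hn with h | h
    · exact Or.inl h
    · right
      have : n * m₁ ≤ -1 * m₁ := mul_le_mul_of_nonneg_right (by omega) (by omega)
      omega
  have hn₂ : n = 0 ∨ n * m₂ ≤ -m₂ := by
    rcases eq_or_lt_of_le hn with h | h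
    · exact Or.inl h
    · right
      have : n * m₂ ≤ -1 * m₂ := mul_le_mul_of_nonneg_right (by omega) (by omega)
      omega
  refine (isBand_of_isTDESolution (isTDESolution_solution m₁ m₂ a) hv).ext hband ?_ ?_
  · intro i t hi ht
    have hs : slope m₁ m₂ i = 1 / m₁ := by rw [slope, if_pos (by omega)]
    have hb := branch_eq_zero m₁ m₂ (Or.inl hi)
    rw [map_apply, coeff_solution_row m₁ m₂ a hn hv hb fun p => by
      rw [hs, mul_one_div, div_lt_one hp₁]
      have h1 : (t : ℚ) < m₁ := by exact_mod_cast ht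
      have h2 : (0 : ℚ) ≤ p := Nat.cast_nonneg _
      linarith]
    by_cases hc : a ≤ m₁
    · have he : eigenConst m₁ m₂ a i = 1 := by
        rw [eigenConst, if_pos (by simp only [hc, true_iff]; omega), if_pos hc, hb]
        simp
      have hcond : q m₁ m₂ a - 1 + n + ((t : ℚ) - i) * slope m₁ m₂ i = 0 ↔
          (a : ℤ) - m₁ + n * m₁ + t = 0 := by
        rw [← Int.cast_eq_zero (α := ℚ), ← mul_right_inj' hp₁.ne', hs, q, if_pos hc, hi, mul_zero]
        apply eq_iff_eq_cancel_right.2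
        push_cast
        field_simp
        ring
      rcases hn₁ with h0 | h0
      · rw [h0] at hcond ⊢
        rw [if_pos rfl, K_apply m₁ m₂ a ha', if_pos hc, he]
        refine if_congr ?_ (by simp) rfl
        rw [hcond]
        omega
      · rw [if_neg (by rw [hcond]; omega), if_neg (by rintro rfl; omega)]
        rfl
    · have he : eigenConst m₁ m₂ a i = 0 := by
        rw [eigenConst, if_neg (by simp only [hc, false_iff]; omega)]
      rw [he, map_zero, zero_mul, ite_self]
      split_ifs
      · rw [K_apply m₁ m₂ a ha', if_neg hc, if_neg (by omega)]
      · rfl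
  · intro i t hi ht
    have hs : slope m₁ m₂ i = -1 / m₂ := by rw [slope, if_neg (by omega)]
    have hb := branch_eq_zero m₁ m₂ (Or.inr hi)
    have hi' : (i : ℚ) = m₁ + m₂ - 1 := by
      rw [eq_sub_iff_add_eq]
      exact_mod_cast hi
    rw [map_apply, coeff_solution_row m₁ m₂ a hn hv hb fun p => by
      rw [hs, mul_div_assoc', div_lt_one hp₂]
      have h1 : (m₁ : ℚ) ≤ t := by exact_mod_cast ht
      have h2 : (p : ℚ) < m₁ + m₂ := by exact_mod_cast p.2
      linarith]
    by_cases hc : a ≤ m₁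
    · have he : eigenConst m₁ m₂ a i = 0 := by
        rw [eigenConst, if_neg (by simp only [hc, true_iff]; omega)]
      rw [he, map_zero, zero_mul, ite_self]
      split_ifs
      · rw [K_apply m₁ m₂ a ha', if_pos hc, if_neg (by omega)]
      · rfl
    · have he : eigenConst m₁ m₂ a i = -1 := by
        rw [eigenConst, if_pos (by simp only [hc, false_iff]; omega), if_neg hc, hb]
        simp
      have hcond : q m₁ m₂ a - 1 + n + ((t : ℚ) - i) * slope m₁ m₂ i = 0 ↔
          (m₁ : ℤ) + m₂ - a - m₂ + n * m₂ - (t - (m₁ + m₂ - 1)) = 0 := by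
        rw [← Int.cast_eq_zero (α := ℚ), ← mul_right_inj' hp₂.ne', hs, q, if_neg hc, hi', mul_zero]
        apply eq_iff_eq_cancel_right.2
        push_cast
        field_simp
        ring
      rcases hn₂ with h0 | h0
      · rw [h0] at hcond ⊢
        rw [if_pos rfl, K_apply m₁ m₂ a ha', if_neg hc, he]
        refine if_congr ?_ (by simp) rfl
        rw [hcond]
        omega
      · rw [if_neg (by rw [hcond]; omega), if_neg (by rintro rfl; omega)]
        rfl

theorem vanishesBelow_solution (ha : 1 ≤ a) (ha' : a < m₁ + m₂) (i j : Fin (m₁ + m₂)) :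
    VanishesBelow (q m₁ m₂ a - 1) (solution m₁ m₂ a i j) := by
  -- A lower bound for the order that is below `q_a - 1` can be raised by `1`.
  have key : ∀ k : ℕ, (∀ i j, VanishesBelow (q m₁ m₂ a - 1 + (-k : ℤ)) (solution m₁ m₂ a i j)) →
      ∀ i j, VanishesBelow (q m₁ m₂ a - 1) (solution m₁ m₂ a i j) := by
    intro k
    induction k with
    | zero =>
      intro h i j
      simpa using h i j
    | succ k ih =>
      intro h
      have h0 := coeff_solution_eq m₁ m₂ a ha ha' (by omega) h
      rw [if_neg (by omega)] at h0
      refine ih fun i j ρ hρ => ?_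
      by_contra hne
      obtain ⟨n, hn⟩ := exists_exponent_eq m₁ m₂ a hne
      have h1 : ¬ ρ < q m₁ m₂ a - 1 + (-(k + 1 : ℕ) : ℤ) := fun hlt => hne (h i j ρ hlt)
      rw [hn, add_lt_add_iff_left, Int.cast_lt] at h1 hρ
      apply hne
      rw [hn, show n = -(k + 1 : ℕ) by omega]
      exact congrFun (congrFun h0 i) j
  obtain ⟨B, hB⟩ := (Set.finite_range fun ij : Fin (m₁ + m₂) × Fin (m₁ + m₂) =>
    (solution m₁ m₂ a ij.1 ij.2).order).bddBelow
  obtain ⟨k, hk⟩ := exists_nat_gt (q m₁ m₂ a - 1 - B)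
  refine key k (fun i j => ?_) i j
  refine (VanishesBelow.order _).mono (le_trans ?_ (hB ⟨(i, j), rfl⟩))
  push_cast
  linarith

theorem coeff_solution (ha : 1 ≤ a) (ha' : a < m₁ + m₂) (i j : Fin (m₁ + m₂)) :
    (solution m₁ m₂ a i j).coeff (q m₁ m₂ a - 1) = K SSeries m₁ m₂ a i j := by
  have h := coeff_solution_eq m₁ m₂ a ha ha' le_rfl fun i j => by
    simpa using vanishesBelow_solution m₁ m₂ a ha ha' i j
  simpa using congrFun (congrFun h i) j

/-! ### Laurent series with rational coefficients -/

theorem coeff_ofLaurentZ (f : LaurentSeries (RatFunc ℂ)) (n : ℤ) :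
    (ofLaurentZ f).coeff n = ofRat (f.coeff n) := by
  change (HahnSeries.embDomain _ (HahnSeries.map f ofRat)).coeff _ = _
  exact HahnSeries.embDomain_coeff

theorem coeff_ofLaurentZ_eq_zero (f : LaurentSeries (RatFunc ℂ)) {ρ : ℚ} (h : ∀ n : ℤ, ρ ≠ n) :
    (ofLaurentZ f).coeff ρ = 0 := by
  change (HahnSeries.embDomain _ (HahnSeries.map f ofRat)).coeff _ = _
  apply HahnSeries.embDomain_of_notMem_range
  rintro ⟨n, hn⟩
  exact h n hn.symm

theorem exists_laurent_solution : ∃ N : Matrix (Fin (m₁ + m₂)) (Fin (m₁ + m₂))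
    (LaurentSeries (RatFunc ℂ)),
    solution m₁ m₂ a = zPow (1 - q m₁ m₂ a) • N.map ofLaurentZ := by
  obtain ⟨X, hX⟩ := exists_ofRatio_solution m₁ m₂ a
  have hcoeff : ∀ i j (n : ℤ), (solution m₁ m₂ a i j).coeff (q m₁ m₂ a - 1 + n) =
      ofRat (RatFunc.X ^ n * (X i j).coeff (q m₁ m₂ a - 1 + n)) := by
    intro i j n
    rw [hX, HahnSeries.C_apply, HahnSeries.coeff_single_zero_mul, coeff_ofRatio, ← mul_assoc,
      sPow_mul_sPow, map_mul, ofRat_X_zpow]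
    congr 3
    ring
  have hbdd : ∀ i j, BddBelow (Function.support fun n : ℤ =>
      RatFunc.X ^ n * (X i j).coeff (q m₁ m₂ a - 1 + n)) := by
    intro i j
    obtain ⟨B, hB⟩ := exists_int_lt ((X i j).order - (q m₁ m₂ a - 1))
    refine ⟨B, fun n hn => ?_⟩
    have h1 := HahnSeries.order_le_of_coeff_ne_zero (right_ne_zero_of_mul hn)
    have h2 : (B : ℚ) < n := by linarith
    exact_mod_cast h2.le
  refine ⟨of fun i j => HahnSeries.ofSuppBddBelow _ (hbdd i j), ?_⟩
  ext i j : 2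
  funext ρ
  rw [Matrix.smul_apply, smul_eq_mul, coeff_zPow_mul, map_apply, of_apply]
  by_cases hρ : ∃ n : ℤ, ρ + (1 - q m₁ m₂ a) = n
  · obtain ⟨n, hn⟩ := hρ
    rw [hn, coeff_ofLaurentZ, HahnSeries.coeff_ofSuppBddBelow, ← hcoeff]
    congr 1
    linarith
  · rw [coeff_ofLaurentZ_eq_zero _ fun n hn => hρ ⟨n, hn⟩]
    by_contra hne
    obtain ⟨n, hn⟩ := exists_exponent_eq m₁ m₂ a hne
    exact hρ ⟨n, by linarith⟩

theorem isNormalizedSolution_solution (ha : 1 ≤ a) (ha' : a < m₁ + m₂) :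
    IsNormalizedSolution m₁ m₂ a (solution m₁ m₂ a) := by
  refine ⟨isTDESolution_solution m₁ m₂ a, ?_⟩
  obtain ⟨N, hN⟩ := exists_laurent_solution m₁ m₂ a
  have hcoeff : ∀ i j (n : ℤ), ofRat ((N i j).coeff n) =
      (solution m₁ m₂ a i j).coeff (q m₁ m₂ a - 1 + n) := by
    intro i j n
    rw [hN, Matrix.smul_apply, smul_eq_mul, coeff_zPow_mul, map_apply, ← coeff_ofLaurentZ]
    congr 1
    ring
  refine ⟨N, hN, fun i j n hn => ?_⟩
  rw [HahnSeries.coeff_sub, coeff_K_laurent m₁ m₂ a ha', sub_eq_zero]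
  apply ofRat.injective
  rw [hcoeff]
  split_ifs with h0
  · rw [h0, Int.cast_zero, add_zero, coeff_solution m₁ m₂ a ha ha', map_K_apply m₁ m₂ a ofRat ha']
  · rw [map_zero]
    apply vanishesBelow_solution m₁ m₂ a ha ha'
    have : (n : ℚ) < 0 := by
      have : n < 0 := by omega
      exact_mod_cast this
    linarith

theorem q_pos (ha : 1 ≤ a) (ha' : a < m₁ + m₂) : 0 < q m₁ m₂ a := by
  rw [q]
  split_ifs
  · exact div_pos (Nat.cast_pos.2 ha) (Nat.cast_pos.2 (NeZero.pos m₁))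
  · have : (a : ℚ) < m₁ + m₂ := by exact_mod_cast ha'
    exact div_pos (by linarith) (Nat.cast_pos.2 (NeZero.pos m₂))

theorem IsNormalizedSolution.unique (ha : 1 ≤ a) (ha' : a < m₁ + m₂)
    {M M' : Matrix (Fin (m₁ + m₂)) (Fin (m₁ + m₂)) ZSeries} (h : IsNormalizedSolution m₁ m₂ a M)
    (h' : IsNormalizedSolution m₁ m₂ a M') : M' = M := by
  obtain ⟨hM, N, rfl, hN⟩ := h
  obtain ⟨hM', N', rfl, hN'⟩ := h'
  rw [← sub_eq_zero]
  refine (isWaveSystem_wave m₁ m₂).eq_zero_of_isTDESolution ?_ (q_pos m₁ m₂ a ha ha')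
    fun i j ρ hρ => ?_
  · have e : ∀ A B : Matrix (Fin (m₁ + m₂)) (Fin (m₁ + m₂)) ZSeries,
        (A - B).map (shift (-1)) = A.map (shift (-1)) - B.map (shift (-1)) := fun A B =>
      Matrix.map_sub _ (map_sub (shiftHom (-1))) A B
    rw [IsTDESolution] at *
    rw [e, Matrix.sub_mul, hM, hM', Matrix.mul_sub]
  · rw [Matrix.sub_apply, HahnSeries.coeff_sub, Matrix.smul_apply, Matrix.smul_apply, smul_eq_mul,
      smul_eq_mul, coeff_zPow_mul, coeff_zPow_mul, map_apply, map_apply]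
    by_cases hn : ∃ n : ℤ, ρ + (1 - q m₁ m₂ a) = n
    · obtain ⟨n, hn⟩ := hn
      have h1 : n < 1 := by
        have : (n : ℚ) < 1 := by linarith
        exact_mod_cast this
      have h2 := hN i j n h1
      have h3 := hN' i j n h1
      rw [HahnSeries.coeff_sub, sub_eq_zero] at h2 h3
      rw [hn, coeff_ofLaurentZ, coeff_ofLaurentZ, h2, h3, sub_self]
    · rw [coeff_ofLaurentZ_eq_zero _ fun n h => hn ⟨n, h⟩,
        coeff_ofLaurentZ_eq_zero _ fun n h => hn ⟨n, h⟩, sub_self]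

end

noncomputable section

open Matrix

variable (m₁ m₂ : ℕ)

/-! ### The matrix `Ψ` with its symbols -/

/-- The index of the symbol of `ψ_j(z, s)`. -/
def symbol (j : Fin (m₁ + m₂)) : ℂ × ℚ × ℚ :=
  if (j : ℕ) + 1 ≤ m₁ then symbolA m₁ (branch m₁ m₂ j) else symbolB m₂ (branch m₁ m₂ j)

/-- The diagonal matrix of the symbols of the columns of `Ψ`. -/
def symbolMatrix : Matrix (Fin (m₁ + m₂)) (Fin (m₁ + m₂)) FormalFun :=
  diagonal fun j => AddMonoidAlgebra.single (symbol m₁ m₂ j) 1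

theorem isUnit_single (σ : ℂ × ℚ × ℚ) : IsUnit (AddMonoidAlgebra.single σ 1 : FormalFun) := by
  refine IsUnit.of_mul_eq_one (AddMonoidAlgebra.single (-σ) 1) ?_
  rw [AddMonoidAlgebra.single_mul_single, add_neg_cancel, one_mul]
  rfl

theorem isUnit_det_symbolMatrix : IsUnit (symbolMatrix m₁ m₂).det := by
  rw [symbolMatrix, det_diagonal, IsUnit.prod_univ_iff]
  exact fun j => isUnit_single _

variable [NeZero m₁] [NeZero m₂]

theorem Psi_eq : Psi m₁ m₂ =
    (reducedPsi m₁ m₂).map (algebraMap ZSeries FormalFun) * symbolMatrix m₁ m₂ := by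
  ext1 i j
  have hc : -(m₁ : ℚ) + ((i : ℕ) + 1) = (rowShift m₁ i : ℤ) := by
    simp only [rowShift]
    push_cast
    ring
  have key : psi m₁ m₂ ((j : ℕ) + 1) (-(m₁ : ℚ) + ((i : ℕ) + 1)) =
      AddMonoidAlgebra.single (symbol m₁ m₂ j) (wave m₁ m₂ j (rowShift m₁ i)) := by
    rw [psi, symbol, wave, branch, hc]
    split_ifs
    · rw [psiA_eq]
      push_cast
      rw [add_sub_cancel_right]
    · rw [psiB_eq]
      push_cast
      rfl
  rw [symbolMatrix, mul_diagonal, map_apply]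
  refine key.trans ?_
  have h : algebraMap ZSeries FormalFun (reducedPsi m₁ m₂ i j) =
      AddMonoidAlgebra.single 0 (reducedPsi m₁ m₂ i j) := rfl
  rw [h, AddMonoidAlgebra.single_mul_single, zero_add, mul_one]
  rfl

theorem isUnit_det_Psi : IsUnit (Psi m₁ m₂).det := by
  rw [Psi_eq, det_mul, ← RingHom.mapMatrix_apply, ← RingHom.map_det]
  exact ((isUnit_det_reducedPsi m₁ m₂).map _).mul (isUnit_det_symbolMatrix m₁ m₂)

variable (a : ℕ)

theorem P_eq : P m₁ m₂ a =
    (diagonal fun j => HahnSeries.C (eigenvalue m₁ m₂ a j)).map (algebraMap ZSeries FormalFun) := by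
  have h₁ := ratCast_ne_zero m₁
  have h₂ := ratCast_ne_zero m₂
  have hexp : ∀ (m : ℕ) (n : ℤ),
      Complex.exp (2 * Real.pi * Complex.I / m) ^ n = cexp2 (n / m) := by
    intro m n
    rw [← Complex.exp_int_mul, cexp2]
    congr 1
    push_cast
    ring
  rw [P, diagonal_map (map_zero _)]
  congr 1
  funext i
  congr 2
  simp only [hexp]
  rw [eigenvalue, eigenConst, q, branch]
  by_cases ha : a ≤ m₁ <;> by_cases hi : (i : ℕ) + 1 ≤ m₁
  · simp only [ha, hi, if_true, one_mul]
    congr 3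
    push_cast
    ring
  · simp only [ha, hi, if_true, if_false]
    simp
  · simp only [ha, hi, if_true, if_false]
    simp
  · simp only [ha, hi, if_false, if_true, map_neg, neg_mul]
    congr 3
    · rw [one_mul]
      congr 1
      push_cast
      ring
    · field_simp
      ring

theorem map_solution : (solution m₁ m₂ a).map (algebraMap ZSeries FormalFun) =
    Psi m₁ m₂ * P m₁ m₂ a * (Psi m₁ m₂)⁻¹ := by
  have h : (solution m₁ m₂ a).map (algebraMap ZSeries FormalFun) * Psi m₁ m₂ =
      Psi m₁ m₂ * P m₁ m₂ a := by
    have hcomm : symbolMatrix m₁ m₂ * P m₁ m₂ a = P m₁ m₂ a * symbolMatrix m₁ m₂ := by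
      rw [symbolMatrix, P, diagonal_mul_diagonal, diagonal_mul_diagonal]
      simp only [mul_comm]
    rw [Psi_eq, Matrix.mul_assoc _ (symbolMatrix m₁ m₂), hcomm, P_eq, ← Matrix.mul_assoc,
      ← Matrix.mul_assoc, ← Matrix.map_mul, ← Matrix.map_mul, solution_mul]
  rw [← h, Matrix.mul_assoc, mul_nonsing_inv _ (isUnit_det_Psi m₁ m₂), Matrix.mul_one]

end

end OrbifoldTDE

theorem mainTheorem4 (m₁ m₂ : ℕ) [NeZero m₁] [NeZero m₂] (a : ℕ) (ha : 1 ≤ a)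
    (ha' : a < m₁ + m₂) :
    IsUnit (OrbifoldTDE.Psi m₁ m₂).det ∧
      ∃ M : Matrix (Fin (m₁ + m₂)) (Fin (m₁ + m₂)) OrbifoldTDE.ZSeries,
        OrbifoldTDE.IsNormalizedSolution m₁ m₂ a M ∧
        (∀ M', OrbifoldTDE.IsNormalizedSolution m₁ m₂ a M' → M' = M) ∧
        M.map (algebraMap OrbifoldTDE.ZSeries OrbifoldTDE.FormalFun) =
          OrbifoldTDE.Psi m₁ m₂ * OrbifoldTDE.P m₁ m₂ a * (OrbifoldTDE.Psi m₁ m₂)⁻¹ := by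
  have h := OrbifoldTDE.isNormalizedSolution_solution m₁ m₂ a ha ha'
  exact ⟨OrbifoldTDE.isUnit_det_Psi m₁ m₂, OrbifoldTDE.solution m₁ m₂ a, h,
    fun M' h' => h.unique m₁ m₂ a ha ha' h', OrbifoldTDE.map_solution m₁ m₂ a⟩
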